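/- Let $N\ge 2$ and let $\Omega\subset\mathbb R^N$ be open and bounded. **Coefficients.** Let $a\in C([0,\infty))$ with $a(0)=0$ and $a>0$ on $(0,\infty)$, and let $h\in C((0,\infty))\cap L^1_{loc}([0,\infty))$ with $h>0$ on $(0,\infty)$. Put $H(v)=\int_0^v h(r)\,dr$ and $F(v)=h(v)a(v)$ (with $F(0)=0$), and suppose that $F$ is locally Lipschitz and nondecreasing on $[0,\infty)$. **Assumptions.** Let $p_1,q_1,\gamma_1,c_3,c_5>0$ and $\beta_1>\beta_2>q_1/2$. Suppose that for all $s\in[0,\infty)$ the following derivatives exist (one-sided at $s=0$) and $$[H^{p_1}F]'(s)\ \ge\ c_3\,H(s)^{q_1},\qquad [H^{\gamma_1+1}]'(s)\ \le\ c_5\big(H(s)^{\beta_1}+H(s)^{\beta_2}\big).$$ Let $\delta_1=\frac{p_1+1}{\gamma_1+1}$ and suppose $1\le\delta_1<2$. Let $\delta_2=1$ if $\delta_1\le\frac{N}{N-1}$, and $\delta_2=\frac{\delta_1N}{N+\delta_1}$ if $\frac N{N-1}<\delta_1<2$. Put $$p_2=\Big(\beta_1-\frac{q_1}2\Big)\frac{2\delta_2}{2-\delta_2},\qquad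 p_3=\Big(\beta_2-\frac{q_1}2\Big)\frac{2\delta_2}{2-\delta_2}.$$ **Solutions.** Let $t_0\in\mathbb R$ and let $u$ be a nonnegative (possibly unbounded) strong solution of $$[H(u)]_t-F(u)\Delta u\le 0\ \text{ in }\Omega\times(t_0,\infty),\qquad u(\cdot,t_0)=u_0\ \text{ in }\Omega,\qquad u=0\ \text{ on }\partial\Omega\times(t_0,\infty).$$ This means the following: $u$ is measurable on $\Omega\times(t_0,\infty)$ and $u(\cdot,t)\ge0$ a.e. in $\Omega$ for every $t\ge t_0$. There is a function $[H(u)]_t\in L^2(\Omega\times(t_0,\infty))$ such that for every $t\ge t_0$, $H(u(x,t))=H(u_0(x))+\int_{t_0}^t[H(u)]_t(x,s)\,ds$ for a.e. $x\in\Omega$. For a.e. $t>t_0$ one has $u(\cdot,t)\in W^{1,1}_0(\Omega)$, and the distributional Laplacian $\Delta u(\cdot,t)$ belongs to $L^1_{loc}(\Omega)$. Moreover $F(u)\Delta u\in L^2(\Omega\times(t_0,\infty))$, and the differential inequality holds a.e. in $\Omega\times(t_0,\infty)$. Suppose in addition that $H(u_0)\in L^{p_1+1}(\Omega)$ and that $H(u(\cdot,t))^{p_1}F(u(\cdot,t))\in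 W^{1,2}_0(\Omega)$ for a.e. $t>t_0$. For $t\ge t_0$ define $$Y(t)=\int_\Omega H(u(x,t))^{p_1+1}dx,\quad Z_1(t)=\int_\Omega H(u(x,t))^{p_2}dx,\quad Z_2(t)=\int_\Omega H(u(x,t))^{p_3}dx,$$ where $Z_1(t),Z_2(t)\in[0,\infty]$. **Conclusion.** $Y$ is finite and nonincreasing on $[t_0,\infty)$. There exists $K>0$, depending only on $N,\Omega,p_1,q_1,\gamma_1,\beta_1,\beta_2,c_3,c_5$ (and not on $a,h,t_0,u_0,u$), such that for a.e. $t>t_0$ the derivative $Y'(t)$ exists and $$Y'(t)+\frac{K}{\big[Z_1(t)+Z_2(t)+1\big]^{\frac{2-\delta_2}{\delta_2}}}\,[Y(t)]^{\frac2{\delta_1}}\ \le\ 0,$$ where the fraction is read as $0$ if $Z_1(t)+Z_2(t)=\infty$. -/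

import Mathlib

open MeasureTheory Set Filter Topology
open scoped ENNReal ContDiff Gradient

noncomputable section

namespace DegenerateEinstein

/-- The ambient space `ℝ^N` with its Euclidean norm. -/
abbrev E (N : ℕ) : Type := EuclideanSpace ℝ (Fin N)

/-- `H(v) = ∫₀^v h(r) dr`. -/
def H (h : ℝ → ℝ) (v : ℝ) : ℝ := ∫ r in (0 : ℝ)..v, h r

/-- `F(v) = h(v) a(v)`. -/
def F (h a : ℝ → ℝ) (v : ℝ) : ℝ := h v * a v

/-- Standing conditions on the diffusion coefficient `a` and the weight `h`
(`F(0) = 0` and `H(0) = 0` are automatic). -/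
structure IsAdmissible (h a : ℝ → ℝ) : Prop where
  a_continuousOn : ContinuousOn a (Ici 0)
  a_zero : a 0 = 0
  a_pos : ∀ s, 0 < s → 0 < a s
  h_pos : ∀ s, 0 < s → 0 < h s
  h_continuousOn : ContinuousOn h (Ioi 0)
  h_locallyIntegrableOn : LocallyIntegrableOn h (Ici 0)
  F_locallyLipschitzOn : LocallyLipschitzOn (Ici 0) (F h a)
  F_monotoneOn : MonotoneOn (F h a) (Ici 0)

/-- `[H^{p₁} F]' ≥ c₃ H^{q₁}` on `[0, ∞)` (one-sided derivative at `0`). -/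
def LowerGrowth (h a : ℝ → ℝ) (p₁ q₁ c₃ : ℝ) : Prop :=
  DifferentiableOn ℝ (fun s => H h s ^ p₁ * F h a s) (Ici 0) ∧
    ∀ s ∈ Ici (0 : ℝ),
      c₃ * H h s ^ q₁ ≤ derivWithin (fun s => H h s ^ p₁ * F h a s) (Ici 0) s

/-- `[H^{γ₁+1}]' ≤ c₅ (H^{β₁} + H^{β₂})` on `[0, ∞)` (one-sided derivative at `0`). -/
def UpperGrowth (h : ℝ → ℝ) (γ₁ β₁ β₂ c₅ : ℝ) : Prop :=
  DifferentiableOn ℝ (fun s => H h s ^ (γ₁ + 1)) (Ici 0) ∧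
    ∀ s ∈ Ici (0 : ℝ),
      derivWithin (fun s => H h s ^ (γ₁ + 1)) (Ici 0) s ≤
        c₅ * (H h s ^ β₁ + H h s ^ β₂)

/-- Test functions: `φ ∈ C_c^∞(Ω)`. -/
def IsTestFunction {N : ℕ} (Ω : Set (E N)) (φ : E N → ℝ) : Prop :=
  ContDiff ℝ ∞ φ ∧ HasCompactSupport φ ∧ tsupport φ ⊆ Ω

/-- `f ∈ W^{1,q}_0(Ω)`: `f` is a limit of test functions in the norm of `W^{1,q}(Ω)`.
The limit `g` of the gradients is the weak gradient of `f`. -/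
def MemW0 {N : ℕ} (q : ℝ≥0∞) (Ω : Set (E N)) (f : E N → ℝ) : Prop :=
  MemLp f q (volume.restrict Ω) ∧
    ∃ g : E N → E N, MemLp g q (volume.restrict Ω) ∧
      ∃ φ : ℕ → E N → ℝ, (∀ k, IsTestFunction Ω (φ k)) ∧
        Tendsto (fun k => eLpNorm (fun x => φ k x - f x) q (volume.restrict Ω))
          atTop (𝓝 0) ∧
        Tendsto (fun k => eLpNorm (fun x => ∇ (φ k) x - g x) q (volume.restrict Ω))
          atTop (𝓝 0)

/-- `Δ f = L` in the sense of distributions on `Ω`, with `f, L ∈ L¹_loc(Ω)`. -/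
def HasWeakLaplacian {N : ℕ} (Ω : Set (E N)) (f L : E N → ℝ) : Prop :=
  LocallyIntegrableOn f Ω ∧ LocallyIntegrableOn L Ω ∧
    ∀ φ : E N → ℝ, IsTestFunction Ω φ →
      ∫ x in Ω, f x * Laplacian.laplacian φ x = ∫ x in Ω, L x * φ x

/-- Lebesgue measure on the space-time cylinder `Ω × (t₀, ∞)`. -/
def cylinder {N : ℕ} (Ω : Set (E N)) (t₀ : ℝ) : Measure (E N × ℝ) :=
  (volume.restrict Ω).prod (volume.restrict (Ioi t₀))

/-- `u` is a nonnegative (possibly unbounded) strong solution of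
`[H(u)]_t - F(u) Δu ≤ 0` in `Ω × (t₀, ∞)`, `u(·, t₀) = u₀` in `Ω`,
`u = 0` on `∂Ω × (t₀, ∞)`.
Here `v = [H(u)]_t ∈ L²(Ω × (t₀, ∞))`, in the sense that `H(u)` is the time primitive
of `v`; `L = Δu` is the distributional Laplacian at almost every time, with
`F(u) Δu ∈ L²(Ω × (t₀, ∞))`; the inequality holds almost everywhere; and the boundary
condition reads `u(·, t) ∈ W^{1,1}_0(Ω)` for almost every `t`. -/
def IsStrongSolution {N : ℕ} (h a : ℝ → ℝ) (Ω : Set (E N)) (t₀ : ℝ)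
    (u₀ : E N → ℝ) (u : E N → ℝ → ℝ) : Prop :=
  AEStronglyMeasurable (fun z : E N × ℝ => u z.1 z.2) (cylinder Ω t₀) ∧
  (∀ t, t₀ ≤ t → ∀ᵐ x ∂volume.restrict Ω, 0 ≤ u x t) ∧
  (∀ᵐ x ∂volume.restrict Ω, u x t₀ = u₀ x) ∧
  (∀ᵐ t ∂volume.restrict (Ioi t₀), MemW0 1 Ω (fun x => u x t)) ∧
  ∃ v L : E N → ℝ → ℝ,
    MemLp (fun z : E N × ℝ => v z.1 z.2) 2 (cylinder Ω t₀) ∧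
    (∀ t, t₀ ≤ t → ∀ᵐ x ∂volume.restrict Ω,
      H h (u x t) = H h (u x t₀) + ∫ s in t₀..t, v x s) ∧
    (∀ᵐ t ∂volume.restrict (Ioi t₀),
      HasWeakLaplacian Ω (fun x => u x t) (fun x => L x t)) ∧
    MemLp (fun z : E N × ℝ => F h a (u z.1 z.2) * L z.1 z.2) 2 (cylinder Ω t₀) ∧
    ∀ᵐ z ∂cylinder Ω t₀, v z.1 z.2 - F h a (u z.1 z.2) * L z.1 z.2 ≤ 0

/-- `δ₁ = (p₁ + 1) / (γ₁ + 1)`. -/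
def delta1 (p₁ γ₁ : ℝ) : ℝ := (p₁ + 1) / (γ₁ + 1)

/-- `δ₂ = 1` if `δ₁ ≤ N / (N - 1)`, and `δ₂ = δ₁ N / (N + δ₁)` otherwise. -/
def delta2 (N : ℕ) (δ₁ : ℝ) : ℝ :=
  if δ₁ ≤ (N : ℝ) / ((N : ℝ) - 1) then 1 else δ₁ * N / (N + δ₁)

/-- `Y(t) = ∫_Ω H(u(x,t))^{p₁+1} dx`. -/
def Y {N : ℕ} (h : ℝ → ℝ) (Ω : Set (E N)) (p₁ : ℝ) (u : E N → ℝ → ℝ) (t : ℝ) : ℝ :=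
  ∫ x in Ω, H h (u x t) ^ (p₁ + 1)

/-- The exponent `(β - q₁/2) · 2δ₂ / (2 - δ₂)`. -/
def zExponent (β q₁ δ₂ : ℝ) : ℝ := (β - q₁ / 2) * (2 * δ₂ / (2 - δ₂))

/-- `Z(t) = ∫_Ω H(u(x,t))^p dx`, with values in `[0, ∞]`. -/
def Z {N : ℕ} (h : ℝ → ℝ) (Ω : Set (E N)) (p : ℝ) (u : E N → ℝ → ℝ) (t : ℝ) : ℝ≥0∞ :=
  ∫⁻ x in Ω, ENNReal.ofReal (H h (u x t) ^ p)

end DegenerateEinstein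

end

/-! Formally, multiply the inequality by (p₁+1) H(u)^{p₁} and integrate by parts: Y' ≤ -(p₁+1) ∫
[H^{p₁}F]'(u) |∇u|² ≤ -c₃ D, where D = ∫ H(u)^{q₁} |∇u|². It remains to bound Y^{2/δ₁} by D times a
power of Z₁ + Z₂ (`exists_moment_bound`). The Sobolev inequality W^{1,1} → L^{N/(N-1)} is applied to
H(u)^κ with κ = γ₁ + 1 + (p₁+1)(1 - 1/δ₂). By the upper growth condition the gradient of this power
is at most a constant times H^{(p₁+1)(1-1/δ₂)} (H^{β₁} + H^{β₂}) |∇u|, and Hölder with weights 1 -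
1/δ₂, (2-δ₂)/(2δ₂), 1/2 produces powers of Y, Z₁ + Z₂ and D. The choice of δ₂ makes the power of Y
either trivial or absorbable on the left, leaving Y^{1/δ₁} ≤ C (Z₁+Z₂)^{(2-δ₂)/(2δ₂)} D^{1/2}.

The labour lies in the integration by parts. At a fixed time u is only in W^{1,1}_0, Δu only in
L¹_loc, and G = H^{p₁}F need not be C¹. Mollification gives an energy inequality with an interior
cutoff (`lintegral_energy_le`); only an inequality is needed, so Fatou suffices for the quadratic
term. Cutoffs reaching the boundary are made from the test functions that approximate G(u) in
W^{1,2}. On {G(u) > ε} a chain rule proved by difference quotients (`SobolevPair.chain_rule`) bounds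
|∇u| by a multiple of |∇G(u)|, so the cutoff error vanishes (`SpatialData.energy_le_of_cut`).
Truncating the nonlinearity at small and large values then removes ε (`SpatialData.energy_le`).

Because u may be unbounded, H^{p₁} is replaced by (H/(1+H/K))^{p₁} ≤ K^{p₁}. This makes the product
with F(u)Δu integrable, and gives a Lipschitz primitive, hence a chain rule along the absolutely
continuous paths t ↦ H(u(x,t)). Fatou as K → ∞ yields an integrated energy inequality in [0,∞]
(`EvolutionData.energy_le`). Finiteness and monotonicity of Y follow at once, and the differential
inequality by differentiating almost everywhere (`ae_deriv_add_le`). -/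

noncomputable section

namespace DegenerateEinstein

/-! ### L¹ convergence with moving majorants -/

variable {N : ℕ}

/-- Dominated convergence in `L¹` with a convergent sequence of dominating functions. -/
theorem tendsto_integral_norm_sub_of_dominated_seq {α F : Type*} [MeasurableSpace α]
    [NormedAddCommGroup F] {μ : Measure α}
    {u : ℕ → α → F} {u₀ : α → F} {G : ℕ → α → ℝ} {G₀ : α → ℝ}
    (hu : ∀ n, AEStronglyMeasurable (u n) μ) (hu₀ : AEStronglyMeasurable u₀ μ)
    (hG : ∀ n, Integrable (G n) μ) (hG₀ : Integrable G₀ μ)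
    (hle : ∀ n, ∀ᵐ x ∂μ, ‖u n x‖ ≤ G n x)
    (hlim : ∀ᵐ x ∂μ, Tendsto (fun n => u n x) atTop (𝓝 (u₀ x)))
    (hGlim : ∀ᵐ x ∂μ, Tendsto (fun n => G n x) atTop (𝓝 (G₀ x)))
    (hGint : Tendsto (fun n => ∫ x, G n x ∂μ) atTop (𝓝 (∫ x, G₀ x ∂μ))) :
    Tendsto (fun n => ∫ x, ‖u n x - u₀ x‖ ∂μ) atTop (𝓝 0) := by
  have hle' : ∀ᵐ x ∂μ, ∀ n, ‖u n x‖ ≤ G n x := ae_all_iff.2 hle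
  have hu₀G : ∀ᵐ x ∂μ, ‖u₀ x‖ ≤ G₀ x := by
    filter_upwards [hle', hlim, hGlim] with x h1 h2 h3
    exact le_of_tendsto_of_tendsto' h2.norm h3 h1
  have hum : ∀ n, AEStronglyMeasurable (fun x => ‖u n x - u₀ x‖) μ :=
    fun n => ((hu n).sub hu₀).norm
  -- Since ‖u n - u₀‖ ≤ G n + G₀, the error is at most min(‖u n - u₀‖, 2 G₀) + max(G₀ - G n, 0) + (G
  -- n - G₀). The first two terms are dominated by fixed integrable functions; the last one tends to
  -- zero in integral by hypothesis.
  have h1 : Tendsto (fun n => ∫ x, min ‖u n x - u₀ x‖ (2 * G₀ x) ∂μ) atTop (𝓝 (∫ _, (0 : ℝ) ∂μ)) := by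
    refine tendsto_integral_of_dominated_convergence (fun x => 2 * |G₀ x|) ?_
      (hG₀.abs.const_mul 2) ?_ ?_
    · intro n
      exact (hum n).inf (hG₀.1.const_mul 2)
    · intro n
      filter_upwards [hu₀G] with x hx
      have h0 : 0 ≤ G₀ x := (norm_nonneg _).trans hx
      rw [Real.norm_eq_abs, abs_of_nonneg (le_min (norm_nonneg _) (by positivity)),
        abs_of_nonneg h0]
      exact min_le_right _ _
    · filter_upwards [hlim, hu₀G] with x hx hx0
      have h0 : 0 ≤ G₀ x := (norm_nonneg _).trans hx0
      have : Tendsto (fun n => ‖u n x - u₀ x‖) atTop (𝓝 0) := by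
        simpa using (hx.sub_const (u₀ x)).norm
      have h2 := this.min (tendsto_const_nhds (x := 2 * G₀ x))
      rwa [min_eq_left (by positivity)] at h2
  have h2 : Tendsto (fun n => ∫ x, max (G₀ x - G n x) 0 ∂μ) atTop (𝓝 (∫ _, (0 : ℝ) ∂μ)) := by
    refine tendsto_integral_of_dominated_convergence (fun x => |G₀ x|) ?_ hG₀.abs ?_ ?_
    · intro n
      exact (hG₀.1.sub (hG n).1).sup aestronglyMeasurable_const
    · intro n
      filter_upwards [hu₀G, hle'] with x hx hx'
      have h0 : 0 ≤ G₀ x := (norm_nonneg _).trans hx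
      have h0' : 0 ≤ G n x := (norm_nonneg _).trans (hx' n)
      rw [Real.norm_eq_abs, abs_of_nonneg (le_max_right _ _), abs_of_nonneg h0]
      exact max_le (by linarith) h0
    · filter_upwards [hGlim] with x hx
      have h3 := ((tendsto_const_nhds (x := G₀ x)).sub hx).max (tendsto_const_nhds (x := (0 : ℝ)))
      simpa using h3
  have h3 : Tendsto (fun n => ∫ x, G n x ∂μ - ∫ x, G₀ x ∂μ) atTop (𝓝 0) := by
    simpa using hGint.sub_const (∫ x, G₀ x ∂μ)
  have hsum := (h1.add h2).add h3
  simp only [integral_zero, add_zero] at hsum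
  have hint : ∀ n, Integrable (fun x => ‖u n x - u₀ x‖) μ := by
    intro n
    refine ((hG n).add hG₀).mono' (hum n) ?_
    filter_upwards [hu₀G, hle'] with x hx hx'
    rw [norm_norm]
    exact (norm_sub_le _ _).trans (add_le_add (hx' n) hx)
  have hmin : ∀ n, Integrable (fun x => min ‖u n x - u₀ x‖ (2 * G₀ x)) μ :=
    fun n => (hint n).inf (hG₀.const_mul 2)
  have hmax : ∀ n, Integrable (fun x => max (G₀ x - G n x) 0) μ :=
    fun n => (hG₀.sub (hG n)).sup (integrable_zero _ _ _)
  refine squeeze_zero (fun n => integral_nonneg fun x => norm_nonneg _) (fun n => ?_) hsum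
  rw [← integral_sub (hG n) hG₀, ← integral_add (hmin n) (hmax n),
    ← integral_add (by exact (hmin n).add (hmax n)) (by exact (hG n).sub hG₀)]
  refine integral_mono_ae (hint n) (((hmin n).add (hmax n)).add ((hG n).sub hG₀)) ?_
  filter_upwards [hu₀G, hle'] with x hx hx'
  have h4 : ‖u n x - u₀ x‖ ≤ G n x + G₀ x :=
    (norm_sub_le _ _).trans (add_le_add (hx' n) hx)
  rcases min_cases ‖u n x - u₀ x‖ (2 * G₀ x) with h | h <;>
    rcases max_cases (G₀ x - G n x) 0 with h' | h' <;> linarith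

/-! ### Mollification -/

variable {N : ℕ}

/-- A shrinking sequence of smooth bump functions. -/
def bump (N n : ℕ) : ContDiffBump (0 : E N) where
  rIn := 1 / (2 * ((n : ℝ) + 1))
  rOut := 1 / ((n : ℝ) + 1)
  rIn_pos := by positivity
  rIn_lt_rOut := by
    apply one_div_lt_one_div_of_lt <;> nlinarith [(Nat.cast_nonneg n : (0 : ℝ) ≤ n)]

/-- The standard mollifier. -/
def rho (N n : ℕ) : E N → ℝ := (bump N n).normed volume

theorem bump_rOut_tendsto (N : ℕ) : Tendsto (fun n => (bump N n).rOut) atTop (𝓝 0) :=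
  tendsto_one_div_add_atTop_nhds_zero_nat

theorem rho_contDiff (n : ℕ) : ContDiff ℝ ∞ (rho N n) := (bump N n).contDiff_normed

theorem rho_hasCompactSupport (n : ℕ) : HasCompactSupport (rho N n) :=
  (bump N n).hasCompactSupport_normed

theorem rho_nonneg (n : ℕ) (x : E N) : 0 ≤ rho N n x := (bump N n).nonneg_normed x

theorem rho_neg (n : ℕ) (x : E N) : rho N n (-x) = rho N n x := (bump N n).normed_neg x

theorem rho_integral (n : ℕ) : ∫ x, rho N n x = 1 := (bump N n).integral_normed

theorem rho_integrable (n : ℕ) : Integrable (rho N n) := (bump N n).integrable_normed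

variable {V : Type*} [NormedAddCommGroup V] [InnerProductSpace ℝ V]

/-- Mollification. -/
def moll (n : ℕ) (u : E N → V) : E N → V :=
  MeasureTheory.convolution (rho N n) u (ContinuousLinearMap.lsmul ℝ ℝ) volume

theorem moll_apply (n : ℕ) (u : E N → V) (x : E N) :
    moll n u x = ∫ t, rho N n t • u (x - t) := rfl

theorem moll_apply_swap (n : ℕ) (u : E N → V) (x : E N) :
    moll n u x = ∫ t, rho N n (x - t) • u t :=
  convolution_lsmul_swap

theorem integrable_moll {u : E N → V} (hu : Integrable u) (n : ℕ) : Integrable (moll n u) :=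
  (rho_integrable n).integrable_convolution _ hu

theorem moll_integral [CompleteSpace V] {u : E N → V} (hu : Integrable u) (n : ℕ) :
    ∫ x, moll n u x = ∫ x, u x := by
  have := integral_convolution (ContinuousLinearMap.lsmul ℝ ℝ) (rho_integrable (N := N) n) hu
  rw [rho_integral] at this
  simpa [moll] using this

theorem moll_tendsto_ae [CompleteSpace V] {u : E N → V} (hu : Integrable u) :
    ∀ᵐ x, Tendsto (fun n => moll n u x) atTop (𝓝 (u x)) := by
  -- The outer radius is exactly twice the inner one, whence `K := 2`; a bounded ratio of radii is
  -- what convergence at Lebesgue points requires.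
  refine ContDiffBump.ae_convolution_tendsto_right_of_locallyIntegrable (K := 2)
    (bump_rOut_tendsto N) (Eventually.of_forall fun n => ?_) hu.locallyIntegrable
  change 1 / ((n : ℝ) + 1) ≤ 2 * (1 / (2 * ((n : ℝ) + 1)))
  apply le_of_eq
  field_simp

theorem norm_moll_le (u : E N → V) (n : ℕ) (x : E N) :
    ‖moll n u x‖ ≤ moll n (fun y => ‖u y‖) x := by
  rw [moll_apply, moll_apply]
  refine (norm_integral_le_integral_norm _).trans_eq ?_
  congr 1
  ext t
  rw [norm_smul, Real.norm_of_nonneg (rho_nonneg n t), smul_eq_mul]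

/-- The mollified norms are moving majorants: they converge almost everywhere to ‖u‖ and all have
the same integral. -/
theorem moll_tendsto_L1 [CompleteSpace V] {u : E N → V} (hu : Integrable u) :
    Tendsto (fun n => ∫ x, ‖moll n u x - u x‖) atTop (𝓝 0) := by
  refine tendsto_integral_norm_sub_of_dominated_seq (G := fun n => moll n (fun y => ‖u y‖))
    (G₀ := fun y => ‖u y‖) (fun n => (integrable_moll hu n).1) hu.1
    (fun n => integrable_moll hu.norm n) hu.norm
    (fun n => Eventually.of_forall fun x => norm_moll_le u n x) (moll_tendsto_ae hu)
    (moll_tendsto_ae hu.norm) ?_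
  simp_rw [moll_integral hu.norm]
  exact tendsto_const_nhds

/-- Fubini and the evenness of the kernel make mollification self-adjoint. -/
theorem moll_inner_swap [CompleteSpace V] {u v : E N → V} (hu : Integrable u) (hv : AEStronglyMeasurable v)
    {C : ℝ} (hC : ∀ x, ‖v x‖ ≤ C) (n : ℕ) :
    ∫ x, inner ℝ (moll n u x) (v x) = ∫ x, inner ℝ (u x) (moll n v x) := by
  have hρ : Continuous (rho N n) := (rho_contDiff n).continuous
  have h1 : Integrable (fun p : E N × E N => rho N n (p.1 - p.2) • u p.2)
      (volume.prod volume) := by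
    have := Integrable.convolution_integrand (ContinuousLinearMap.lsmul ℝ ℝ).flip
      (μ := volume) (ν := volume) hu (rho_integrable (N := N) n)
    simpa using this
  have h2 : Integrable (fun p : E N × E N => inner ℝ (rho N n (p.1 - p.2) • u p.2) (v p.1))
      (volume.prod volume) := by
    refine (h1.norm.mul_const C).mono' (h1.1.inner hv.comp_fst) ?_
    refine Eventually.of_forall fun p => ?_
    refine (norm_inner_le_norm _ _).trans ?_
    exact mul_le_mul_of_nonneg_left (hC _) (norm_nonneg _)
  have e1 : ∀ᵐ x, inner ℝ (moll n u x) (v x)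
      = ∫ t, inner ℝ (rho N n (x - t) • u t) (v x) := by
    filter_upwards [h1.prod_right_ae] with x hx
    rw [moll_apply_swap, real_inner_comm, ← integral_inner hx]
    simp_rw [real_inner_comm (v x)]
  rw [integral_congr_ae e1, integral_integral_swap h2]
  congr 1
  ext t
  rw [moll_apply_swap]
  have : Integrable (fun x => rho N n (t - x) • v x) := by
    have h3 : Integrable (fun x => rho N n (t - x)) := (rho_integrable n).comp_sub_left t
    refine (h3.norm.mul_const C).mono' (h3.1.smul hv) ?_
    refine Eventually.of_forall fun p => ?_
    rw [norm_smul]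
    exact mul_le_mul_of_nonneg_left (hC _) (norm_nonneg _)
  rw [← integral_inner this]
  congr 1
  ext x
  rw [inner_smul_left, inner_smul_right, ← neg_sub x t, rho_neg]
  simp

theorem moll_contDiff {u : E N → V} (hu : LocallyIntegrable u) (n : ℕ) :
    ContDiff ℝ ∞ (moll n u) :=
  (rho_hasCompactSupport n).contDiff_convolution_left _ (rho_contDiff n) hu


/-! ### Weak gradients of limits of test functions -/

theorem inner_gradient {φ : E N → ℝ} {x : E N} (hφ : DifferentiableAt ℝ φ x) (e : E N) :
    inner ℝ (∇ φ x) e = fderiv ℝ φ x e := by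
  have := hφ.hasGradientAt.hasFDerivAt.fderiv
  rw [this]
  simp

theorem continuous_gradient {φ : E N → ℝ} (hφ : ContDiff ℝ 1 φ) : Continuous (∇ φ) :=
  (InnerProductSpace.toDual ℝ (E N)).symm.continuous.comp (hφ.continuous_fderiv one_ne_zero)

theorem support_gradient_subset (φ : E N → ℝ) : Function.support (∇ φ) ⊆ tsupport φ := by
  intro x hx
  by_contra h
  apply hx
  have : fderiv ℝ φ x = 0 := by
    by_contra h'
    exact h (support_fderiv_subset ℝ h')
  simp [gradient, this]

theorem hasCompactSupport_gradient {φ : E N → ℝ} (h : HasCompactSupport φ) :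
    HasCompactSupport (∇ φ) :=
  h.mono' (support_gradient_subset φ)

theorem hasCompactSupport_fderiv_apply {φ : E N → ℝ} (h : HasCompactSupport φ) (e : E N) :
    HasCompactSupport (fun x => fderiv ℝ φ x e) :=
  h.fderiv_apply (𝕜 := ℝ) e

/-- `f` has weak gradient `g` on the whole space, and `φ` is a sequence of smooth compactly
supported functions converging to `f` in `W^{1,1}`. -/
structure SobolevPair (f : E N → ℝ) (g : E N → E N) (φ : ℕ → E N → ℝ) : Prop where
  int_f : Integrable f
  int_g : Integrable g
  smooth : ∀ k, ContDiff ℝ ∞ (φ k)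
  supp : ∀ k, HasCompactSupport (φ k)
  tendsto_f : Tendsto (fun k => ∫ x, ‖φ k x - f x‖) atTop (𝓝 0)
  tendsto_g : Tendsto (fun k => ∫ x, ‖∇ (φ k) x - g x‖) atTop (𝓝 0)

/-- `L¹` convergence and bounded almost everywhere convergence multiply. -/
theorem tendsto_integral_mul_of_tendsto_L1_ae {α : Type*} [MeasurableSpace α] {μ : Measure α}
    {u w : ℕ → α → ℝ} {u₀ w₀ : α → ℝ} (hu : ∀ n, Integrable (u n) μ) (hu₀ : Integrable u₀ μ)
    (h : Tendsto (fun n => ∫ x, ‖u n x - u₀ x‖ ∂μ) atTop (𝓝 0))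
    (hw : ∀ n, AEStronglyMeasurable (w n) μ) {C : ℝ} (hC : ∀ n x, ‖w n x‖ ≤ C)
    (hlim : ∀ᵐ x ∂μ, Tendsto (fun n => w n x) atTop (𝓝 (w₀ x))) :
    Tendsto (fun n => ∫ x, u n x * w n x ∂μ) atTop (𝓝 (∫ x, u₀ x * w₀ x ∂μ)) := by
  have i1 : ∀ n, Integrable (fun x => u n x * w n x) μ :=
    fun n => (hu n).mul_bdd (c := C) (hw n) (Eventually.of_forall (hC n))
  have i2 : ∀ n, Integrable (fun x => u₀ x * w n x) μ :=
    fun n => hu₀.mul_bdd (c := C) (hw n) (Eventually.of_forall (hC n))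
  have t1 : Tendsto (fun n => ∫ x, u₀ x * w n x ∂μ) atTop (𝓝 (∫ x, u₀ x * w₀ x ∂μ)) := by
    refine tendsto_integral_of_dominated_convergence (fun x => ‖u₀ x‖ * C) (fun n => (i2 n).1)
      (hu₀.norm.mul_const C) (fun n => Eventually.of_forall fun x => ?_) ?_
    · rw [norm_mul]
      exact mul_le_mul_of_nonneg_left (hC n x) (norm_nonneg _)
    · filter_upwards [hlim] with x hx
      exact hx.const_mul _
  have t2 : Tendsto (fun n => ∫ x, u n x * w n x ∂μ - ∫ x, u₀ x * w n x ∂μ) atTop (𝓝 0) := by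
    have h2 := h.const_mul C
    rw [mul_zero] at h2
    refine squeeze_zero_norm (fun n => ?_) h2
    rw [← integral_sub (i1 n) (i2 n), ← integral_const_mul]
    refine norm_integral_le_of_norm_le (((hu n).sub hu₀).norm.const_mul C) ?_
    refine Eventually.of_forall fun x => ?_
    rw [← sub_mul, norm_mul, mul_comm]
    exact mul_le_mul_of_nonneg_right (hC n x) (norm_nonneg _)
  simpa using t2.add t1

/-- `L¹` convergence passes to integrals against a bounded factor. -/
theorem tendsto_integral_mul_of_tendsto_L1 {α : Type*} [MeasurableSpace α] {μ : Measure α}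
    {u : ℕ → α → ℝ} {u₀ w : α → ℝ} (hu : ∀ n, Integrable (u n) μ) (hu₀ : Integrable u₀ μ)
    (h : Tendsto (fun n => ∫ x, ‖u n x - u₀ x‖ ∂μ) atTop (𝓝 0))
    (hw : AEStronglyMeasurable w μ) {C : ℝ} (hC : ∀ x, ‖w x‖ ≤ C) :
    Tendsto (fun n => ∫ x, u n x * w x ∂μ) atTop (𝓝 (∫ x, u₀ x * w x ∂μ)) :=
  tendsto_integral_mul_of_tendsto_L1_ae hu hu₀ h (fun _ => hw) (fun _ => hC)
    (Eventually.of_forall fun _ => tendsto_const_nhds)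

/-- Fatou's lemma for real functions whose integrals are bounded by nonnegative numbers. -/
theorem lintegral_ofReal_le_of_tendsto {α : Type*} [MeasurableSpace α] {μ : Measure α}
    {u : ℕ → α → ℝ} {u₀ : α → ℝ} {c : ℕ → ℝ} {c₀ : ℝ}
    (hu : ∀ n, AEMeasurable (u n) μ)
    (hlim : ∀ᵐ x ∂μ, Tendsto (fun n => u n x) atTop (𝓝 (u₀ x)))
    (hle : ∀ᶠ n in atTop, 0 ≤ c n ∧ ∫⁻ x, ENNReal.ofReal (u n x) ∂μ ≤ ENNReal.ofReal (c n))
    (hc : Tendsto c atTop (𝓝 c₀)) :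
    0 ≤ c₀ ∧ ∫⁻ x, ENNReal.ofReal (u₀ x) ∂μ ≤ ENNReal.ofReal c₀ := by
  refine ⟨ge_of_tendsto hc (hle.mono fun n hn => hn.1), ?_⟩
  calc ∫⁻ x, ENNReal.ofReal (u₀ x) ∂μ
      = ∫⁻ x, liminf (fun n => ENNReal.ofReal (u n x)) atTop ∂μ := by
        refine lintegral_congr_ae ?_
        filter_upwards [hlim] with x hx
        exact (ENNReal.tendsto_ofReal hx).liminf_eq.symm
    _ ≤ liminf (fun n => ∫⁻ x, ENNReal.ofReal (u n x) ∂μ) atTop :=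
        lintegral_liminf_le' fun n => (hu n).ennreal_ofReal
    _ ≤ liminf (fun n => ENNReal.ofReal (c n)) atTop :=
        liminf_le_liminf (hle.mono fun n hn => hn.2)
    _ = ENNReal.ofReal c₀ := (ENNReal.tendsto_ofReal hc).liminf_eq

theorem exists_bound_of_compactSupport {F : Type*} [NormedAddCommGroup F] {w : E N → F}
    (hw : Continuous w) (hs : HasCompactSupport w) : ∃ C, ∀ x, ‖w x‖ ≤ C :=
  hw.bounded_above_of_compact_support hs

theorem integral_mul_fderiv_by_parts {φ ψ : E N → ℝ} (hφ : ContDiff ℝ 1 φ)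
    (hψ : ContDiff ℝ 1 ψ) (hψs : HasCompactSupport ψ) (e : E N) :
    ∫ x, φ x * fderiv ℝ ψ x e = - ∫ x, inner ℝ (∇ φ x) e * ψ x := by
  have cψ' : Continuous (fun x => fderiv ℝ ψ x e) :=
    (hψ.continuous_fderiv one_ne_zero).clm_apply continuous_const
  have cφ' : Continuous (fun x => fderiv ℝ φ x e) :=
    (hφ.continuous_fderiv one_ne_zero).clm_apply continuous_const
  rw [integral_mul_fderiv_eq_neg_fderiv_mul_of_integrable]
  · congr 1
    refine integral_congr_ae (Eventually.of_forall fun x => ?_)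
    simp only [inner_gradient (hφ.differentiable one_ne_zero x)]
  · exact (cφ'.mul hψ.continuous).integrable_of_hasCompactSupport hψs.mul_left
  · exact (hφ.continuous.mul cψ').integrable_of_hasCompactSupport
      (hasCompactSupport_fderiv_apply hψs e).mul_left
  · exact (hφ.continuous.mul hψ.continuous).integrable_of_hasCompactSupport hψs.mul_left
  · exact fun x _ => hφ.differentiable one_ne_zero x
  · exact fun x _ => hψ.differentiable one_ne_zero x

/-- The reflected kernel y ↦ ρ(x - y) is itself an admissible test function, and its y-derivative is
minus the derivative that falls on the kernel when the convolution is differentiated. -/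
theorem hasGradientAt_moll_of_weak {f : E N → ℝ} {g : E N → E N}
    (hf : Integrable f) (hg : Integrable g)
    (hw : ∀ ψ : E N → ℝ, ContDiff ℝ 1 ψ → HasCompactSupport ψ → ∀ e,
      ∫ x, f x * fderiv ℝ ψ x e = - ∫ x, inner ℝ (g x) e * ψ x) (n : ℕ) (x : E N) :
    HasGradientAt (moll n f) (moll n g x) x := by
  have hd : DifferentiableAt ℝ (moll n f) x :=
    (moll_contDiff hf.locallyIntegrable n).differentiable (by simp) x
  have h1 := (rho_hasCompactSupport (N := N) n).hasFDerivAt_convolution_left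
    (ContinuousLinearMap.lsmul ℝ ℝ) ((rho_contDiff n).of_le (by simp))
    hf.locallyIntegrable x
  suffices hs : ∇ (moll n f) x = moll n g x by
    rw [← hs]; exact hd.hasGradientAt
  refine ext_inner_right ℝ fun e => ?_
  rw [inner_gradient hd]
  have cρ : Continuous (rho N n) := (rho_contDiff n).continuous
  have cρ' : Continuous (fderiv ℝ (rho N n)) :=
    ((rho_contDiff n).of_le (m := 1) (by simp)).continuous_fderiv one_ne_zero
  have key := hw (fun y => rho N n (x - y))
    (((rho_contDiff n).of_le (by simp)).comp (contDiff_const.sub contDiff_id))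
    ((rho_hasCompactSupport n).comp_homeomorph (Homeomorph.subLeft x)) e
  have hder : ∀ y, fderiv ℝ (fun y => rho N n (x - y)) y e = - fderiv ℝ (rho N n) (x - y) e := by
    intro y
    have h2 : HasFDerivAt (fun y => x - y) (-ContinuousLinearMap.id ℝ (E N)) y :=
      (hasFDerivAt_id y).const_sub x
    have h3 : HasFDerivAt (rho N n) (fderiv ℝ (rho N n) (x - y)) (x - y) :=
      ((rho_contDiff n).differentiable (by simp) _).hasFDerivAt
    have h5 : fderiv ℝ (fun y => rho N n (x - y)) y = _ := (h3.comp y h2).fderiv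
    rw [h5]
    simp
  simp_rw [hder] at key
  have e1 : fderiv ℝ (moll n f) x e = ∫ y, f y * fderiv ℝ (rho N n) (x - y) e := by
    have h4 : fderiv ℝ (moll n f) x = _ := h1.fderiv
    rw [h4, convolution_eq_swap, ContinuousLinearMap.integral_apply]
    · refine integral_congr_ae (Eventually.of_forall fun y => ?_)
      simp [ContinuousLinearMap.precompL_apply, mul_comm]
    · obtain ⟨C, hC⟩ := exists_bound_of_compactSupport cρ'
        ((rho_hasCompactSupport (N := N) n).fderiv (𝕜 := ℝ))
      have hex := (((rho_hasCompactSupport (N := N) n).fderiv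
        (𝕜 := ℝ)).convolutionExists_left
        ((ContinuousLinearMap.lsmul ℝ ℝ).precompL (E N)) cρ' hf.locallyIntegrable) x
      exact hex.integrable_swap
  have e2 : inner ℝ (moll n g x) e = ∫ y, inner ℝ (g y) e * rho N n (x - y) := by
    rw [moll_apply_swap, real_inner_comm, ← integral_inner]
    · refine integral_congr_ae (Eventually.of_forall fun y => ?_)
      simp only
      rw [inner_smul_right, real_inner_comm, mul_comm]
    · obtain ⟨C, hC⟩ := exists_bound_of_compactSupport cρ (rho_hasCompactSupport (N := N) n)
      exact hg.bdd_smul C (cρ.comp (continuous_const.sub continuous_id)).aestronglyMeasurable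
        (Eventually.of_forall fun y => hC _)
  rw [e1, e2]
  have e3 : ∫ y, f y * - fderiv ℝ (rho N n) (x - y) e
      = - ∫ y, f y * fderiv ℝ (rho N n) (x - y) e := by
    rw [← integral_neg]; simp
  rw [e3] at key
  linarith


namespace SobolevPair

variable {f : E N → ℝ} {g : E N → E N} {φ : ℕ → E N → ℝ}

theorem int_φ (h : SobolevPair f g φ) (k : ℕ) : Integrable (φ k) :=
  (h.smooth k).continuous.integrable_of_hasCompactSupport (h.supp k)

theorem int_gradient (h : SobolevPair f g φ) (k : ℕ) : Integrable (∇ (φ k)) :=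
  (continuous_gradient ((h.smooth k).of_le (by simp))).integrable_of_hasCompactSupport
    (hasCompactSupport_gradient (h.supp k))

theorem tendsto_inner (h : SobolevPair f g φ) (e : E N) :
    Tendsto (fun k => ∫ x, ‖inner ℝ (∇ (φ k) x) e - inner ℝ (g x) e‖) atTop (𝓝 0) := by
  have h2 := h.tendsto_g.mul_const ‖e‖
  rw [zero_mul] at h2
  refine squeeze_zero (fun n => integral_nonneg fun x => norm_nonneg _) (fun n => ?_) h2
  rw [← integral_mul_const]
  refine integral_mono ?_ (((h.int_gradient n).sub h.int_g).norm.mul_const _) fun x => ?_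
  · exact (((h.int_gradient n).inner_const e).sub (h.int_g.inner_const e)).norm
  · change ‖inner ℝ (∇ (φ n) x) e - inner ℝ (g x) e‖ ≤ _
    rw [← inner_sub_left]
    exact norm_inner_le_norm _ _

/-- Classical integration by parts holds for each φ k, and both sides are continuous in L¹ because ψ
and its derivative are bounded. -/
theorem weak_deriv (h : SobolevPair f g φ) {ψ : E N → ℝ} (hψ : ContDiff ℝ 1 ψ)
    (hψs : HasCompactSupport ψ) (e : E N) :
    ∫ x, f x * fderiv ℝ ψ x e = - ∫ x, inner ℝ (g x) e * ψ x := by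
  have cψ' : Continuous (fun x => fderiv ℝ ψ x e) :=
    (hψ.continuous_fderiv one_ne_zero).clm_apply continuous_const
  have sψ' := hasCompactSupport_fderiv_apply hψs e
  obtain ⟨C, hC⟩ := exists_bound_of_compactSupport hψ.continuous hψs
  obtain ⟨C', hC'⟩ := exists_bound_of_compactSupport cψ' sψ'
  have l1 := tendsto_integral_mul_of_tendsto_L1 h.int_φ h.int_f h.tendsto_f
    cψ'.aestronglyMeasurable hC'
  have l2 := tendsto_integral_mul_of_tendsto_L1 (fun k => (h.int_gradient k).inner_const e)
    (h.int_g.inner_const e) (h.tendsto_inner e) hψ.continuous.aestronglyMeasurable hC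
  refine tendsto_nhds_unique l1 ?_
  refine l2.neg.congr fun k => ?_
  exact (integral_mul_fderiv_by_parts ((h.smooth k).of_le (by simp)) hψ hψs e).symm

/-- Sums `weak_deriv` over the partial derivatives of ψ in the coordinate directions. It turns the
distributional Laplacian, which puts two derivatives on the test function, into a divergence
identity for g. -/
theorem integral_mul_laplacian (h : SobolevPair f g φ) {ψ : E N → ℝ} (hψ : ContDiff ℝ ∞ ψ)
    (hψs : HasCompactSupport ψ) :
    ∫ x, f x * Laplacian.laplacian ψ x = - ∫ x, inner ℝ (g x) (∇ ψ x) := by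
  set b := EuclideanSpace.basisFun (Fin N) ℝ with hb
  have hd : ContDiff ℝ ∞ (fderiv ℝ ψ) := hψ.fderiv_right (by simp)
  have hdi : ∀ i, ContDiff ℝ ∞ (fun x => fderiv ℝ ψ x (b i)) := fun i =>
    hd.clm_apply contDiff_const
  have hsi : ∀ i, HasCompactSupport (fun x => fderiv ℝ ψ x (b i)) := fun i =>
    hasCompactSupport_fderiv_apply hψs (b i)
  have hlap : ∀ x, Laplacian.laplacian ψ x
      = ∑ i, fderiv ℝ (fun y => fderiv ℝ ψ y (b i)) x (b i) := by
    intro x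
    rw [InnerProductSpace.laplacian_eq_iteratedFDeriv_orthonormalBasis ψ b]
    refine Finset.sum_congr rfl fun i _ => ?_
    rw [iteratedFDeriv_two_apply]
    have : HasFDerivAt (fun y => fderiv ℝ ψ y (b i)) ((fderiv ℝ (fderiv ℝ ψ) x).flip (b i)) x := by
      have h1 := (hd.differentiable (by simp) x).hasFDerivAt.clm_apply
        (hasFDerivAt_const (b i) x)
      simpa using h1
    rw [this.fderiv]
    simp
  have hw : ∀ i, ∫ x, f x * fderiv ℝ (fun y => fderiv ℝ ψ y (b i)) x (b i)
      = - ∫ x, inner ℝ (g x) (b i) * fderiv ℝ ψ x (b i) := fun i =>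
    h.weak_deriv ((hdi i).of_le (by simp)) (hsi i) (b i)
  have i1 : ∀ i, Integrable (fun x => f x * fderiv ℝ (fun y => fderiv ℝ ψ y (b i)) x (b i)) := by
    intro i
    have c : Continuous (fun x => fderiv ℝ (fun y => fderiv ℝ ψ y (b i)) x (b i)) :=
      (((hdi i).of_le (m := 1) (by simp)).continuous_fderiv one_ne_zero).clm_apply
        continuous_const
    obtain ⟨C, hC⟩ := exists_bound_of_compactSupport c
      (hasCompactSupport_fderiv_apply (hsi i) (b i))
    exact h.int_f.mul_bdd (c := C) c.aestronglyMeasurable (Eventually.of_forall hC)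
  have i2 : ∀ i, Integrable (fun x => inner ℝ (g x) (b i) * fderiv ℝ ψ x (b i)) := by
    intro i
    obtain ⟨C, hC⟩ := exists_bound_of_compactSupport (hdi i).continuous (hsi i)
    exact (h.int_g.inner_const (b i)).mul_bdd (c := C) (hdi i).continuous.aestronglyMeasurable
      (Eventually.of_forall hC)
  simp_rw [hlap, Finset.mul_sum]
  rw [integral_finsetSum _ fun i _ => i1 i]
  simp_rw [hw]
  rw [Finset.sum_neg_distrib, ← integral_finsetSum _ fun i _ => i2 i]
  congr 1
  refine integral_congr_ae (Eventually.of_forall fun x => ?_)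
  simp only
  rw [← OrthonormalBasis.sum_inner_mul_inner b (g x) (∇ ψ x)]
  refine Finset.sum_congr rfl fun i _ => ?_
  rw [← inner_gradient (hψ.differentiable (by simp) x), real_inner_comm (b i) (∇ ψ x)]

theorem hasGradientAt_moll (h : SobolevPair f g φ) (n : ℕ) (x : E N) :
    HasGradientAt (moll n f) (moll n g x) x :=
  hasGradientAt_moll_of_weak h.int_f h.int_g (fun _ h1 h2 e => h.weak_deriv h1 h2 e) n x

end SobolevPair

theorem gradient_moll {ψ : E N → ℝ} (hψ : ContDiff ℝ 1 ψ) (hψs : HasCompactSupport ψ) (n : ℕ) :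
    ∇ (moll n ψ) = moll n (∇ ψ) := by
  ext1 x
  exact (hasGradientAt_moll_of_weak (hψ.continuous.integrable_of_hasCompactSupport hψs)
    ((continuous_gradient hψ).integrable_of_hasCompactSupport (hasCompactSupport_gradient hψs))
    (fun ψ' h1 h2 e => integral_mul_fderiv_by_parts hψ h1 h2 e) n x).gradient


/-! ### Interior energy inequalities -/

/-- The distributional identity `div g = L` on `Ω`. -/
structure WeakDivergence (Ω : Set (E N)) (g : E N → E N) (L : E N → ℝ) : Prop where
  locInt : LocallyIntegrableOn L Ω
  eq : ∀ ψ : E N → ℝ, IsTestFunction Ω ψ →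
    ∫ x, inner ℝ (g x) (∇ ψ x) = - ∫ x in Ω, L x * ψ x

/-- The equation is tested with the mollification of ψ, which for large n is still supported in a
compact neighbourhood of K inside Ω, and the mollifier is then moved onto g and L by symmetry. As L
is integrable only on compact subsets of Ω, it is cut off to that neighbourhood before being
convolved. -/
theorem WeakDivergence.integral_moll {Ω : Set (E N)} {g : E N → E N} {L : E N → ℝ}
    (hL : WeakDivergence Ω g L) (hg : Integrable g) (hΩ : IsOpen Ω) {K : Set (E N)}
    (hK : IsCompact K) (hKΩ : K ⊆ Ω) :
    ∃ L' : E N → ℝ, Integrable L' ∧ (∀ x ∈ K, L' x = L x) ∧ ∀ᶠ n in atTop,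
      ∀ ψ : E N → ℝ, ContDiff ℝ 1 ψ → tsupport ψ ⊆ K →
        ∫ x, inner ℝ (moll n g x) (∇ ψ x) = - ∫ x, moll n L' x * ψ x := by
  obtain ⟨δ, hδ, hsub⟩ := hK.exists_cthickening_subset_open hΩ hKΩ
  set K' := Metric.cthickening δ K with hK'
  have hK'c : IsCompact K' := hK.cthickening
  have hint : Integrable (K'.indicator L) :=
    (integrable_indicator_iff hK'c.measurableSet).2 (hL.locInt.integrableOn_compact_subset hsub hK'c)
  refine ⟨K'.indicator L, hint, fun x hx => indicator_of_mem
    (Metric.self_subset_cthickening K hx) L, ?_⟩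
  filter_upwards [(bump_rOut_tendsto N).eventually (gt_mem_nhds hδ)] with n hn ψ hψ hψK
  have hψs : HasCompactSupport ψ := hK.of_isClosed_subset (isClosed_tsupport ψ) hψK
  have hsupp : tsupport (moll n ψ) ⊆ K' := by
    refine closure_minimal ?_ hK'c.isClosed
    refine (support_convolution_subset _).trans ?_
    rintro _ ⟨y, hy, z, hz, rfl⟩
    have hy' : y ∈ Function.support (rho N n) := hy
    rw [rho, (bump N n).support_normed_eq] at hy'
    refine Metric.mem_cthickening_of_dist_le (y + z) z δ K (hψK (subset_tsupport ψ hz)) ?_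
    simpa using (mem_ball_zero_iff.1 hy').le.trans hn.le
  have htest : IsTestFunction Ω (moll n ψ) :=
    ⟨moll_contDiff (hψ.continuous.integrable_of_hasCompactSupport hψs).locallyIntegrable n,
      hK'c.of_isClosed_subset (isClosed_tsupport _) hsupp, hsupp.trans hsub⟩
  obtain ⟨C, hC⟩ := exists_bound_of_compactSupport hψ.continuous hψs
  obtain ⟨C', hC'⟩ := exists_bound_of_compactSupport (continuous_gradient hψ)
    (hasCompactSupport_gradient hψs)
  rw [moll_inner_swap hg (continuous_gradient hψ).aestronglyMeasurable hC', ← gradient_moll hψ hψs,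
    hL.eq _ htest]
  congr 1
  have h1 := moll_inner_swap hint hψ.continuous.aestronglyMeasurable hC n
  simp only [RCLike.inner_apply, conj_trivial] at h1
  simp_rw [mul_comm (moll n (K'.indicator L) _)]
  rw [h1, ← integral_indicator hΩ.measurableSet]
  refine integral_congr_ae (Eventually.of_forall fun x => ?_)
  simp only
  by_cases hx : x ∈ K'
  · rw [indicator_of_mem (hsub hx), indicator_of_mem hx, mul_comm]
  · rw [indicator_of_notMem hx, mul_zero]
    by_cases hxΩ : x ∈ Ω
    · rw [indicator_of_mem hxΩ, image_eq_zero_of_notMem_tsupport fun h => hx (hsupp h), mul_zero]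
    · rw [indicator_of_notMem hxΩ]

theorem gradient_comp_mul {A : ℝ → ℝ} {f ζ : E N → ℝ} {x g : E N} (hA : DifferentiableAt ℝ A (f x))
    (hf : HasGradientAt f g x) (hζ : DifferentiableAt ℝ ζ x) :
    ∇ (fun y => A (f y) * ζ y) x = (deriv A (f x) * ζ x) • g + A (f x) • ∇ ζ x := by
  have h1 := (hA.hasDerivAt.comp_hasFDerivAt x hf.hasFDerivAt).mul hζ.hasFDerivAt
  have h2 : fderiv ℝ (fun y => A (f y) * ζ y) x = _ := h1.fderiv
  rw [gradient, h2]
  simp only [map_add, map_smul, LinearIsometryEquiv.symm_apply_apply, gradient]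
  rw [smul_smul, add_comm, mul_comm]
  rfl

/-- Caccioppoli-type inequality for a smooth nonlinearity. -/
theorem lintegral_energy_le_of_contDiff {Ω : Set (E N)} {f : E N → ℝ} {g : E N → E N}
    {φ : ℕ → E N → ℝ} {L : E N → ℝ}
    (h : SobolevPair f g φ) (hL : WeakDivergence Ω g L) (hΩ : IsOpen Ω)
    {A m : ℝ → ℝ} (hA : ContDiff ℝ 1 A) {C : ℝ} (hC : ∀ s, ‖A s‖ ≤ C) (hm : Continuous m)
    (hmA : ∀ s, m s ≤ deriv A s) (hA' : ∀ s, 0 ≤ deriv A s)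
    {ζ : E N → ℝ} (hζ : IsTestFunction Ω ζ) (hζ0 : ∀ x, 0 ≤ ζ x) :
    0 ≤ (- (∫ x in Ω, A (f x) * L x * ζ x) - ∫ x, A (f x) * inner ℝ (g x) (∇ ζ x)) ∧
      ∫⁻ x, ENNReal.ofReal (m (f x) * ‖g x‖ ^ 2 * ζ x) ≤
      ENNReal.ofReal (- (∫ x in Ω, A (f x) * L x * ζ x)
        - ∫ x, A (f x) * inner ℝ (g x) (∇ ζ x)) := by
  obtain ⟨hζc, hζs, hζΩ⟩ := hζ
  have hζ1 : ContDiff ℝ 1 ζ := hζc.of_le (by simp)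
  obtain ⟨L', hL'i, hL'e, hev⟩ := hL.integral_moll h.int_g hΩ hζs.isCompact hζΩ
  obtain ⟨Cζ, hCζ⟩ := exists_bound_of_compactSupport hζc.continuous hζs
  obtain ⟨Cζ', hCζ'⟩ := exists_bound_of_compactSupport (continuous_gradient hζ1)
    (hasCompactSupport_gradient hζs)
  have cf : ∀ n, ContDiff ℝ 1 (moll n f) := fun n =>
    (moll_contDiff h.int_f.locallyIntegrable n).of_le (by simp)
  have cg : ∀ n, Continuous (moll n g) := fun n =>
    (moll_contDiff h.int_g.locallyIntegrable n).continuous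
  have cA' : Continuous (deriv A) := hA.continuous_deriv le_rfl
  -- The test function A(moll n f) ζ is C¹ with support in that of ζ, so the mollified equation
  -- applies; the product rule separates the quadratic term from the cutoff term.
  have key : ∀ᶠ n in atTop, ∫ x, deriv A (moll n f x) * ‖moll n g x‖ ^ 2 * ζ x
      = - (∫ x, moll n L' x * (A (moll n f x) * ζ x))
        - ∫ x, inner ℝ (moll n g x) (∇ ζ x) * A (moll n f x) := by
    filter_upwards [hev] with n hn
    have h1 := hn (fun x => A (moll n f x) * ζ x) ((hA.comp (cf n)).mul hζ1)
      (tsupport_mul_subset_right)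
    rw [← h1, ← integral_sub]
    · refine integral_congr_ae (Eventually.of_forall fun x => ?_)
      simp only
      rw [gradient_comp_mul (hA.differentiable one_ne_zero _) (h.hasGradientAt_moll n x)
        (hζ1.differentiable one_ne_zero x), inner_add_right, inner_smul_right, inner_smul_right,
        real_inner_self_eq_norm_sq]
      ring
    · have c : Continuous (fun x => inner ℝ (moll n g x) (∇ (fun x => A (moll n f x) * ζ x) x)) :=
        (cg n).inner (continuous_gradient ((hA.comp (cf n)).mul hζ1))
      refine c.integrable_of_hasCompactSupport ?_
      refine (hasCompactSupport_gradient (φ := fun x => A (moll n f x) * ζ x)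
        hζs.mul_left).mono ?_
      intro x hx hx'
      apply hx
      simp only [hx', inner_zero_right]
    · have c : Continuous (fun x => inner ℝ (moll n g x) (∇ ζ x) * A (moll n f x)) :=
        ((cg n).inner (continuous_gradient hζ1)).mul (hA.continuous.comp (cf n).continuous)
      refine c.integrable_of_hasCompactSupport ?_
      refine (hasCompactSupport_gradient hζs).mono ?_
      intro x hx hx'
      apply hx
      simp only [hx', inner_zero_right, zero_mul]
  have lf := moll_tendsto_ae h.int_f
  have lg := moll_tendsto_ae h.int_g
  have t1 : Tendsto (fun n => ∫ x, moll n L' x * (A (moll n f x) * ζ x)) atTop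
      (𝓝 (∫ x, L' x * (A (f x) * ζ x))) := by
    refine tendsto_integral_mul_of_tendsto_L1_ae (integrable_moll hL'i) hL'i (moll_tendsto_L1 hL'i)
      (C := C * Cζ) (fun n => ?_) (fun n x => ?_) ?_
    · exact ((hA.continuous.comp (cf n).continuous).mul hζc.continuous).aestronglyMeasurable
    · rw [norm_mul]
      exact mul_le_mul (hC _) (hCζ x) (norm_nonneg _) ((norm_nonneg _).trans (hC 0))
    · filter_upwards [lf] with x hx
      exact ((hA.continuous.tendsto _).comp hx).mul_const _
  have t2 : Tendsto (fun n => ∫ x, inner ℝ (moll n g x) (∇ ζ x) * A (moll n f x)) atTop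
      (𝓝 (∫ x, inner ℝ (g x) (∇ ζ x) * A (f x))) := by
    have igz : ∀ {u : E N → E N}, Integrable u → Integrable (fun x => inner ℝ (u x) (∇ ζ x)) := by
      intro u hu
      refine (hu.norm.mul_const Cζ').mono'
        (hu.1.inner (continuous_gradient hζ1).aestronglyMeasurable) ?_
      refine Eventually.of_forall fun x => (norm_inner_le_norm _ _).trans ?_
      exact mul_le_mul_of_nonneg_left (hCζ' x) (norm_nonneg _)
    refine tendsto_integral_mul_of_tendsto_L1_ae (fun n => igz (integrable_moll h.int_g n))
      (igz h.int_g) ?_ (C := C) (fun n => ?_) (fun n x => hC _) ?_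
    · have h2 := (moll_tendsto_L1 h.int_g).mul_const Cζ'
      rw [zero_mul] at h2
      refine squeeze_zero (fun n => integral_nonneg fun x => norm_nonneg _) (fun n => ?_) h2
      rw [← integral_mul_const]
      refine integral_mono ((igz (integrable_moll h.int_g n)).sub (igz h.int_g)).norm
        (((integrable_moll h.int_g n).sub h.int_g).norm.mul_const _) fun x => ?_
      change ‖inner ℝ (moll n g x) (∇ ζ x) - inner ℝ (g x) (∇ ζ x)‖ ≤ _
      rw [← inner_sub_left]
      exact (norm_inner_le_norm _ _).trans
        (mul_le_mul_of_nonneg_left (hCζ' x) (norm_nonneg _))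
    · exact (hA.continuous.comp (cf n).continuous).aestronglyMeasurable
    · filter_upwards [lf] with x hx
      exact (hA.continuous.tendsto _).comp hx
  have t3 := t1.neg.sub t2
  have e1 : ∫ x in Ω, A (f x) * L x * ζ x = ∫ x, L' x * (A (f x) * ζ x) := by
    rw [← integral_indicator hΩ.measurableSet]
    refine integral_congr_ae (Eventually.of_forall fun x => ?_)
    simp only
    by_cases hx : x ∈ tsupport ζ
    · rw [indicator_of_mem (hζΩ hx), hL'e x hx]; ring
    · rw [image_eq_zero_of_notMem_tsupport hx, mul_zero, mul_zero]
      by_cases hxΩ : x ∈ Ω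
      · rw [indicator_of_mem hxΩ, image_eq_zero_of_notMem_tsupport hx, mul_zero]
      · rw [indicator_of_notMem hxΩ]
  have e2 : ∫ x, A (f x) * inner ℝ (g x) (∇ ζ x) = ∫ x, inner ℝ (g x) (∇ ζ x) * A (f x) := by
    simp_rw [mul_comm]
  rw [e1, e2]
  -- The right side converges as a product of an L¹ limit and a bounded almost everywhere limit. The
  -- quadratic term has no majorant, g being merely integrable, and passes to the limit by Fatou.
  refine lintegral_ofReal_le_of_tendsto
    (u := fun n x => m (moll n f x) * ‖moll n g x‖ ^ 2 * ζ x) (fun n => ?_) ?_ ?_ t3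
  · exact (((hm.comp (cf n).continuous).mul ((cg n).norm.pow 2)).mul
      hζc.continuous).aemeasurable
  · filter_upwards [lf, lg] with x hx hx'
    exact (((hm.tendsto _).comp hx).mul (hx'.norm.pow 2)).mul_const _
  · filter_upwards [key] with n hn
    rw [← hn]
    refine ⟨integral_nonneg fun x => mul_nonneg (mul_nonneg (hA' _) (by positivity)) (hζ0 x), ?_⟩
    rw [ofReal_integral_eq_lintegral_ofReal]
    · refine lintegral_mono fun x => ENNReal.ofReal_le_ofReal ?_
      exact mul_le_mul_of_nonneg_right
        (mul_le_mul_of_nonneg_right (hmA _) (by positivity)) (hζ0 x)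
    · exact (((cA'.comp (cf n).continuous).mul ((cg n).norm.pow 2)).mul
        hζc.continuous).integrable_of_hasCompactSupport hζs.mul_left
    · exact Eventually.of_forall fun x => mul_nonneg (mul_nonneg (hA' _) (by positivity)) (hζ0 x)

/-- Caccioppoli-type inequality for a continuous nonlinearity `A` such that `A - ∫ m` is
nondecreasing. -/
theorem lintegral_energy_le {Ω : Set (E N)} {f : E N → ℝ} {g : E N → E N}
    {φ : ℕ → E N → ℝ} {L : E N → ℝ}
    (h : SobolevPair f g φ) (hL : WeakDivergence Ω g L) (hΩ : IsOpen Ω)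
    {A m : ℝ → ℝ} (hA : Continuous A) {C : ℝ} (hC : ∀ s, ‖A s‖ ≤ C) (hm : Continuous m)
    (hm0 : ∀ s, 0 ≤ m s) (hmA : ∀ s t, s ≤ t → ∫ r in s..t, m r ≤ A t - A s)
    {ζ : E N → ℝ} (hζ : IsTestFunction Ω ζ) (hζ0 : ∀ x, 0 ≤ ζ x) :
    0 ≤ (- (∫ x in Ω, A (f x) * L x * ζ x) - ∫ x, A (f x) * inner ℝ (g x) (∇ ζ x)) ∧
      ∫⁻ x, ENNReal.ofReal (m (f x) * ‖g x‖ ^ 2 * ζ x) ≤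
      ENNReal.ofReal (- (∫ x in Ω, A (f x) * L x * ζ x)
        - ∫ x, A (f x) * inner ℝ (g x) (∇ ζ x)) := by
  set η : ℕ → ℝ := fun n => 1 / ((n : ℝ) + 1) with hη
  have hη0 : ∀ n, 0 < η n := fun n => by positivity
  have hηt : Tendsto η atTop (𝓝[>] 0) := tendsto_nhdsWithin_iff.2
    ⟨tendsto_one_div_add_atTop_nhds_zero_nat, Eventually.of_forall hη0⟩
  have hprim : ∀ {B : ℝ → ℝ}, Continuous B → ∀ s,
      HasDerivAt (fun t => ∫ r in (0 : ℝ)..t, B r) (B s) s := fun hB s =>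
    (hB.integral_hasStrictDerivAt 0 s).hasDerivAt
  -- Forward Steklov averages (1/η) ∫_s^{s+η} B. For continuous B they are C¹ and inherit its
  -- bounds; the derivative of the average of A is a difference quotient of A, which by `hmA`
  -- dominates the average of m.
  set av : (ℝ → ℝ) → ℕ → ℝ → ℝ := fun B n s =>
    (η n)⁻¹ * ((∫ r in (0 : ℝ)..(s + η n), B r) - ∫ r in (0 : ℝ)..s, B r) with hav
  have hav_deriv : ∀ {B : ℝ → ℝ}, Continuous B → ∀ n s,
      HasDerivAt (av B n) ((η n)⁻¹ * (B (s + η n) - B s)) s := by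
    intro B hB n s
    exact (((hprim hB (s + η n)).comp_add_const s (η n)).sub (hprim hB s)).const_mul _
  have hav_tendsto : ∀ {B : ℝ → ℝ}, Continuous B → ∀ s,
      Tendsto (fun n => av B n s) atTop (𝓝 (B s)) := by
    intro B hB s
    exact ((hprim hB s).tendsto_slope_zero_right).comp hηt
  have hav_cont : ∀ {B : ℝ → ℝ}, Continuous B → ∀ n, Continuous (av B n) := fun hB n =>
    continuous_iff_continuousAt.2 fun s => (hav_deriv hB n s).continuousAt
  have hav_C1 : ∀ n, ContDiff ℝ 1 (av A n) := by
    intro n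
    rw [contDiff_one_iff_deriv]
    refine ⟨fun s => (hav_deriv hA n s).differentiableAt, ?_⟩
    have : deriv (av A n) = fun s => (η n)⁻¹ * (A (s + η n) - A s) :=
      funext fun s => (hav_deriv hA n s).deriv
    rw [this]
    fun_prop
  have hsub : ∀ {B : ℝ → ℝ}, Continuous B → ∀ s t,
      (∫ r in (0 : ℝ)..t, B r) - ∫ r in (0 : ℝ)..s, B r = ∫ r in s..t, B r := fun hB s t =>
    intervalIntegral.integral_interval_sub_left (hB.intervalIntegrable _ _)
      (hB.intervalIntegrable _ _)
  have hav_bound : ∀ n s, ‖av A n s‖ ≤ C := by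
    intro n s
    simp only [hav]
    rw [hsub hA, norm_mul, norm_inv, Real.norm_of_nonneg (hη0 n).le]
    have h1 := intervalIntegral.norm_integral_le_of_norm_le_const (a := s) (b := s + η n) (C := C)
      (f := A) fun x _ => hC x
    rw [add_sub_cancel_left, abs_of_pos (hη0 n)] at h1
    calc (η n)⁻¹ * ‖∫ r in s..(s + η n), A r‖ ≤ (η n)⁻¹ * (C * η n) :=
          mul_le_mul_of_nonneg_left h1 (inv_nonneg.2 (hη0 n).le)
      _ = C := by field_simp [(hη0 n).ne']
  have hmono : ∀ s t, s ≤ t → 0 ≤ A t - A s := fun s t hst =>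
    (intervalIntegral.integral_nonneg hst fun r _ => hm0 r).trans (hmA s t hst)
  have main : ∀ n, 0 ≤ (- (∫ x in Ω, av A n (f x) * L x * ζ x)
        - ∫ x, av A n (f x) * inner ℝ (g x) (∇ ζ x)) ∧
      ∫⁻ x, ENNReal.ofReal (av m n (f x) * ‖g x‖ ^ 2 * ζ x) ≤
      ENNReal.ofReal (- (∫ x in Ω, av A n (f x) * L x * ζ x)
        - ∫ x, av A n (f x) * inner ℝ (g x) (∇ ζ x)) := by
    intro n
    refine lintegral_energy_le_of_contDiff h hL hΩ (hav_C1 n) (hav_bound n) (hav_cont hm n)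
      (fun s => ?_) (fun s => ?_) hζ hζ0
    · rw [(hav_deriv hA n s).deriv]
      simp only [hav]
      rw [hsub hm]
      exact mul_le_mul_of_nonneg_left (hmA _ _ (by linarith [hη0 n])) (inv_nonneg.2 (hη0 n).le)
    · rw [(hav_deriv hA n s).deriv]
      exact mul_nonneg (inv_nonneg.2 (hη0 n).le) (hmono _ _ (by linarith [hη0 n]))
  obtain ⟨hζc, hζs, hζΩ⟩ := hζ
  have hζ1 : ContDiff ℝ 1 ζ := hζc.of_le (by simp)
  obtain ⟨Cζ, hCζ⟩ := exists_bound_of_compactSupport hζc.continuous hζs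
  obtain ⟨Cζ', hCζ'⟩ := exists_bound_of_compactSupport (continuous_gradient hζ1)
    (hasCompactSupport_gradient hζs)
  have hfm : AEMeasurable f := h.int_f.1.aemeasurable
  have iL : Integrable (fun x => L x * ζ x) (volume.restrict Ω) := by
    have i1 : IntegrableOn (fun x => L x * ζ x) (tsupport ζ) :=
      (hL.locInt.integrableOn_compact_subset hζΩ hζs.isCompact).mul_bdd (c := Cζ)
        hζc.continuous.aestronglyMeasurable (Eventually.of_forall hCζ)
    refine (i1.integrable_of_forall_notMem_eq_zero fun x hx => ?_).restrict
    rw [image_eq_zero_of_notMem_tsupport hx, mul_zero]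
  have ig : Integrable (fun x => inner ℝ (g x) (∇ ζ x)) := by
    refine (h.int_g.norm.mul_const Cζ').mono'
      (h.int_g.1.inner (continuous_gradient hζ1).aestronglyMeasurable) ?_
    refine Eventually.of_forall fun x => (norm_inner_le_norm _ _).trans ?_
    exact mul_le_mul_of_nonneg_left (hCζ' x) (norm_nonneg _)
  have t1 : Tendsto (fun n => ∫ x in Ω, av A n (f x) * L x * ζ x) atTop
      (𝓝 (∫ x in Ω, A (f x) * L x * ζ x)) := by
    have := tendsto_integral_mul_of_tendsto_L1_ae (μ := volume.restrict Ω)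
      (u := fun _ x => L x * ζ x) (w := fun n x => av A n (f x)) (w₀ := fun x => A (f x))
      (fun _ => iL) iL (by simp) (C := C)
      (fun n => ((hav_cont hA n).measurable.comp_aemeasurable
        hfm.restrict).aestronglyMeasurable) (fun n x => hav_bound n _)
      (Eventually.of_forall fun x => hav_tendsto hA _)
    refine (this.congr fun n => ?_).trans_eq ?_ <;> [skip; congr 1] <;>
    · refine integral_congr_ae (Eventually.of_forall fun x => ?_)
      ring
  have t2 : Tendsto (fun n => ∫ x, av A n (f x) * inner ℝ (g x) (∇ ζ x)) atTop
      (𝓝 (∫ x, A (f x) * inner ℝ (g x) (∇ ζ x))) := by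
    have := tendsto_integral_mul_of_tendsto_L1_ae (μ := volume)
      (u := fun _ x => inner ℝ (g x) (∇ ζ x)) (w := fun n x => av A n (f x))
      (w₀ := fun x => A (f x))
      (fun _ => ig) ig (by simp) (C := C)
      (fun n => ((hav_cont hA n).measurable.comp_aemeasurable
        hfm).aestronglyMeasurable) (fun n x => hav_bound n _)
      (Eventually.of_forall fun x => hav_tendsto hA _)
    simpa only [mul_comm] using this
  refine lintegral_ofReal_le_of_tendsto
    (u := fun n x => av m n (f x) * ‖g x‖ ^ 2 * ζ x) (fun n => ?_)
    (Eventually.of_forall fun x => ?_) (Eventually.of_forall main)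
    (t1.neg.sub t2)
  · exact ((((hav_cont hm n).measurable.comp_aemeasurable hfm).mul
      (h.int_g.1.norm.aemeasurable.pow_const 2))).mul hζc.continuous.aemeasurable
  · exact ((hav_tendsto hm _).mul_const _).mul_const _


/-! ### Difference quotients and the chain rule -/

theorem exists_subseq_tendsto_ae_of_L1 {α F : Type*} [MeasurableSpace α] [NormedAddCommGroup F]
    {μ : Measure α} {u : ℕ → α → F} {u₀ : α → F} (hu : ∀ n, Integrable (u n) μ)
    (hu₀ : Integrable u₀ μ) (h : Tendsto (fun n => ∫ x, ‖u n x - u₀ x‖ ∂μ) atTop (𝓝 0)) :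
    ∃ ns : ℕ → ℕ, StrictMono ns ∧ ∀ᵐ x ∂μ, Tendsto (fun i => u (ns i) x) atTop (𝓝 (u₀ x)) := by
  refine TendstoInMeasure.exists_seq_tendsto_ae (tendstoInMeasure_of_tendsto_eLpNorm
    (one_ne_zero) (fun n => (hu n).1) hu₀.1 ?_)
  have h2 := ENNReal.tendsto_ofReal h
  rw [ENNReal.ofReal_zero] at h2
  refine h2.congr fun n => ?_
  rw [eLpNorm_one_eq_lintegral_enorm]
  exact ofReal_integral_norm_eq_lintegral_enorm ((hu n).sub hu₀)

section Translation

variable {φ : E N → ℝ}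

theorem sub_eq_integral_fderiv (hφ : ContDiff ℝ 1 φ) (e : E N) (τ : ℝ) (x : E N) :
    φ (x + τ • e) - φ x = ∫ r in (0 : ℝ)..τ, fderiv ℝ φ (x + r • e) e := by
  have c : Continuous (fun r : ℝ => fderiv ℝ φ (x + r • e) e) :=
    ((hφ.continuous_fderiv one_ne_zero).comp (by fun_prop)).clm_apply continuous_const
  have hd : ∀ r ∈ uIcc 0 τ, HasDerivAt (fun r : ℝ => φ (x + r • e)) (fderiv ℝ φ (x + r • e) e) r := by
    intro r _
    have h1 : HasDerivAt (fun r : ℝ => x + r • e) e r := by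
      simpa using ((hasDerivAt_id r).smul_const e).const_add x
    exact (hφ.differentiable one_ne_zero _).hasFDerivAt.comp_hasDerivAt r h1
  rw [intervalIntegral.integral_eq_sub_of_hasDerivAt hd (c.intervalIntegrable _ _)]
  simp

/-- Fubini together with the translation invariance of Lebesgue measure. -/
theorem integrable_line_average (hφ : ContDiff ℝ 1 φ) (hφs : HasCompactSupport φ) (e : E N)
    {τ : ℝ} (hτ : 0 < τ) :
    Integrable (fun x => ∫ r in (0 : ℝ)..τ, ‖fderiv ℝ φ (x + r • e) e‖) ∧
    ∫ x, ∫ r in (0 : ℝ)..τ, ‖fderiv ℝ φ (x + r • e) e‖ = τ * ∫ x, ‖fderiv ℝ φ x e‖ := by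
  have c0 : Continuous (fun x => ‖fderiv ℝ φ x e‖) :=
    ((hφ.continuous_fderiv one_ne_zero).clm_apply continuous_const).norm
  have i0 : Integrable (fun x => ‖fderiv ℝ φ x e‖) :=
    c0.integrable_of_hasCompactSupport (hasCompactSupport_fderiv_apply hφs e).norm
  have c1 : Continuous (fun p : E N × ℝ => ‖fderiv ℝ φ (p.1 + p.2 • e) e‖) :=
    c0.comp (by fun_prop : Continuous fun p : E N × ℝ => p.1 + p.2 • e)
  have hint : Integrable (fun p : E N × ℝ => ‖fderiv ℝ φ (p.1 + p.2 • e) e‖)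
      (volume.prod (volume.restrict (Ioc 0 τ))) := by
    rw [integrable_prod_iff' c1.aestronglyMeasurable]
    refine ⟨Eventually.of_forall fun r => i0.comp_add_right (r • e), ?_⟩
    have : (fun r : ℝ => ∫ x, ‖‖fderiv ℝ φ (x + r • e) e‖‖)
        = fun _ => ∫ x, ‖fderiv ℝ φ x e‖ := by
      ext r
      simp_rw [norm_norm]
      exact integral_add_right_eq_self (fun x => ‖fderiv ℝ φ x e‖) (r • e)
    rw [this]
    exact integrable_const _
  simp_rw [intervalIntegral.integral_of_le hτ.le]
  refine ⟨hint.integral_prod_left, ?_⟩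
  rw [integral_integral_swap hint]
  have : ∀ r : ℝ, ∫ x, ‖fderiv ℝ φ (x + r • e) e‖ = ∫ x, ‖fderiv ℝ φ x e‖ := fun r =>
    integral_add_right_eq_self (fun x => ‖fderiv ℝ φ x e‖) (r • e)
  simp_rw [this]
  simp [hτ.le]

theorem norm_sub_le_line_average (hφ : ContDiff ℝ 1 φ) (e : E N) {τ : ℝ} (hτ : 0 < τ) (x : E N) :
    ‖φ (x + τ • e) - φ x‖ ≤ ∫ r in (0 : ℝ)..τ, ‖fderiv ℝ φ (x + r • e) e‖ := by
  rw [sub_eq_integral_fderiv hφ e τ x]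
  exact intervalIntegral.norm_integral_le_integral_norm hτ.le

theorem integral_norm_sub_le (hφ : ContDiff ℝ 1 φ) (hφs : HasCompactSupport φ) (e : E N)
    {τ : ℝ} (hτ : 0 < τ) :
    ∫ x, ‖φ (x + τ • e) - φ x‖ ≤ τ * ∫ x, ‖fderiv ℝ φ x e‖ := by
  obtain ⟨h1, h2⟩ := integrable_line_average hφ hφs e hτ
  have i := hφ.continuous.integrable_of_hasCompactSupport hφs (μ := volume)
  rw [← h2]
  exact integral_mono ((i.comp_add_right _).sub i).norm h1 (norm_sub_le_line_average hφ e hτ)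

/-- The line averages of |∂φ/∂e| over segments of length τ dominate the quotients, and their
integrals do not depend on τ, so dominated convergence with moving majorants applies. -/
theorem tendsto_diffQuot_of_contDiff (hφ : ContDiff ℝ 1 φ) (hφs : HasCompactSupport φ) (e : E N)
    {τ : ℕ → ℝ} (hτ0 : ∀ n, 0 < τ n)
    (hτ : Tendsto τ atTop (𝓝 0)) :
    Tendsto (fun n => ∫ x, ‖(τ n)⁻¹ * (φ (x + τ n • e) - φ x) - fderiv ℝ φ x e‖) atTop (𝓝 0) := by
  have hτ' : Tendsto τ atTop (𝓝[>] 0) := tendsto_nhdsWithin_iff.2 ⟨hτ, Eventually.of_forall hτ0⟩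
  have i := hφ.continuous.integrable_of_hasCompactSupport hφs (μ := volume)
  have c0 : Continuous (fun x => fderiv ℝ φ x e) :=
    (hφ.continuous_fderiv one_ne_zero).clm_apply continuous_const
  have i0 : Integrable (fun x => fderiv ℝ φ x e) :=
    c0.integrable_of_hasCompactSupport (hasCompactSupport_fderiv_apply hφs e)
  refine tendsto_integral_norm_sub_of_dominated_seq
    (G := fun n x => (τ n)⁻¹ * ∫ r in (0 : ℝ)..τ n, ‖fderiv ℝ φ (x + r • e) e‖)
    (G₀ := fun x => ‖fderiv ℝ φ x e‖) (fun n => ?_) i0.1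
    (fun n => (integrable_line_average hφ hφs e (hτ0 n)).1.const_mul _) i0.norm
    (fun n => Eventually.of_forall fun x => ?_) (Eventually.of_forall fun x => ?_)
    (Eventually.of_forall fun x => ?_) ?_
  · exact (((i.comp_add_right _).sub i).const_mul _).1
  · rw [norm_mul, Real.norm_of_nonneg (inv_nonneg.2 (hτ0 n).le)]
    exact mul_le_mul_of_nonneg_left (norm_sub_le_line_average hφ e (hτ0 n) x)
      (inv_nonneg.2 (hτ0 n).le)
  · have h1 : HasDerivAt (fun r : ℝ => x + r • e) e 0 := by
      simpa using ((hasDerivAt_id (0 : ℝ)).smul_const e).const_add x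
    have h2 : HasDerivAt (fun r : ℝ => φ (x + r • e)) (fderiv ℝ φ (x + (0 : ℝ) • e) e) 0 :=
      (hφ.differentiable one_ne_zero _).hasFDerivAt.comp_hasDerivAt 0 h1
    have h3 := h2.tendsto_slope_zero_right.comp hτ'
    simpa [Function.comp_def] using h3
  · have c : Continuous (fun r : ℝ => ‖fderiv ℝ φ (x + r • e) e‖) :=
      c0.norm.comp (by fun_prop : Continuous fun r : ℝ => x + r • e)
    have h2 := (c.integral_hasStrictDerivAt 0 0).hasDerivAt
    have h3 := h2.tendsto_slope_zero_right.comp hτ'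
    simpa [Function.comp_def] using h3
  · simp_rw [integral_const_mul, (integrable_line_average hφ hφs e (hτ0 _)).2]
    refine tendsto_const_nhds.congr fun n => ?_
    rw [inv_mul_cancel_left₀ (hτ0 n).ne']

end Translation

namespace SobolevPair

variable {f : E N → ℝ} {g : E N → E N} {φ : ℕ → E N → ℝ}

theorem gradient_sub {a b : E N → ℝ} (ha : Differentiable ℝ a) (hb : Differentiable ℝ b) :
    ∇ (fun x => a x - b x) = fun x => ∇ a x - ∇ b x := by
  ext1 x
  rw [gradient, gradient, gradient, ← map_sub, fderiv_fun_sub (ha x) (hb x)]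

/-- Allows the translation estimate to be applied to the approximation error f - φ j. -/
theorem sub_smooth (h : SobolevPair f g φ) (j : ℕ) :
    SobolevPair (fun x => f x - φ j x) (fun x => g x - ∇ (φ j) x) (fun k x => φ k x - φ j x) where
  int_f := h.int_f.sub (h.int_φ j)
  int_g := h.int_g.sub (h.int_gradient j)
  smooth k := (h.smooth k).sub (h.smooth j)
  supp k := (h.supp k).sub (h.supp j)
  tendsto_f := by simpa using h.tendsto_f
  tendsto_g := by
    refine h.tendsto_g.congr fun k => ?_
    rw [gradient_sub ((h.smooth k).differentiable (by simp))
      ((h.smooth j).differentiable (by simp))]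
    simp

theorem integral_norm_sub_le (h : SobolevPair f g φ) (e : E N) {τ : ℝ} (hτ : 0 < τ) :
    ∫ x, ‖f (x + τ • e) - f x‖ ≤ τ * ∫ x, ‖inner ℝ (g x) e‖ := by
  have t1 : Tendsto (fun k => 2 * (∫ x, ‖φ k x - f x‖) +
      τ * (∫ x, ‖inner ℝ (∇ (φ k) x) e - inner ℝ (g x) e‖)
        + τ * ∫ x, ‖inner ℝ (g x) e‖) atTop (𝓝 (τ * ∫ x, ‖inner ℝ (g x) e‖)) := by
    have := ((h.tendsto_f.const_mul 2).add ((h.tendsto_inner e).const_mul τ)).add_const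
      (τ * ∫ x, ‖inner ℝ (g x) e‖)
    simpa using this
  refine ge_of_tendsto' t1 fun k => ?_
  have hk1 : ContDiff ℝ 1 (φ k) := (h.smooth k).of_le (by simp)
  have i1 : Integrable (fun x => ‖φ k x - f x‖) := ((h.int_φ k).sub h.int_f).norm
  have i2 : Integrable (fun x => ‖φ k (x + τ • e) - f (x + τ • e)‖) :=
    i1.comp_add_right (τ • e)
  have i3 : Integrable (fun x => ‖φ k (x + τ • e) - φ k x‖) :=
    (((h.int_φ k).comp_add_right _).sub (h.int_φ k)).norm
  have i4 : Integrable (fun x => ‖f (x + τ • e) - f x‖) :=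
    ((h.int_f.comp_add_right _).sub h.int_f).norm
  have e2 : ∫ x, ‖φ k (x + τ • e) - f (x + τ • e)‖ = ∫ x, ‖φ k x - f x‖ :=
    integral_add_right_eq_self (fun x => ‖φ k x - f x‖) (τ • e)
  have s1 : ∫ x, ‖f (x + τ • e) - f x‖ ≤ ∫ x, (‖φ k (x + τ • e) - f (x + τ • e)‖ + ‖φ k x - f x‖)
      + ‖φ k (x + τ • e) - φ k x‖ := by
    refine integral_mono i4 ((i2.add i1).add i3) fun x => ?_
    have : f (x + τ • e) - f x = -(φ k (x + τ • e) - f (x + τ • e)) + (φ k x - f x)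
      + (φ k (x + τ • e) - φ k x) := by ring
    simp only
    rw [this]
    refine (norm_add_le _ _).trans (add_le_add_left ((norm_add_le _ _).trans_eq ?_) _)
    rw [norm_neg]
  rw [integral_add (by exact i2.add i1) i3, integral_add i2 i1, e2] at s1
  have s2 := DegenerateEinstein.integral_norm_sub_le hk1 (h.supp k) e hτ
  have s3 : ∫ x, ‖fderiv ℝ (φ k) x e‖ ≤ (∫ x, ‖inner ℝ (∇ (φ k) x) e - inner ℝ (g x) e‖)
      + ∫ x, ‖inner ℝ (g x) e‖ := by
    have j1 : Integrable (fun x => ‖inner ℝ (∇ (φ k) x) e - inner ℝ (g x) e‖) :=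
      (((h.int_gradient k).inner_const e).sub (h.int_g.inner_const e)).norm
    have j2 : Integrable (fun x => ‖inner ℝ (g x) e‖) := (h.int_g.inner_const e).norm
    rw [← integral_add j1 j2]
    simp_rw [← inner_gradient (hk1.differentiable one_ne_zero _)]
    refine integral_mono ((h.int_gradient k).inner_const e).norm (j1.add j2) fun x => ?_
    exact norm_le_norm_sub_add _ _
  have s4 := mul_le_mul_of_nonneg_left s3 hτ.le
  linarith

/-- An ε/3 argument: the quotients of f - φ j are bounded in L¹ by the norm of ⟨g - ∇φ j, e⟩
uniformly in τ, while for the fixed smooth function φ j convergence is already known. -/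
theorem tendsto_diffQuot (h : SobolevPair f g φ) (e : E N) {τ : ℕ → ℝ} (hτ0 : ∀ n, 0 < τ n)
    (hτ : Tendsto τ atTop (𝓝 0)) :
    Tendsto (fun n => ∫ x, ‖(τ n)⁻¹ * (f (x + τ n • e) - f x) - inner ℝ (g x) e‖) atTop (𝓝 0) := by
  rw [Metric.tendsto_atTop]
  intro ε hε
  obtain ⟨j, hj⟩ := ((h.tendsto_inner e).eventually (gt_mem_nhds (by positivity : 0 < ε / 3))).exists
  have hj1 : ContDiff ℝ 1 (φ j) := (h.smooth j).of_le (by simp)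
  obtain ⟨n₀, hn₀⟩ := eventually_atTop.1 ((tendsto_diffQuot_of_contDiff hj1 (h.supp j) e hτ0
    hτ).eventually (gt_mem_nhds (by positivity : 0 < ε / 3)))
  refine ⟨n₀, fun n hn => ?_⟩
  rw [Real.dist_eq, sub_zero, abs_of_nonneg (integral_nonneg fun x => norm_nonneg _)]
  have h1 := hn₀ n hn
  have h2 := (h.sub_smooth j).integral_norm_sub_le e (hτ0 n)
  have dφ : ∀ x, fderiv ℝ (φ j) x e = inner ℝ (∇ (φ j) x) e := fun x =>
    (inner_gradient (hj1.differentiable one_ne_zero x) e).symm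
  simp_rw [dφ] at h1
  simp_rw [inner_sub_left, norm_sub_rev (inner ℝ (g _) e)] at h2
  set a := τ n with ha
  have ha0 : 0 < a := hτ0 n
  have i1 : Integrable (fun x => ‖(f (x + a • e) - φ j (x + a • e)) - (f x - φ j x)‖) := by
    have := (h.sub_smooth j).int_f
    exact ((this.comp_add_right (a • e)).sub this).norm
  have i2 : Integrable (fun x => ‖a⁻¹ * (φ j (x + a • e) - φ j x) - inner ℝ (∇ (φ j) x) e‖) :=
    (((((h.int_φ j).comp_add_right (a • e)).sub (h.int_φ j)).const_mul _).sub
      ((h.int_gradient j).inner_const e)).norm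
  have i3 : Integrable (fun x => ‖inner ℝ (∇ (φ j) x) e - inner ℝ (g x) e‖) :=
    (((h.int_gradient j).inner_const e).sub (h.int_g.inner_const e)).norm
  have i0 : Integrable (fun x => ‖a⁻¹ * (f (x + a • e) - f x) - inner ℝ (g x) e‖) :=
    ((((h.int_f.comp_add_right (a • e)).sub h.int_f).const_mul _).sub
      (h.int_g.inner_const e)).norm
  have s1 : ∫ x, ‖a⁻¹ * (f (x + a • e) - f x) - inner ℝ (g x) e‖ ≤
      ∫ x, (a⁻¹ * ‖(f (x + a • e) - φ j (x + a • e)) - (f x - φ j x)‖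
        + ‖a⁻¹ * (φ j (x + a • e) - φ j x) - inner ℝ (∇ (φ j) x) e‖)
        + ‖inner ℝ (∇ (φ j) x) e - inner ℝ (g x) e‖ := by
    refine integral_mono i0 (((i1.const_mul _).add i2).add i3) fun x => ?_
    have : a⁻¹ * (f (x + a • e) - f x) - inner ℝ (g x) e
      = a⁻¹ * ((f (x + a • e) - φ j (x + a • e)) - (f x - φ j x))
        + (a⁻¹ * (φ j (x + a • e) - φ j x) - inner ℝ (∇ (φ j) x) e)
        + (inner ℝ (∇ (φ j) x) e - inner ℝ (g x) e) := by ring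
    simp only
    rw [this]
    refine (norm_add_le _ _).trans (add_le_add_left ((norm_add_le _ _).trans_eq ?_) _)
    rw [norm_mul, Real.norm_of_nonneg (inv_nonneg.2 ha0.le)]
  rw [integral_add (by exact (i1.const_mul _).add i2) i3, integral_add (i1.const_mul _) i2,
    integral_const_mul] at s1
  have s2 := mul_le_mul_of_nonneg_left h2 (inv_nonneg.2 ha0.le)
  rw [inv_mul_cancel_left₀ ha0.ne'] at s2
  linarith

/-- Chain rule for a differentiable outer function, given that the composition is Sobolev. -/
theorem chain_rule {γ : E N → E N} {ψ : ℕ → E N → ℝ} {G G' : ℝ → ℝ}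
    (h : SobolevPair f g φ) (hf0 : ∀ x, 0 ≤ f x)
    (hG : ∀ s, 0 ≤ s → HasDerivWithinAt G (G' s) (Ici 0) s)
    (hw : SobolevPair (fun x => G (f x)) γ ψ) :
    ∀ᵐ x, γ x = G' (f x) • g x := by
  set τ : ℕ → ℝ := fun n => 1 / ((n : ℝ) + 1) with hτdef
  have hτ0 : ∀ n, 0 < τ n := fun n => by positivity
  have hτ : Tendsto τ atTop (𝓝 0) := tendsto_one_div_add_atTop_nhds_zero_nat
  have key : ∀ e : E N, ∀ᵐ x, inner ℝ (γ x) e = inner ℝ (G' (f x) • g x) e := by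
    intro e
    have iq : ∀ {u : E N → ℝ}, Integrable u → ∀ n,
        Integrable (fun x => (τ n)⁻¹ * (u (x + τ n • e) - u x)) := fun hu n =>
      ((hu.comp_add_right (τ n • e)).sub hu).const_mul _
    -- Along a common subsequence the quotients of f and of G ∘ f both converge at almost every x.
    -- There the second limit is forced by the derivative of G at the single point f x, so G need be
    -- neither Lipschitz nor C¹. The one-sided derivative at 0 suffices because f takes values in
    -- [0, ∞).
    obtain ⟨ns, hns, hae⟩ := exists_subseq_tendsto_ae_of_L1 (iq h.int_f)
      (h.int_g.inner_const e) (h.tendsto_diffQuot e hτ0 hτ)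
    obtain ⟨ms, hms, hae'⟩ := exists_subseq_tendsto_ae_of_L1
      (fun i => iq hw.int_f (ns i)) (hw.int_g.inner_const e)
      ((hw.tendsto_diffQuot e hτ0 hτ).comp hns.tendsto_atTop)
    filter_upwards [hae, hae'] with x hx hx'
    have h1 := hx.comp hms.tendsto_atTop
    have hd : Tendsto (fun i => f (x + τ (ns (ms i)) • e) - f x) atTop (𝓝 0) := by
      have h3 := (hτ.comp (hns.tendsto_atTop.comp hms.tendsto_atTop)).mul h1
      rw [zero_mul] at h3
      refine h3.congr fun i => ?_
      simp only [Function.comp_apply]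
      rw [mul_inv_cancel_left₀ (hτ0 _).ne']
    have h2 := (hG (f x) (hf0 x)).hasFDerivWithinAt.lim
      (c := fun i => (τ (ns (ms i)))⁻¹) (d := fun i => f (x + τ (ns (ms i)) • e) - f x)
      (v := inner ℝ (g x) e) ?_ ?_ ?_
      (l := atTop)
    · have h3 := tendsto_nhds_unique hx' (h2.congr fun i => ?_)
      · rw [h3, inner_smul_left]
        simp [mul_comm]
      · simp
    · exact hd
    · refine Eventually.of_forall fun i => ?_
      simpa using hf0 _
    · simpa [Function.comp_def] using h1
  set b := EuclideanSpace.basisFun (Fin N) ℝ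
  have := ae_all_iff.2 fun i => key (b i)
  filter_upwards [this] with x hx
  refine b.repr.injective (PiLp.ext fun i => ?_)
  rw [b.repr_apply_apply, b.repr_apply_apply, real_inner_comm, hx i, real_inner_comm]

end SobolevPair


/-! ### Scalar cutoffs and truncations -/

/-- A continuous cutoff on `(0, ∞)`, vanishing near `0` and near infinity. -/
def cut (n : ℕ) (y : ℝ) : ℝ :=
  max 0 (min 1 (((n : ℝ) + 1) * y - 1)) * max 0 (min 1 ((n : ℝ) + 2 - y))

theorem continuous_cut (n : ℕ) : Continuous (cut n) := by unfold cut; fun_prop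

theorem cut_nonneg (n : ℕ) (y : ℝ) : 0 ≤ cut n y := mul_nonneg (le_max_left _ _) (le_max_left _ _)

theorem cut_le_one (n : ℕ) (y : ℝ) : cut n y ≤ 1 :=
  mul_le_one₀ (max_le zero_le_one (min_le_left _ _)) (le_max_left _ _)
    (max_le zero_le_one (min_le_left _ _))

theorem cut_of_le {n : ℕ} {y : ℝ} (h : ((n : ℝ) + 1) * y ≤ 1) : cut n y = 0 := by
  unfold cut
  rw [max_eq_left ((min_le_right _ _).trans (by linarith)), zero_mul]

theorem cut_of_ge {n : ℕ} {y : ℝ} (h : (n : ℝ) + 2 ≤ y) : cut n y = 0 := by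
  unfold cut
  rw [max_eq_left ((min_le_right _ _).trans (by linarith) : min 1 ((n : ℝ) + 2 - y) ≤ 0), mul_zero]

theorem tendsto_cut {y : ℝ} (hy : 0 < y) : Tendsto (fun n => cut n y) atTop (𝓝 1) := by
  obtain ⟨n₀, hn₀⟩ := exists_nat_ge (2 / y + y)
  refine tendsto_const_nhds.congr' ?_
  filter_upwards [eventually_ge_atTop n₀] with n hn
  have h1 : 2 / y + y ≤ n := hn₀.trans (by exact_mod_cast hn)
  have h3 : 0 < 2 / y := by positivity
  have h2 : 2 ≤ (n : ℝ) * y := by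
    have : 2 / y ≤ n := by linarith
    rwa [div_le_iff₀ hy] at this
  unfold cut
  rw [min_eq_left (by nlinarith), min_eq_left (by linarith)]
  norm_num

/-- The primitive of `cut`, a bounded truncation of the identity. -/
def trunc (n : ℕ) (y : ℝ) : ℝ := ∫ r in (0 : ℝ)..y, cut n r

theorem hasDerivAt_trunc (n : ℕ) (y : ℝ) : HasDerivAt (trunc n) (cut n y) y :=
  ((continuous_cut n).integral_hasStrictDerivAt 0 y).hasDerivAt

theorem continuous_trunc (n : ℕ) : Continuous (trunc n) :=
  continuous_iff_continuousAt.2 fun y => (hasDerivAt_trunc n y).continuousAt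

theorem trunc_nonneg (n : ℕ) {y : ℝ} (hy : 0 ≤ y) : 0 ≤ trunc n y :=
  intervalIntegral.integral_nonneg hy fun r _ => cut_nonneg n r

theorem trunc_le_self (n : ℕ) {y : ℝ} (hy : 0 ≤ y) : trunc n y ≤ y := by
  have := intervalIntegral.integral_mono_on (μ := volume) hy
    ((continuous_cut n).intervalIntegrable 0 y)
    ((continuous_const (y := (1 : ℝ))).intervalIntegrable 0 y) fun r _ => cut_le_one n r
  simpa [trunc] using this

theorem trunc_of_le {n : ℕ} {y : ℝ} (hy : 0 ≤ y) (h : ((n : ℝ) + 1) * y ≤ 1) : trunc n y = 0 := by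
  unfold trunc
  rw [intervalIntegral.integral_congr (g := fun _ => 0), intervalIntegral.integral_zero]
  intro r hr
  rw [uIcc_of_le hy] at hr
  refine cut_of_le (le_trans ?_ h)
  exact mul_le_mul_of_nonneg_left hr.2 (by positivity)

theorem trunc_le (n : ℕ) {y : ℝ} (hy : 0 ≤ y) : trunc n y ≤ (n : ℝ) + 2 := by
  rcases le_total y (n + 2) with h | h
  · exact (trunc_le_self n hy).trans h
  · have hs : trunc n y = trunc n (n + 2) := by
      unfold trunc
      rw [← intervalIntegral.integral_add_adjacent_intervals
        ((continuous_cut n).intervalIntegrable 0 ((n : ℝ) + 2))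
        ((continuous_cut n).intervalIntegrable _ y),
        intervalIntegral.integral_congr (a := (n : ℝ) + 2) (g := fun _ => 0),
        intervalIntegral.integral_zero, add_zero]
      intro r hr
      rw [uIcc_of_le h] at hr
      exact cut_of_ge hr.1
    rw [hs]
    exact trunc_le_self n (by positivity)

theorem tendsto_trunc {y : ℝ} (hy : 0 ≤ y) : Tendsto (fun n => trunc n y) atTop (𝓝 y) := by
  have h1 : Tendsto (fun n => ∫ r in (0 : ℝ)..y, cut n r) atTop (𝓝 (∫ _ in (0 : ℝ)..y, (1 : ℝ))) := by
    refine intervalIntegral.tendsto_integral_filter_of_dominated_convergence (fun _ => 1)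
      (Eventually.of_forall fun n => (continuous_cut n).aestronglyMeasurable)
      (Eventually.of_forall fun n => Eventually.of_forall fun r _ => ?_)
      (continuous_const.intervalIntegrable _ _) (Eventually.of_forall fun r hr => ?_)
    · rw [Real.norm_of_nonneg (cut_nonneg n r)]; exact cut_le_one n r
    · rw [uIoc_of_le hy] at hr
      exact tendsto_cut hr.1
  rw [intervalIntegral.integral_const, smul_eq_mul, mul_one, sub_zero] at h1
  exact h1

/-- A smooth step, `0` below `ε / 4` and `1` above `ε / 2`. -/
def step (ε y : ℝ) : ℝ := Real.smoothTransition (4 / ε * y - 1)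

theorem contDiff_step (ε : ℝ) : ContDiff ℝ ∞ (step ε) := by
  unfold step
  exact Real.smoothTransition.contDiff.comp (by fun_prop)

theorem step_nonneg (ε y : ℝ) : 0 ≤ step ε y := Real.smoothTransition.nonneg _

theorem step_le_one (ε y : ℝ) : step ε y ≤ 1 := Real.smoothTransition.le_one _

theorem step_zero (ε : ℝ) : step ε 0 = 0 :=
  Real.smoothTransition.zero_of_nonpos (by simp)

theorem step_of_ge {ε y : ℝ} (hε : 0 < ε) (h : ε / 2 ≤ y) : step ε y = 1 := by
  refine Real.smoothTransition.one_of_one_le ?_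
  have : 2 ≤ 4 / ε * y := by
    rw [div_mul_eq_mul_div, le_div_iff₀ hε]; linarith
  linarith

theorem deriv_step_of_gt {ε y : ℝ} (hε : 0 < ε) (h : ε / 2 < y) : deriv (step ε) y = 0 := by
  have : step ε =ᶠ[𝓝 y] fun _ => 1 := by
    filter_upwards [Ioi_mem_nhds h] with z hz
    exact step_of_ge hε (le_of_lt hz)
  rw [this.deriv_eq]; simp

theorem deriv_step_of_lt {ε y : ℝ} (hε : 0 < ε) (h : y < 0) : deriv (step ε) y = 0 := by
  have : step ε =ᶠ[𝓝 y] fun _ => 0 := by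
    filter_upwards [Iio_mem_nhds h] with z hz
    refine Real.smoothTransition.zero_of_nonpos ?_
    have : 4 / ε * z ≤ 0 := mul_nonpos_of_nonneg_of_nonpos (by positivity) (le_of_lt hz)
    linarith
  rw [this.deriv_eq]; simp

theorem exists_bound_deriv_step {ε : ℝ} (hε : 0 < ε) : ∃ C, ∀ y, ‖deriv (step ε) y‖ ≤ C := by
  have hc : Continuous (deriv (step ε)) := (contDiff_step ε).continuous_deriv (by simp)
  refine hc.bounded_above_of_compact_support (HasCompactSupport.intro (isCompact_Icc (a := 0)
    (b := ε / 2)) fun y hy => ?_)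
  rw [mem_Icc, not_and_or, not_le, not_le] at hy
  rcases hy with hy | hy
  · exact deriv_step_of_lt hε hy
  · exact deriv_step_of_gt hε hy

theorem gradient_comp {χ : ℝ → ℝ} {ψ : E N → ℝ} {x : E N} (hχ : DifferentiableAt ℝ χ (ψ x))
    (hψ : DifferentiableAt ℝ ψ x) : ∇ (fun y => χ (ψ y)) x = deriv χ (ψ x) • ∇ ψ x := by
  have h2 : fderiv ℝ (fun y => χ (ψ y)) x = _ :=
    (hχ.hasDerivAt.comp_hasFDerivAt x hψ.hasFDerivAt).fderiv
  rw [gradient, h2, map_smul]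
  rfl

theorem isTestFunction_comp {Ω : Set (E N)} {χ : ℝ → ℝ} {ψ : E N → ℝ} (hχ : ContDiff ℝ ∞ χ)
    (h0 : χ 0 = 0) (hψ : IsTestFunction Ω ψ) : IsTestFunction Ω (fun x => χ (ψ x)) :=
  ⟨hχ.comp hψ.1, hψ.2.1.comp_left h0,
    (closure_mono (Function.support_comp_subset h0 ψ)).trans hψ.2.2⟩

/-! ### Testing up to the boundary at a fixed time -/

/-- The data at a fixed time: `f` and `G ∘ f` vanish on the boundary. -/
structure SpatialData (Ω : Set (E N)) (G G' c : ℝ → ℝ) (f : E N → ℝ) (g : E N → E N)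
    (L : E N → ℝ) (φ : ℕ → E N → ℝ) (γ : E N → E N) (ψ : ℕ → E N → ℝ) : Prop where
  open' : IsOpen Ω
  pair_f : SobolevPair f g φ
  nonneg : ∀ x, 0 ≤ f x
  div : WeakDivergence Ω g L
  pair_G : SobolevPair (fun x => G (f x)) γ ψ
  test_G : ∀ k, IsTestFunction Ω (ψ k)
  memLp : MemLp γ 2
  tendsto_G : Tendsto (fun k => eLpNorm (fun x => ∇ (ψ k) x - γ x) 2 volume) atTop (𝓝 0)
  hasDeriv : ∀ s, 0 ≤ s → HasDerivWithinAt G (G' s) (Ici 0) s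
  G_zero : G 0 = 0
  le_deriv : ∀ s, 0 ≤ s → c s ≤ G' s
  c_pos : ∀ s, 0 < s → 0 < c s
  c_mono : MonotoneOn c (Ici 0)

namespace SpatialData

variable {Ω : Set (E N)} {G G' c : ℝ → ℝ} {f : E N → ℝ} {g : E N → E N}
    {L : E N → ℝ} {φ : ℕ → E N → ℝ} {γ : E N → E N} {ψ : ℕ → E N → ℝ}

/-- By continuity of G at 0, the condition G(f) > ε keeps f above some δ > 0, where G' ≥ c δ > 0;
there γ = G'(f) g can be solved for g. Consequently g, globally only integrable, is square
integrable on {G(f) > ε}. -/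
theorem exists_gradient_bound (h : SpatialData Ω G G' c f g L φ γ ψ) {ε : ℝ} (hε : 0 < ε) :
    ∃ C, 0 ≤ C ∧ ∀ᵐ x, ε < G (f x) → ‖g x‖ ≤ C * ‖γ x‖ := by
  have hcont : ContinuousWithinAt G (Ici 0) 0 := (h.hasDeriv 0 le_rfl).continuousWithinAt
  have hev : ∀ᶠ s in 𝓝[Ici 0] (0 : ℝ), G s < ε := by
    refine hcont.eventually (gt_mem_nhds ?_)
    rw [h.G_zero]; exact hε
  obtain ⟨δ, hδ, hsub⟩ := (mem_nhdsGE_iff_exists_Ico_subset).1 hev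
  refine ⟨(c δ)⁻¹, inv_nonneg.2 (h.c_pos δ hδ).le, ?_⟩
  filter_upwards [h.pair_f.chain_rule h.nonneg h.hasDeriv h.pair_G] with x hx hGx
  have hδf : δ ≤ f x := by
    by_contra hlt
    have : G (f x) < ε := hsub ⟨h.nonneg x, not_le.1 hlt⟩
    linarith
  have h1 : c δ ≤ G' (f x) := (h.c_mono (le_of_lt hδ : (0:ℝ) ≤ δ) (h.nonneg x) hδf).trans
    (h.le_deriv _ (h.nonneg x))
  have hcδ := h.c_pos δ hδ
  rw [hx, norm_smul, Real.norm_of_nonneg (hcδ.le.trans h1), inv_mul_eq_div, le_div_iff₀ hcδ,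
    mul_comm]
  exact mul_le_mul_of_nonneg_right h1 (norm_nonneg _)

/-- The interior cutoff is `step ε` composed with ψ k, where ψ k → G(f) in W^{1,2}. Along a
subsequence it is eventually 1 at almost every point where A(f) or m(f) is nonzero, so the main
terms converge. Its gradient contributes step'(ψ k) A(f) ⟨g, ∇ψ k⟩, which tends to zero in L¹
because |g| ≤ B |γ| on {G(f) > ε} and step'(ψ k) eventually vanishes there. -/
theorem energy_le_of_cut (h : SpatialData Ω G G' c f g L φ γ ψ) {ε : ℝ} (hε : 0 < ε)
    {A m : ℝ → ℝ} (hA : Continuous A) {C : ℝ} (hC : ∀ s, ‖A s‖ ≤ C) (hm : Continuous m)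
    (hm0 : ∀ s, 0 ≤ m s) (hmA : ∀ s t, s ≤ t → ∫ r in s..t, m r ≤ A t - A s)
    (hAz : ∀ s, 0 ≤ s → A s ≠ 0 → ε < G s) (hmz : ∀ s, 0 ≤ s → m s ≠ 0 → ε < G s)
    (hAL : IntegrableOn (fun x => A (f x) * L x) Ω) :
    0 ≤ (- ∫ x in Ω, A (f x) * L x) ∧
      ∫⁻ x, ENNReal.ofReal (m (f x) * ‖g x‖ ^ 2) ≤
      ENNReal.ofReal (- ∫ x in Ω, A (f x) * L x) := by
  obtain ⟨ns, hns, hae⟩ := exists_subseq_tendsto_ae_of_L1 h.pair_G.int_φ h.pair_G.int_f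
    h.pair_G.tendsto_f
  obtain ⟨B, hB0, hB⟩ := h.exists_gradient_bound hε
  obtain ⟨D, hD⟩ := exists_bound_deriv_step hε
  have hD0 : 0 ≤ D := (norm_nonneg _).trans (hD 0)
  have hC0 : 0 ≤ C := (norm_nonneg _).trans (hC 0)
  have hfm : AEMeasurable f := h.pair_f.int_f.1.aemeasurable
  have hχd : Continuous (deriv (step ε)) := (contDiff_step ε).continuous_deriv (by simp)
  have hχlim : ∀ᵐ x, ε < G (f x) →
      (∀ᶠ k in atTop, step ε (ψ (ns k) x) = 1 ∧ deriv (step ε) (ψ (ns k) x) = 0) := by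
    filter_upwards [hae] with x hx hGx
    filter_upwards [hx.eventually (lt_mem_nhds (by linarith : ε / 2 < G (f x)))] with k hk
    exact ⟨step_of_ge hε hk.le, deriv_step_of_gt hε hk⟩
  have hgrad : ∀ k x, ∇ (fun y => step ε (ψ k y)) x = deriv (step ε) (ψ k x) • ∇ (ψ k) x :=
    fun k x => gradient_comp ((contDiff_step ε).differentiable (by simp) _)
      ((h.pair_G.smooth k).differentiable (by simp) x)
  have t1 : Tendsto (fun k => ∫ x in Ω, A (f x) * L x * step ε (ψ (ns k) x)) atTop
      (𝓝 (∫ x in Ω, A (f x) * L x)) := by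
    refine tendsto_integral_of_dominated_convergence (fun x => ‖A (f x) * L x‖) (fun k => ?_)
      hAL.norm (fun k => Eventually.of_forall fun x => ?_) ?_
    · exact hAL.1.mul (((contDiff_step ε).continuous.comp
        (h.pair_G.smooth (ns k)).continuous).aestronglyMeasurable)
    · rw [norm_mul _ (step _ _), Real.norm_of_nonneg (step_nonneg _ _)]
      exact mul_le_of_le_one_right (norm_nonneg _) (step_le_one _ _)
    · filter_upwards [ae_restrict_of_ae hχlim] with x hx
      by_cases hz : A (f x) = 0
      · simp [hz]
      · refine tendsto_const_nhds.congr' ?_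
        filter_upwards [hx (hAz _ (h.nonneg x) hz)] with k hk
        rw [hk.1, mul_one]
  have γ2 : Integrable (fun x => ‖γ x‖ ^ 2) := h.memLp.integrable_norm_pow two_ne_zero
  have gradLp : ∀ k, MemLp (∇ (ψ k)) 2 := fun k =>
    (continuous_gradient ((h.pair_G.smooth k).of_le (by simp))).memLp_of_hasCompactSupport
      (hasCompactSupport_gradient (h.pair_G.supp k))
  have dLp : ∀ k, MemLp (fun x => ∇ (ψ k) x - γ x) 2 := fun k => (gradLp k).sub h.memLp
  have iγd : ∀ k, Integrable (fun x => ‖γ x‖ * ‖∇ (ψ k) x - γ x‖) := fun k =>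
    h.memLp.norm.integrable_mul (dLp k).norm
  have s1 : Tendsto (fun k => ∫ x, ‖γ x‖ * ‖∇ (ψ (ns k)) x - γ x‖) atTop (𝓝 0) := by
    have h1 : Tendsto (fun k => (eLpNorm γ 2 volume *
        eLpNorm (fun x => ∇ (ψ (ns k)) x - γ x) 2 volume).toReal) atTop (𝓝 0) := by
      have := ENNReal.Tendsto.const_mul (h.tendsto_G.comp hns.tendsto_atTop)
        (a := eLpNorm γ 2 volume) (Or.inr h.memLp.2.ne)
      rw [mul_zero] at this
      exact (ENNReal.tendsto_toReal ENNReal.zero_ne_top).comp this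
    refine squeeze_zero (fun k => integral_nonneg fun x => by positivity) (fun k => ?_) h1
    rw [integral_eq_lintegral_of_nonneg_ae (Eventually.of_forall fun x => by positivity)
      (iγd _).1]
    refine ENNReal.toReal_mono (ENNReal.mul_ne_top h.memLp.2.ne (dLp _).2.ne) ?_
    have h2 := eLpNorm_smul_le_mul_eLpNorm (p := 2) (q := 2) (r := 1) (μ := volume)
      (dLp (ns k)).norm.1 h.memLp.norm.1
    rw [eLpNorm_norm, eLpNorm_norm, eLpNorm_one_eq_lintegral_enorm] at h2
    refine le_trans (le_of_eq ?_) h2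
    refine lintegral_congr fun x => ?_
    rw [← ofReal_norm]
    congr 1
    simp
  -- Writing ∇ψ k = (∇ψ k - γ) + γ, the first part of the cutoff error is controlled by
  -- Cauchy–Schwarz (`s1`); `J` controls the second and is dominated by D ‖γ‖².
  set J : ℕ → E N → ℝ := fun k x =>
    {x | ε < G (f x)}.indicator (fun x => ‖γ x‖ ^ 2 * ‖deriv (step ε) (ψ (ns k) x)‖) x with hJ
  have hset : NullMeasurableSet {x | ε < G (f x)} :=
    nullMeasurableSet_lt aemeasurable_const h.pair_G.int_f.1.aemeasurable
  have hJm : ∀ k, AEStronglyMeasurable (J k) volume := fun k =>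
    (γ2.1.mul (hχd.comp (h.pair_G.smooth (ns k)).continuous).norm.aestronglyMeasurable).indicator₀
      hset
  have hJle : ∀ k x, ‖J k x‖ ≤ ‖γ x‖ ^ 2 * D := by
    intro k x
    refine (norm_indicator_le_norm_self _ _).trans ?_
    rw [Real.norm_of_nonneg (by positivity)]
    exact mul_le_mul_of_nonneg_left (hD _) (by positivity)
  have iJ : ∀ k, Integrable (J k) := fun k =>
    (γ2.mul_const D).mono' (hJm k) (Eventually.of_forall (hJle k))
  have s2 : Tendsto (fun k => ∫ x, J k x) atTop (𝓝 (∫ _ : E N, (0 : ℝ))) := by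
    refine tendsto_integral_of_dominated_convergence (fun x => ‖γ x‖ ^ 2 * D) hJm
      (γ2.mul_const D) (fun k => Eventually.of_forall (hJle k)) ?_
    filter_upwards [hχlim] with x hx
    by_cases hGx : ε < G (f x)
    · refine tendsto_const_nhds.congr' ?_
      filter_upwards [hx hGx] with k hk
      have hJx : J k x = ‖γ x‖ ^ 2 * ‖deriv (step ε) (ψ (ns k) x)‖ :=
        indicator_of_mem (s := {x | ε < G (f x)}) hGx _
      rw [hJx, hk.2, norm_zero, mul_zero]
    · have : ∀ k, J k x = 0 := fun k => indicator_of_notMem (by simpa using hGx) _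
      simp [this]
  have t2 : Tendsto (fun k => ∫ x, A (f x) * inner ℝ (g x) (∇ (fun y => step ε (ψ (ns k) y)) x))
      atTop (𝓝 0) := by
    have s3 : Tendsto (fun k => C * B * D * (∫ x, ‖γ x‖ * ‖∇ (ψ (ns k)) x - γ x‖)
        + C * B * ∫ x, J k x) atTop (𝓝 0) := by
      have := (s1.const_mul (C * B * D)).add (s2.const_mul (C * B))
      simpa using this
    refine squeeze_zero_norm (fun k => ?_) s3
    rw [← integral_const_mul, ← integral_const_mul,
      ← integral_add ((iγd _).const_mul _) ((iJ k).const_mul _)]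
    refine norm_integral_le_of_norm_le (((iγd _).const_mul _).add ((iJ k).const_mul _)) ?_
    filter_upwards [hB] with x hx
    by_cases hz : A (f x) = 0
    · rw [hz, zero_mul, norm_zero]
      have : 0 ≤ J k x := indicator_nonneg (fun x _ => by positivity) x
      positivity
    · have hGx := hAz _ (h.nonneg x) hz
      have hJx : J k x = ‖γ x‖ ^ 2 * ‖deriv (step ε) (ψ (ns k) x)‖ :=
        indicator_of_mem (s := {x | ε < G (f x)}) hGx _
      rw [hJx, hgrad, inner_smul_right, norm_mul, norm_mul]
      set d := ‖deriv (step ε) (ψ (ns k) x)‖ with hd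
      have hdD : d ≤ D := hD _
      have hd0 : 0 ≤ d := norm_nonneg _
      have h1 : ‖inner ℝ (g x) (∇ (ψ (ns k)) x)‖ ≤
          B * ‖γ x‖ * (‖∇ (ψ (ns k)) x - γ x‖ + ‖γ x‖) := by
        refine (norm_inner_le_norm _ _).trans ?_
        refine mul_le_mul (hx hGx) ?_ (norm_nonneg _) (by positivity)
        exact norm_le_norm_sub_add _ _
      calc ‖A (f x)‖ * (d * ‖inner ℝ (g x) (∇ (ψ (ns k)) x)‖)
          ≤ C * (d * (B * ‖γ x‖ * (‖∇ (ψ (ns k)) x - γ x‖ + ‖γ x‖))) := by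
            gcongr; exact hC _
        _ = C * B * d * (‖γ x‖ * ‖∇ (ψ (ns k)) x - γ x‖) + C * B * (‖γ x‖ ^ 2 * d) := by ring
        _ ≤ C * B * D * (‖γ x‖ * ‖∇ (ψ (ns k)) x - γ x‖) + C * B * (‖γ x‖ ^ 2 * d) := by gcongr
  have t3 := t1.neg.sub t2
  rw [sub_zero] at t3
  refine lintegral_ofReal_le_of_tendsto
    (u := fun k x => m (f x) * ‖g x‖ ^ 2 * step ε (ψ (ns k) x)) (fun k => ?_) ?_
    (Eventually.of_forall fun k => ?_) (t3)
  · exact ((hm.measurable.comp_aemeasurable hfm).mul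
      (h.pair_f.int_g.1.norm.aemeasurable.pow_const 2)).mul
      ((contDiff_step ε).continuous.comp (h.pair_G.smooth (ns k)).continuous).aemeasurable
  · filter_upwards [hχlim] with x hx
    by_cases hz : m (f x) = 0
    · simp [hz]
    · refine tendsto_const_nhds.congr' ?_
      filter_upwards [hx (hmz _ (h.nonneg x) hz)] with k hk
      rw [hk.1, mul_one]
  · exact lintegral_energy_le h.pair_f h.div h.open' hA hC hm hm0 hmA
      (isTestFunction_comp (contDiff_step ε) (step_zero ε) (h.test_G _))
      (fun x => step_nonneg _ _)

/-- Testing the equation with `A(f)`. -/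
theorem energy_le (h : SpatialData Ω G G' c f g L φ γ ψ)
    {A A' m : ℝ → ℝ} (hA : Continuous A) (hA0 : ∀ s, s ≤ 0 → A s = 0)
    (hApos : ∀ s, 0 < s → 0 < A s)
    (hAd : ∀ s, 0 < s → HasDerivAt A (A' s) s) (hAG : ∀ s, 0 ≤ s → A s ≤ G s)
    (hm : Continuous m) (hm0 : ∀ s, 0 ≤ m s) (hmz : ∀ s, s ≤ 0 → m s = 0)
    (hmA : ∀ s, 0 < s → m s ≤ A' s)
    (hAL : IntegrableOn (fun x => A (f x) * L x) Ω) :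
    0 ≤ (- ∫ x in Ω, A (f x) * L x) ∧
      ∫⁻ x, ENNReal.ofReal (m (f x) * ‖g x‖ ^ 2) ≤
      ENNReal.ofReal (- ∫ x in Ω, A (f x) * L x) := by
  have hAnn : ∀ s, 0 ≤ A s := fun s => by
    rcases le_or_gt s 0 with hs | hs
    · exact (hA0 s hs).ge
    · exact (hApos s hs).le
  have hfm : AEMeasurable f := h.pair_f.int_f.1.aemeasurable
  have cA : ∀ n, Continuous fun s => trunc n (A s) := fun n => (continuous_trunc n).comp hA
  have cm : ∀ n, Continuous fun s => cut n (A s) * m s := fun n =>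
    ((continuous_cut n).comp hA).mul hm
  have hle : ∀ n x, ‖trunc n (A (f x)) * L x‖ ≤ ‖A (f x) * L x‖ := by
    intro n x
    rw [norm_mul, norm_mul, Real.norm_of_nonneg (trunc_nonneg n (hAnn _)),
      Real.norm_of_nonneg (hAnn _)]
    exact mul_le_mul_of_nonneg_right (trunc_le_self n (hAnn _)) (norm_nonneg _)
  have hLm : AEStronglyMeasurable L (volume.restrict Ω) := h.div.locInt.aestronglyMeasurable
  have hmeas : ∀ n, AEStronglyMeasurable (fun x => trunc n (A (f x)) * L x)
      (volume.restrict Ω) := fun n =>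
    ((cA n).measurable.comp_aemeasurable hfm.restrict).aestronglyMeasurable.mul hLm
  -- `trunc n ∘ A` is bounded and vanishes where A ≤ 1/(n+1). Since A ≤ G, it lives on {G >
  -- 1/(n+1)}, so the cutoff argument applies with that ε, and its derivative cut n (A) A' dominates
  -- cut n (A) m.
  have main : ∀ n : ℕ, 0 ≤ (- ∫ x in Ω, trunc n (A (f x)) * L x) ∧
      ∫⁻ x, ENNReal.ofReal (cut n (A (f x)) * m (f x) * ‖g x‖ ^ 2) ≤
      ENNReal.ofReal (- ∫ x in Ω, trunc n (A (f x)) * L x) := by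
    intro n
    have hn : (0 : ℝ) < n + 1 := by positivity
    have hGε : ∀ s, 0 ≤ s → ¬ ((n : ℝ) + 1) * A s ≤ 1 → 1 / ((n : ℝ) + 1) < G s := by
      intro s hs hs'
      refine lt_of_lt_of_le ?_ (hAG s hs)
      rw [div_lt_iff₀ hn]
      linarith
    refine h.energy_le_of_cut (ε := 1 / ((n : ℝ) + 1)) (by positivity) (cA n) (C := (n : ℝ) + 2)
      (fun s => ?_) (cm n) (fun s => mul_nonneg (cut_nonneg _ _) (hm0 _)) ?_
      (fun s hs hs' => hGε s hs fun hle => hs' (trunc_of_le (hAnn s) hle))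
      (fun s hs hs' => hGε s hs fun hle => hs' ?_) ?_
    · rw [Real.norm_of_nonneg (trunc_nonneg n (hAnn s))]
      exact trunc_le n (hAnn s)
    · have hprim : ∀ s, HasDerivAt (fun t => ∫ r in (0 : ℝ)..t, cut n (A r) * m r)
          (cut n (A s) * m s) s := fun s => ((cm n).integral_hasStrictDerivAt 0 s).hasDerivAt
      have hmono : Monotone fun s => trunc n (A s) - ∫ r in (0 : ℝ)..s, cut n (A r) * m r := by
        have hc : Continuous fun s => trunc n (A s) - ∫ r in (0 : ℝ)..s, cut n (A r) * m r :=
          (cA n).sub (continuous_iff_continuousAt.2 fun s => (hprim s).continuousAt)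
        -- A is assumed differentiable only on (0, ∞). On (-∞, 0] the function is identically zero,
        -- and the two monotone pieces share the point 0.
        refine MonotoneOn.Iic_union_Ici (a := 0) ?_ ?_
        · intro s hs t ht _
          have hz : ∀ s, s ≤ 0 → trunc n (A s) - ∫ r in (0 : ℝ)..s, cut n (A r) * m r = 0 := by
            intro s hs
            rw [hA0 s hs, trunc_of_le le_rfl (by simp), intervalIntegral.integral_congr
              (g := fun _ => 0), intervalIntegral.integral_zero, sub_zero]
            intro r hr
            rw [uIcc_of_ge hs] at hr
            simp [hmz r hr.2]
          simp only [hz s hs, hz t ht, le_refl]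
        · have hd : ∀ s, 0 < s → HasDerivAt
              (fun s => trunc n (A s) - ∫ r in (0 : ℝ)..s, cut n (A r) * m r)
              (cut n (A s) * A' s - cut n (A s) * m s) s := fun s hs =>
            ((hasDerivAt_trunc n (A s)).comp s (hAd s hs)).sub (hprim s)
          refine monotoneOn_of_deriv_nonneg (convex_Ici 0) hc.continuousOn ?_ ?_
          · rw [interior_Ici]
            exact fun s hs => (hd s hs).differentiableAt.differentiableWithinAt
          · rw [interior_Ici]
            intro s hs
            rw [(hd s hs).deriv, ← mul_sub]
            exact mul_nonneg (cut_nonneg _ _) (sub_nonneg.2 (hmA s hs))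
      intro s t hst
      have h1 := hmono hst
      have h2 := intervalIntegral.integral_interval_sub_left
        ((cm n).intervalIntegrable (μ := volume) 0 t) ((cm n).intervalIntegrable 0 s)
      simp only at h1
      linarith
    · rw [cut_of_le hle, zero_mul]
    · exact hAL.norm.mono' (hmeas n) (Eventually.of_forall (hle n))
  have t1 : Tendsto (fun n => ∫ x in Ω, trunc n (A (f x)) * L x) atTop
      (𝓝 (∫ x in Ω, A (f x) * L x)) := by
    refine tendsto_integral_of_dominated_convergence (fun x => ‖A (f x) * L x‖) hmeas hAL.norm
      (fun n => Eventually.of_forall (hle n)) (Eventually.of_forall fun x => ?_)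
    exact (tendsto_trunc (hAnn _)).mul_const _
  refine lintegral_ofReal_le_of_tendsto
    (u := fun n x => cut n (A (f x)) * m (f x) * ‖g x‖ ^ 2) (fun n => ?_)
    (Eventually.of_forall fun x => ?_) (Eventually.of_forall main)
    (t1.neg)
  · exact ((cm n).measurable.comp_aemeasurable hfm).mul
      (h.pair_f.int_g.1.norm.aemeasurable.pow_const 2)
  · rcases (h.nonneg x).eq_or_lt with hz | hz
    · simp [hmz (f x) hz.ge]
    · have := ((tendsto_cut (hApos _ hz)).mul_const (m (f x))).mul_const (‖g x‖ ^ 2)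
      simpa using this

end SpatialData


/-! ### Sobolev and Hölder inequalities -/

theorem enorm_fderiv_eq_enorm_gradient (φ : E N → ℝ) (x : E N) : ‖fderiv ℝ φ x‖ₑ = ‖∇ φ x‖ₑ := by
  rw [gradient, ← ofReal_norm, ← ofReal_norm, LinearIsometryEquiv.norm_map]

/-- The classical inequality is applied to V ∘ φ k, with V the primitive of W. The bound on W lets
the gradient term converge in L¹, and the norm on the left is lower semicontinuous under almost
everywhere convergence. -/
theorem SobolevPair.gagliardo_nirenberg_of_bounded {f : E N → ℝ} {g : E N → E N}
    {φ : ℕ → E N → ℝ} (h : SobolevPair f g φ) {p : NNReal} (hp : NNReal.HolderConjugate N p)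
    {W : ℝ → ℝ} (hW : Continuous W) (hW0 : ∀ s, 0 ≤ W s) {C : ℝ} (hC : ∀ s, ‖W s‖ ≤ C) :
    eLpNorm (fun x => ∫ r in (0 : ℝ)..f x, W r) p volume ≤
      eLpNormLESNormFDerivOneConst (volume : Measure (E N)) p *
        ∫⁻ x, ENNReal.ofReal (W (f x) * ‖g x‖) := by
  obtain ⟨ns, hns, hae⟩ := exists_subseq_tendsto_ae_of_L1 h.int_φ h.int_f h.tendsto_f
  set V : ℝ → ℝ := fun s => ∫ r in (0 : ℝ)..s, W r with hV
  have hVd : ∀ s, HasDerivAt V (W s) s := fun s => (hW.integral_hasStrictDerivAt 0 s).hasDerivAt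
  have hV1 : ContDiff ℝ 1 V := by
    rw [contDiff_one_iff_deriv]
    refine ⟨fun s => (hVd s).differentiableAt, ?_⟩
    rw [funext fun s => (hVd s).deriv]
    exact hW
  have hV0 : V 0 = 0 := by simp [hV]
  have cφ : ∀ k, Continuous (φ k) := fun k => (h.smooth k).continuous
  have iW : ∀ k, Integrable (fun x => ‖∇ (φ k) x‖ * W (φ k x)) := fun k =>
    (h.int_gradient k).norm.mul_bdd (c := C) (hW.comp (cφ k)).aestronglyMeasurable
      (Eventually.of_forall fun x => hC _)
  have hfm : AEMeasurable f := h.int_f.1.aemeasurable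
  have t1 : Tendsto (fun k => ∫ x, ‖∇ (φ (ns k)) x‖ * W (φ (ns k) x)) atTop
      (𝓝 (∫ x, ‖g x‖ * W (f x))) := by
    refine tendsto_integral_mul_of_tendsto_L1_ae (fun k => (h.int_gradient (ns k)).norm)
      h.int_g.norm ?_ (C := C)
      (fun k => (hW.comp (cφ _)).aestronglyMeasurable) (fun k x => hC _) ?_
    · refine squeeze_zero (fun k => integral_nonneg fun x => norm_nonneg _) (fun k => ?_)
        (h.tendsto_g.comp hns.tendsto_atTop)
      refine integral_mono (((h.int_gradient _).norm.sub h.int_g.norm).norm)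
        ((h.int_gradient _).sub h.int_g).norm fun x => ?_
      exact abs_norm_sub_norm_le _ _
    · filter_upwards [hae] with x hx
      exact (hW.tendsto _).comp hx
  have e0 : ∫⁻ x, ENNReal.ofReal (W (f x) * ‖g x‖)
      = ENNReal.ofReal (∫ x, ‖g x‖ * W (f x)) := by
    rw [ofReal_integral_eq_lintegral_ofReal]
    · simp_rw [mul_comm]
    · exact h.int_g.norm.mul_bdd (c := C) (hW.measurable.comp_aemeasurable hfm).aestronglyMeasurable
        (Eventually.of_forall fun x => hC _)
    · exact Eventually.of_forall fun x => mul_nonneg (norm_nonneg _) (hW0 _)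
  have t2 := ENNReal.Tendsto.const_mul (ENNReal.tendsto_ofReal t1)
    (a := (eLpNormLESNormFDerivOneConst (volume : Measure (E N)) p : ℝ≥0∞))
    (Or.inr ENNReal.coe_ne_top)
  rw [e0]
  refine (Lp.eLpNorm_lim_le_liminf_eLpNorm (f := fun k x => V (φ (ns k) x))
    (fun k => (hV1.continuous.comp (cφ _)).aestronglyMeasurable) _ ?_).trans ?_
  · filter_upwards [hae] with x hx
    exact (hV1.continuous.tendsto _).comp hx
  · refine (liminf_le_liminf (Eventually.of_forall fun k => ?_)).trans_eq t2.liminf_eq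
    have h1 := eLpNorm_le_eLpNorm_fderiv_one (volume : Measure (E N))
      (u := fun x => V (φ (ns k) x)) (hV1.comp ((h.smooth (ns k)).of_le (by simp)))
      ((h.supp (ns k)).comp_left hV0) (p := p) (by simpa using hp)
    refine h1.trans_eq ?_
    congr 1
    rw [eLpNorm_one_eq_lintegral_enorm, ofReal_integral_eq_lintegral_ofReal (iW _)
      (Eventually.of_forall fun x => mul_nonneg (norm_nonneg _) (hW0 _))]
    refine lintegral_congr fun x => ?_
    rw [enorm_fderiv_eq_enorm_gradient, gradient_comp (hVd _).differentiableAt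
      ((h.smooth (ns k)).differentiable (by simp) x), (hVd _).deriv, ← ofReal_norm, norm_smul,
      Real.norm_of_nonneg (hW0 _), mul_comm]

/-- Gagliardo–Nirenberg–Sobolev inequality for a nonlinear function of a Sobolev function. -/
theorem SobolevPair.gagliardo_nirenberg {f : E N → ℝ} {g : E N → E N}
    {φ : ℕ → E N → ℝ} (h : SobolevPair f g φ) {p : NNReal} (hp : NNReal.HolderConjugate N p)
    {W : ℝ → ℝ} (hW : Continuous W) (hW0 : ∀ s, 0 ≤ W s) (hWz : ∀ s, s ≤ 0 → W s = 0) :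
    eLpNorm (fun x => ∫ r in (0 : ℝ)..f x, W r) p volume ≤
      eLpNormLESNormFDerivOneConst (volume : Measure (E N)) p *
        ∫⁻ x, ENNReal.ofReal (W (f x) * ‖g x‖) := by
  -- Multiplying by χ n makes W compactly supported, hence bounded, and does not change its
  -- primitive at f x once n ≥ |f x|.
  set χ : ℕ → ℝ → ℝ := fun n s => max 0 (min 1 ((n : ℝ) + 1 - s)) with hχ
  have hχ1 : ∀ n s, χ n s ≤ 1 := fun n s => max_le zero_le_one (min_le_left _ _)
  have hχ0 : ∀ n s, 0 ≤ χ n s := fun n s => le_max_left _ _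
  have cW : ∀ n, Continuous fun s => W s * χ n s := fun n => by
    simp only [hχ]; fun_prop
  have hχe : ∀ (n : ℕ) (s : ℝ), s ≤ n → χ n s = 1 := fun n s hs => by
    simp only [hχ]
    rw [min_eq_left (by linarith)]; norm_num
  have hfm : AEMeasurable f := h.int_f.1.aemeasurable
  have cV : ∀ n, Continuous fun s => ∫ r in (0 : ℝ)..s, W r * χ n r := fun n =>
    continuous_iff_continuousAt.2 fun s =>
      ((cW n).integral_hasStrictDerivAt 0 s).hasDerivAt.continuousAt
  refine (Lp.eLpNorm_lim_le_liminf_eLpNorm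
    (f := fun n x => ∫ r in (0 : ℝ)..f x, W r * χ n r)
    (fun n => ((cV n).measurable.comp_aemeasurable hfm).aestronglyMeasurable) _
    (Eventually.of_forall fun x => ?_)).trans ?_
  · obtain ⟨n₀, hn₀⟩ := exists_nat_ge |f x|
    refine tendsto_const_nhds.congr' ?_
    filter_upwards [eventually_ge_atTop n₀] with n hn
    refine intervalIntegral.integral_congr fun r hr => ?_
    have h2 : |f x| ≤ n := hn₀.trans (by exact_mod_cast hn)
    have h3 : r ≤ |f x| := by
      rcases le_total 0 (f x) with h4 | h4
      · rw [uIcc_of_le h4] at hr; exact hr.2.trans (le_abs_self _)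
      · rw [uIcc_of_ge h4] at hr; exact hr.2.trans (abs_nonneg _)
    rw [hχe n r (h3.trans h2), mul_one]
  · refine (liminf_le_liminf (Eventually.of_forall fun n => ?_)).trans_eq (liminf_const _)
    obtain ⟨C, hC⟩ := (cW n).bounded_above_of_compact_support (HasCompactSupport.intro
      (isCompact_Icc (a := (0 : ℝ)) (b := n + 1)) fun s hs => by
        rw [mem_Icc, not_and_or, not_le, not_le] at hs
        rcases hs with hs | hs
        · rw [hWz s hs.le, zero_mul]
        · have : χ n s = 0 := max_eq_left ((min_le_right _ _).trans (by linarith))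
          rw [this, mul_zero])
    refine (h.gagliardo_nirenberg_of_bounded hp (cW n)
      (fun s => mul_nonneg (hW0 s) (hχ0 n s)) hC).trans ?_
    gcongr
    exact mul_le_of_le_one_right (hW0 _) (hχ1 n _)

/-- Hölder for three factors with weights e, 1/ρ, 1/2. The middle factor is raised to the power ρ,
and convexity of that power splits the sum at the cost of 2^{ρ-1}. -/
theorem lintegral_holder_three {α : Type*} [MeasurableSpace α] {μ : Measure α}
    {ℓ G : α → ℝ≥0∞} (hℓ : AEMeasurable ℓ μ) (hG : AEMeasurable G μ) {P e b₁ b₂ q ρ : ℝ}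
    (he : 0 ≤ e) (hρ : 1 ≤ ρ) (hsum : e + 1 / ρ + 1 / 2 = 1) :
    ∫⁻ x, ℓ x ^ (P * e) * (ℓ x ^ b₁ + ℓ x ^ b₂) * (ℓ x ^ (q / 2) * G x) ∂μ ≤
      (∫⁻ x, ℓ x ^ P ∂μ) ^ e *
        (2 ^ (ρ - 1) * (∫⁻ x, ℓ x ^ (b₁ * ρ) ∂μ + ∫⁻ x, ℓ x ^ (b₂ * ρ) ∂μ)) ^ (1 / ρ) *
        (∫⁻ x, ℓ x ^ q * G x ^ 2 ∂μ) ^ ((1 : ℝ) / 2) := by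
  have hρ0 : 0 < ρ := by linarith
  have h1 := ENNReal.lintegral_prod_norm_pow_le (μ := μ) (Finset.univ : Finset (Fin 3))
    (f := ![fun x => ℓ x ^ P, fun x => (ℓ x ^ b₁ + ℓ x ^ b₂) ^ ρ, fun x => ℓ x ^ q * G x ^ 2])
    (p := ![e, 1 / ρ, 1 / 2]) ?_ ?_ ?_
  · simp only [Fin.prod_univ_three, Matrix.cons_val_zero, Matrix.cons_val_one,
      Matrix.cons_val] at h1
    refine (le_of_eq ?_).trans (h1.trans ?_)
    · refine lintegral_congr fun x => ?_
      have hsq : (G x ^ 2) ^ ((1 : ℝ) / 2) = G x := by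
        rw [← ENNReal.rpow_natCast, ← ENNReal.rpow_mul]; norm_num
      rw [ENNReal.rpow_mul (ℓ x) P e, ← ENNReal.rpow_mul _ ρ, mul_one_div_cancel hρ0.ne',
        ENNReal.rpow_one, ENNReal.mul_rpow_of_nonneg _ _ (by norm_num : (0 : ℝ) ≤ 1 / 2),
        ← ENNReal.rpow_mul (ℓ x) q, hsq, mul_one_div]
    · gcongr
      rw [← lintegral_add_left' (hℓ.pow_const _), ← lintegral_const_mul'' _
        (by exact (hℓ.pow_const _).add (hℓ.pow_const _))]
      refine lintegral_mono fun x => ?_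
      rw [ENNReal.rpow_mul, ENNReal.rpow_mul]
      exact ENNReal.rpow_add_le_mul_rpow_add_rpow _ _ hρ
  · intro i _
    fin_cases i
    · exact hℓ.pow_const _
    · exact ((hℓ.pow_const _).add (hℓ.pow_const _)).pow_const _
    · exact (hℓ.pow_const _).mul (hG.pow_const _)
  · rw [Fin.sum_univ_three]
    exact hsum
  · intro i _
    fin_cases i
    · exact he
    · simpa using hρ0.le
    · norm_num


/-! ### Exponents and the moment bound -/

/-- Guarantees that 1 - 1/δ₂ is nonnegative and 2δ₂/(2-δ₂) positive. In the second branch, δ₂ ≥ 1 is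
the branch condition δ₁ > N/(N-1) rewritten in weaker form. -/
theorem delta2_bounds (hN : 2 ≤ N) {δ₁ δ₂ : ℝ} (h1 : 1 ≤ δ₁) (h2 : δ₁ < 2)
    (hδ₂ : δ₂ = delta2 N δ₁) : 1 ≤ δ₂ ∧ δ₂ < 2 := by
  have hN' : (2 : ℝ) ≤ N := by exact_mod_cast hN
  rw [hδ₂, delta2]
  split_ifs with h
  · norm_num
  · rw [not_le, div_lt_iff₀ (by linarith)] at h
    have h0 : (0 : ℝ) < N + δ₁ := by linarith
    constructor
    · rw [le_div_iff₀ h0]; nlinarith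
    · rw [div_lt_iff₀ h0]; nlinarith

/-- The exponent `1 - 1 / δ₂`. -/
def dualExponent (δ₂ : ℝ) : ℝ := 1 - 1 / δ₂

/-- The exponent `κ` for which `H(u)^κ` is estimated by the Sobolev inequality. -/
def sobolevExponent (p₁ γ₁ δ₂ : ℝ) : ℝ := γ₁ + 1 + (p₁ + 1) * dualExponent δ₂

/-- Interpolation of a power of `Y` between `Z₁ + Z₂` and the dissipation. -/
theorem exists_moment_bound (hN : 2 ≤ N) {Ω : Set (E N)} (hΩ : IsOpen Ω)
    (hΩb : Bornology.IsBounded Ω) {p₁ q₁ γ₁ β₁ β₂ δ₁ δ₂ p₂ p₃ c : ℝ}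
    (hp₁ : 0 < p₁) (hq₁ : 0 < q₁) (hγ₁ : 0 < γ₁) (hβ : β₂ < β₁) (hβ₂ : q₁ / 2 < β₂) (hc : 0 < c)
    (hδ₁ : δ₁ = delta1 p₁ γ₁) (hδ₁_ge : 1 ≤ δ₁) (hδ₁_lt : δ₁ < 2)
    (hδ₂ : δ₂ = delta2 N δ₁) (hp₂ : p₂ = zExponent β₁ q₁ δ₂) (hp₃ : p₃ = zExponent β₂ q₁ δ₂) :
    ∃ K : ℝ, 0 < K ∧ ∀ (f : E N → ℝ) (g : E N → E N) (φ : ℕ → E N → ℝ), SobolevPair f g φ →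
      (∀ x, 0 ≤ f x) → (∀ x, x ∉ Ω → f x = 0) →
      ∀ η W : ℝ → ℝ, Continuous η → (∀ s, 0 ≤ η s) → Continuous W → (∀ s, 0 ≤ W s) →
      (∀ s, s ≤ 0 → W s = 0) →
      (∀ s, 0 ≤ s → ∫ r in (0 : ℝ)..s, W r = η s ^ sobolevExponent p₁ γ₁ δ₂) →
      (∀ s, 0 ≤ s → W s ≤ c * (η s ^ ((p₁ + 1) * dualExponent δ₂) * (η s ^ β₁ + η s ^ β₂))) →
      ∫⁻ x in Ω, ENNReal.ofReal (η (f x) ^ (p₁ + 1)) ≠ ⊤ →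
      (∫⁻ x in Ω, ENNReal.ofReal (η (f x) ^ (p₁ + 1))) ^ (2 / δ₁) *
        ((∫⁻ x in Ω, ENNReal.ofReal (η (f x) ^ p₂)) +
          (∫⁻ x in Ω, ENNReal.ofReal (η (f x) ^ p₃)) + 1) ^ (-((2 - δ₂) / δ₂)) ≤
      ENNReal.ofReal K * ∫⁻ x in Ω, ENNReal.ofReal (η (f x) ^ q₁ * ‖g x‖ ^ 2) := by
  obtain ⟨hδ₂1, hδ₂2⟩ := delta2_bounds hN hδ₁_ge hδ₁_lt hδ₂
  have hN' : (2 : ℝ) ≤ N := by exact_mod_cast hN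
  set e := dualExponent δ₂ with he
  set κ := sobolevExponent p₁ γ₁ δ₂ with hκ
  set ρ := 2 * δ₂ / (2 - δ₂) with hρ
  set a := (2 - δ₂) / δ₂ with ha
  have hδ₂0 : 0 < δ₂ := by linarith
  have h2δ : 0 < 2 - δ₂ := by linarith
  have ha0 : 0 < a := by positivity
  have he0 : 0 ≤ e := by
    rw [he, dualExponent, sub_nonneg, div_le_one hδ₂0]; exact hδ₂1
  have hρ1 : 1 ≤ ρ := by rw [hρ, le_div_iff₀ h2δ]; linarith
  have hρ0 : 0 < ρ := by linarith
  -- The three Hölder weights, carried by Y, by the moments Z and by the dissipation. This identity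
  -- dictates ρ, and hence the exponents p₂ and p₃.
  have hsum : e + 1 / ρ + 1 / 2 = 1 := by
    rw [he, dualExponent, hρ]; field_simp; ring
  have haρ : 1 / ρ * 2 = a := by rw [hρ, ha]; field_simp
  have hκ0 : 0 < κ := by
    rw [hκ, sobolevExponent]
    have : 0 ≤ (p₁ + 1) * dualExponent δ₂ := mul_nonneg (by linarith) he0
    linarith
  have hδ₁0 : 0 < δ₁ := by linarith
  have hPδ : (γ₁ + 1) * δ₁ = p₁ + 1 := by
    rw [hδ₁, delta1]; field_simp
  set p : NNReal := NNReal.conjExponent N with hp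
  have hNN : (1 : NNReal) < N := by
    have : (1 : ℕ) < N := by omega
    exact_mod_cast this
  have hpc : NNReal.HolderConjugate N p := NNReal.HolderConjugate.conjExponent hNN
  have hpr : (p : ℝ) = N / (N - 1) := by
    have := hpc.coe.conjugate_eq
    simpa using this
  have hp0 : (0 : ℝ) < p := by rw [hpr]; apply div_pos <;> linarith
  set Csob : ℝ≥0∞ := ((eLpNormLESNormFDerivOneConst (volume : Measure (E N)) p : NNReal) : ℝ≥0∞)
    with hCsob
  -- `M` is the price of lowering the Lebesgue exponent from p to δ₁ on the bounded set Ω. In the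
  -- other branch κ p = p₁ + 1 exactly and nothing is lost.
  set M : ℝ≥0∞ := if δ₁ ≤ p then (volume Ω) ^ (1 / δ₁ - 1 / (p : ℝ)) else 1 with hM
  have hMtop : M ≠ ⊤ := by
    rw [hM]
    split_ifs with h
    · refine ENNReal.rpow_ne_top_of_nonneg ?_ hΩb.measure_lt_top.ne
      rw [sub_nonneg]
      exact one_div_le_one_div_of_le hδ₁0 h
    · exact ENNReal.one_ne_top
  set B : ℝ≥0∞ := (M * (Csob * ENNReal.ofReal c) * (2 ^ (ρ - 1)) ^ (1 / ρ)) ^ 2 with hB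
  have hBtop : B ≠ ⊤ := by
    refine ENNReal.pow_ne_top (ENNReal.mul_ne_top (ENNReal.mul_ne_top hMtop
      (ENNReal.mul_ne_top ENNReal.coe_ne_top ENNReal.ofReal_ne_top)) ?_)
    refine ENNReal.rpow_ne_top_of_nonneg (by positivity) (ENNReal.rpow_ne_top_of_nonneg
      (by linarith) (by norm_num))
  -- Adding 1 makes the constant positive without any need to exclude `B = 0`.
  refine ⟨B.toReal + 1, by positivity, ?_⟩
  intro f g φ h hf0 hfz η W hη hη0 hW hW0 hWz hWint hWle hYtop
  set μ := (volume : Measure (E N)).restrict Ω with hμ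
  set ℓ : E N → ℝ≥0∞ := fun x => ENNReal.ofReal (η (f x)) with hℓ
  have hfm : AEMeasurable f μ := h.int_f.1.aemeasurable.restrict
  have hℓm : AEMeasurable ℓ μ := (hη.measurable.comp_aemeasurable hfm).ennreal_ofReal
  have hgm : AEMeasurable (fun x => ‖g x‖ₑ) μ := h.int_g.1.enorm.restrict
  have hpow : ∀ {b : ℝ}, 0 ≤ b → ∀ x, ENNReal.ofReal (η (f x) ^ b) = ℓ x ^ b := fun hb x =>
    (ENNReal.ofReal_rpow_of_nonneg (hη0 _) hb).symm
  have hp₂0 : p₂ = (β₁ - q₁ / 2) * ρ := hp₂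
  have hp₃0 : p₃ = (β₂ - q₁ / 2) * ρ := hp₃
  have hp₂n : 0 ≤ p₂ := by rw [hp₂0]; exact mul_nonneg (by linarith) hρ0.le
  have hp₃n : 0 ≤ p₃ := by rw [hp₃0]; exact mul_nonneg (by linarith) hρ0.le
  have hYe : ∫⁻ x in Ω, ENNReal.ofReal (η (f x) ^ (p₁ + 1)) = ∫⁻ x, ℓ x ^ (p₁ + 1) ∂μ :=
    lintegral_congr fun x => hpow (by linarith) x
  have hZ₂e : ∫⁻ x in Ω, ENNReal.ofReal (η (f x) ^ p₂)
      = ∫⁻ x, ℓ x ^ ((β₁ - q₁ / 2) * ρ) ∂μ := by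
    rw [← hp₂0]; exact lintegral_congr fun x => hpow hp₂n x
  have hZ₃e : ∫⁻ x in Ω, ENNReal.ofReal (η (f x) ^ p₃)
      = ∫⁻ x, ℓ x ^ ((β₂ - q₁ / 2) * ρ) ∂μ := by
    rw [← hp₃0]; exact lintegral_congr fun x => hpow hp₃n x
  have hDe : ∫⁻ x in Ω, ENNReal.ofReal (η (f x) ^ q₁ * ‖g x‖ ^ 2)
      = ∫⁻ x, ℓ x ^ q₁ * ‖g x‖ₑ ^ 2 ∂μ := by
    refine lintegral_congr fun x => ?_
    rw [ENNReal.ofReal_mul (Real.rpow_nonneg (hη0 _) _), hpow hq₁.le,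
      ENNReal.ofReal_pow (norm_nonneg _), ofReal_norm]
  rw [hYe] at hYtop
  rw [hYe, hZ₂e, hZ₃e, hDe]
  set Y := ∫⁻ x, ℓ x ^ (p₁ + 1) ∂μ
  set Z := ∫⁻ x, ℓ x ^ ((β₁ - q₁ / 2) * ρ) ∂μ + ∫⁻ x, ℓ x ^ ((β₂ - q₁ / 2) * ρ) ∂μ
  set D := ∫⁻ x, ℓ x ^ q₁ * ‖g x‖ₑ ^ 2 ∂μ
  -- Sobolev and Hölder
  have hV : ∀ x, ‖∫ r in (0 : ℝ)..f x, W r‖ₑ = ℓ x ^ κ := by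
    intro x
    rw [hWint _ (hf0 x), ← hpow hκ0.le, Real.enorm_of_nonneg (Real.rpow_nonneg (hη0 _) _)]
  have hVm : AEStronglyMeasurable (fun x => ∫ r in (0 : ℝ)..f x, W r) μ := by
    have cV : Continuous fun s => ∫ r in (0 : ℝ)..s, W r := continuous_iff_continuousAt.2
      fun s => (hW.integral_hasStrictDerivAt 0 s).hasDerivAt.continuousAt
    exact (cV.measurable.comp_aemeasurable hfm).aestronglyMeasurable
  have hVnorm : ∀ {b : ℝ}, eLpNorm' (fun x => ∫ r in (0 : ℝ)..f x, W r) b μ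
      = (∫⁻ x, ℓ x ^ (κ * b) ∂μ) ^ (1 / b) := by
    intro b
    rw [eLpNorm'_eq_lintegral_enorm]
    simp_rw [hV, ENNReal.rpow_mul]
  set T : ℝ≥0∞ := Csob * ENNReal.ofReal c * (2 ^ (ρ - 1) * Z) ^ (1 / ρ) * D ^ ((1 : ℝ) / 2) with hT
  have hSob : (∫⁻ x, ℓ x ^ (κ * p) ∂μ) ^ (1 / (p : ℝ)) ≤ T * Y ^ e := by
    rw [← hVnorm]
    have h1 := h.gagliardo_nirenberg hpc hW hW0 hWz
    rw [eLpNorm_eq_eLpNorm' (by exact_mod_cast hpc.symm.pos.ne') ENNReal.coe_ne_top,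
      ENNReal.coe_toReal] at h1
    have h2 : ∫⁻ x, ENNReal.ofReal (W (f x) * ‖g x‖) = ∫⁻ x, ENNReal.ofReal (W (f x) * ‖g x‖) ∂μ := by
      rw [hμ, ← lintegral_indicator hΩ.measurableSet]
      refine lintegral_congr fun x => ?_
      by_cases hx : x ∈ Ω
      · rw [indicator_of_mem hx]
      · rw [indicator_of_notMem hx, hfz x hx, hWz 0 le_rfl, zero_mul, ENNReal.ofReal_zero]
    -- A factor ℓ^{q₁/2} is split off both ℓ^{β₁} and ℓ^{β₂} and paired with |g|, so that the square
    -- of the pair is the dissipation density. The remaining exponents β - q₁/2 are positive by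
    -- assumption.
    have h3 : ∫⁻ x, ENNReal.ofReal (W (f x) * ‖g x‖) ∂μ ≤
        ENNReal.ofReal c * ∫⁻ x, ℓ x ^ ((p₁ + 1) * e) * (ℓ x ^ (β₁ - q₁ / 2) + ℓ x ^ (β₂ - q₁ / 2))
          * (ℓ x ^ (q₁ / 2) * ‖g x‖ₑ) ∂μ := by
      rw [← lintegral_const_mul' _ _ ENNReal.ofReal_ne_top]
      refine lintegral_mono fun x => ?_
      rw [ENNReal.ofReal_mul (hW0 _), ofReal_norm]
      calc ENNReal.ofReal (W (f x)) * ‖g x‖ₑ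
          ≤ ENNReal.ofReal (c * (η (f x) ^ ((p₁ + 1) * e) * (η (f x) ^ β₁ + η (f x) ^ β₂)))
            * ‖g x‖ₑ := by
            gcongr; exact hWle _ (hf0 x)
        _ = _ := by
            have r1 : ∀ b : ℝ, 0 ≤ η (f x) ^ b := fun b => Real.rpow_nonneg (hη0 _) b
            have r2 : ℓ x ^ β₁ = ℓ x ^ (β₁ - q₁ / 2) * ℓ x ^ (q₁ / 2) := by
              rw [← ENNReal.rpow_add_of_nonneg _ _ (by linarith) (by linarith)]; congr 1; ring
            have r3 : ℓ x ^ β₂ = ℓ x ^ (β₂ - q₁ / 2) * ℓ x ^ (q₁ / 2) := by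
              rw [← ENNReal.rpow_add_of_nonneg _ _ (by linarith) (by linarith)]; congr 1; ring
            rw [ENNReal.ofReal_mul hc.le, ENNReal.ofReal_mul (r1 _),
              ENNReal.ofReal_add (r1 _) (r1 _), hpow (mul_nonneg (by linarith) he0),
              hpow (by linarith), hpow (by linarith), r2, r3]
            ring
    have h4 := lintegral_holder_three hℓm hgm (P := p₁ + 1) (b₁ := β₁ - q₁ / 2)
      (b₂ := β₂ - q₁ / 2) (q := q₁) he0 hρ1 hsum
    calc eLpNorm' (fun x => ∫ r in (0 : ℝ)..f x, W r) p μ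
        ≤ eLpNorm' (fun x => ∫ r in (0 : ℝ)..f x, W r) p volume :=
          eLpNorm'_mono_measure _ Measure.restrict_le_self hp0.le
      _ ≤ Csob * (ENNReal.ofReal c * (Y ^ e * (2 ^ (ρ - 1) * Z) ^ (1 / ρ) * D ^ ((1 : ℝ) / 2))) := by
          refine h1.trans ?_
          rw [h2]
          gcongr
          refine h3.trans ?_
          gcongr
      _ = T * Y ^ e := by rw [hT]; ring
  -- If δ₁ ≤ p, then e = 0, κ = γ₁ + 1 and κ δ₁ = p₁ + 1, and only the embedding of L^p(Ω) into
  -- L^{δ₁}(Ω) is needed. Otherwise κ p = p₁ + 1 and 1/p = 1/δ₁ + e, so Y^e cancels from both sides;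
  -- this is why Y must be finite, and Y = 0 is treated apart.
  have hY1 : Y ^ (1 / δ₁) ≤ M * T := by
    by_cases hcase : δ₁ ≤ p
    · have hδ₂e : δ₂ = 1 := by
        rw [hδ₂, delta2, if_pos]; rw [← hpr]; exact hcase
      have hee : e = 0 := by rw [he, dualExponent, hδ₂e]; norm_num
      have hκe : κ = γ₁ + 1 := by rw [hκ, sobolevExponent, ← he, hee]; ring
      have h5 := eLpNorm'_le_eLpNorm'_mul_rpow_measure_univ hδ₁0 hcase hVm
      rw [hVnorm, hVnorm, hκe, hPδ, ← hκe] at h5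
      rw [hee, ENNReal.rpow_zero, mul_one] at hSob
      rw [hM, if_pos hcase, mul_comm]
      refine h5.trans ?_
      rw [hμ, Measure.restrict_apply_univ]
      gcongr
    · rw [hM, if_neg hcase, one_mul]
      have hδ₂e : δ₂ = δ₁ * N / (N + δ₁) := by
        rw [hδ₂, delta2, if_neg]; rw [← hpr]; exact hcase
      have hN1 : (N : ℝ) - 1 ≠ 0 := by linarith
      have hN0 : (N : ℝ) ≠ 0 := by linarith
      have hee : e = 1 - (N + δ₁) / (δ₁ * N) := by
        rw [he, dualExponent, hδ₂e, one_div_div]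
      have hκp : κ * p = p₁ + 1 := by
        rw [hκ, sobolevExponent, ← he, hee, ← hPδ, hpr]
        field_simp
        ring
      have hexp : 1 / (p : ℝ) = 1 / δ₁ + e := by
        rw [hee, hpr]; field_simp; ring
      rw [hκp, hexp] at hSob
      by_cases hY0 : Y = 0
      · rw [hY0, ENNReal.zero_rpow_of_pos (by positivity)]
        exact zero_le
      · rw [ENNReal.rpow_add _ _ hY0 hYtop] at hSob
        exact (ENNReal.mul_le_mul_iff_left (ENNReal.rpow_pos (pos_iff_ne_zero.2 hY0) hYtop).ne'
          (ENNReal.rpow_ne_top_of_nonneg he0 hYtop)).1 hSob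
  have hY2 : Y ^ (2 / δ₁) ≤ B * (Z ^ a * D) := by
    have h6 : Y ^ (2 / δ₁) = (Y ^ (1 / δ₁)) ^ 2 := by
      rw [← ENNReal.rpow_natCast, ← ENNReal.rpow_mul]; congr 1; push_cast; ring
    rw [h6]
    refine (pow_le_pow_left' hY1 2).trans_eq ?_
    have h7 : (Z ^ (1 / ρ)) ^ 2 = Z ^ a := by
      rw [← ENNReal.rpow_natCast, ← ENNReal.rpow_mul, ← haρ]; norm_num
    have h8 : (D ^ ((1 : ℝ) / 2)) ^ 2 = D := by
      rw [← ENNReal.rpow_natCast, ← ENNReal.rpow_mul]; norm_num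
    rw [hT, ENNReal.mul_rpow_of_nonneg _ _ (by positivity : (0 : ℝ) ≤ 1 / ρ), ← h7, hB]
    conv_rhs => rw [← h8]
    ring
  have hBle : B ≤ ENNReal.ofReal (B.toReal + 1) := by
    rw [← ENNReal.ofReal_toReal hBtop]
    refine ENNReal.ofReal_le_ofReal ?_
    rw [ENNReal.toReal_ofReal ENNReal.toReal_nonneg]
    linarith
  -- For Z = ∞ the second factor is 0 and the product is 0, in agreement with reading the fraction
  -- as 0.
  have hZS : Z ^ a * (Z + 1) ^ (-a) ≤ 1 := by
    by_cases hZt : Z = ⊤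
    · have : (Z + 1) ^ (-a) = 0 := by
        rw [hZt, top_add, ENNReal.top_rpow_of_neg (neg_lt_zero.2 ha0)]
      rw [this, mul_zero]; exact zero_le
    · rw [ENNReal.rpow_neg]
      refine (mul_le_mul_left (ENNReal.rpow_le_rpow (le_self_add : Z ≤ Z + 1) ha0.le) _).trans ?_
      exact ENNReal.mul_inv_le_one _
  calc Y ^ (2 / δ₁) * (Z + 1) ^ (-a) ≤ B * (Z ^ a * D) * (Z + 1) ^ (-a) := by gcongr
    _ = B * D * (Z ^ a * (Z + 1) ^ (-a)) := by ring
    _ ≤ B * D * 1 := by gcongr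
    _ ≤ ENNReal.ofReal (B.toReal + 1) * D := by rw [mul_one]; gcongr

/-! ### Regularity and growth of the weights -/

/-- `H`, extended by `0` to the negative half line. -/
def Hpos (h : ℝ → ℝ) (s : ℝ) : ℝ := H h (max s 0)

/-- The truncated weight `(H / (1 + H / K))^{p₁} F`, extended by `0`. -/
def truncWeight (h a : ℝ → ℝ) (p₁ K s : ℝ) : ℝ :=
  (Hpos h s / (1 + Hpos h s / K)) ^ p₁ * F h a (max s 0)

/-- A lower bound for the derivative of `truncWeight`. -/
def truncDensity (h : ℝ → ℝ) (p₁ q₁ c₃ K s : ℝ) : ℝ :=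
  c₃ * Hpos h s ^ q₁ * (1 + Hpos h s / K) ^ (-(p₁ + 1))

/-- The derivative of `H^κ`, extended by `0`. -/
def powDeriv (h : ℝ → ℝ) (κ s : ℝ) : ℝ :=
  if 0 < s then κ * Hpos h s ^ (κ - 1) * h s else 0

namespace IsAdmissible

variable {h a : ℝ → ℝ}

theorem intervalIntegrable (hA : IsAdmissible h a) {v w : ℝ} (hv : 0 ≤ v) (hw : 0 ≤ w) :
    IntervalIntegrable h volume v w := by
  rw [intervalIntegrable_iff']
  refine hA.h_locallyIntegrableOn.integrableOn_compact_subset ?_ isCompact_uIcc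
  intro x hx
  exact (le_min hv hw).trans hx.1

theorem hasDerivAt_H (hA : IsAdmissible h a) {s : ℝ} (hs : 0 < s) : HasDerivAt (H h) (h s) s := by
  have hc : ContinuousAt h s := hA.h_continuousOn.continuousAt (Ioi_mem_nhds hs)
  exact intervalIntegral.integral_hasDerivAt_right (hA.intervalIntegrable le_rfl hs.le)
    (hA.h_continuousOn.stronglyMeasurableAtFilter isOpen_Ioi s hs) hc

theorem continuousOn_H (hA : IsAdmissible h a) : ContinuousOn (H h) (Ici 0) := by
  intro s hs
  have h1 : ContinuousOn (H h) (Icc 0 (s + 1)) := by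
    have hs' : (0 : ℝ) ≤ s + 1 := by linarith [mem_Ici.1 hs]
    have := intervalIntegral.continuousOn_primitive_interval' (b₁ := 0) (b₂ := s + 1) (a := 0)
      (hA.intervalIntegrable le_rfl hs') left_mem_uIcc
    rwa [uIcc_of_le hs'] at this
  refine (h1 s ⟨hs, by linarith⟩).mono_of_mem_nhdsWithin ?_
  rw [← Ici_inter_Iic]
  exact inter_mem self_mem_nhdsWithin (mem_nhdsWithin_of_mem_nhds (Iic_mem_nhds (by linarith)))

theorem H_zero (h : ℝ → ℝ) : H h 0 = 0 := by simp [H]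

theorem H_strictMonoOn (hA : IsAdmissible h a) : StrictMonoOn (H h) (Ici 0) := by
  refine strictMonoOn_of_deriv_pos (convex_Ici 0) hA.continuousOn_H fun s hs => ?_
  rw [interior_Ici] at hs
  rw [(hA.hasDerivAt_H hs).deriv]
  exact hA.h_pos s hs

theorem Hpos_of_nonneg {s : ℝ} (hs : 0 ≤ s) : Hpos h s = H h s := by rw [Hpos, max_eq_left hs]

theorem Hpos_of_nonpos {s : ℝ} (hs : s ≤ 0) : Hpos h s = 0 := by
  rw [Hpos, max_eq_right hs, H_zero]

theorem Hpos_pos (hA : IsAdmissible h a) {s : ℝ} (hs : 0 < s) : 0 < Hpos h s := by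
  rw [Hpos_of_nonneg hs.le, ← H_zero h]
  exact hA.H_strictMonoOn (mem_Ici.2 le_rfl) (mem_Ici.2 hs.le) hs

theorem Hpos_nonneg (hA : IsAdmissible h a) (s : ℝ) : 0 ≤ Hpos h s := by
  rcases le_or_gt s 0 with hs | hs
  · exact (Hpos_of_nonpos hs).ge
  · exact (hA.Hpos_pos hs).le

theorem continuous_Hpos (hA : IsAdmissible h a) : Continuous (Hpos h) :=
  hA.continuousOn_H.comp_continuous (by fun_prop) fun _ => mem_Ici.2 (le_max_right _ _)

theorem hasDerivAt_Hpos (hA : IsAdmissible h a) {s : ℝ} (hs : 0 < s) :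
    HasDerivAt (Hpos h) (h s) s := by
  refine (hA.hasDerivAt_H hs).congr_of_eventuallyEq ?_
  filter_upwards [Ioi_mem_nhds hs] with r hr
  exact Hpos_of_nonneg (le_of_lt hr)

theorem F_zero (hA : IsAdmissible h a) : F h a 0 = 0 := by simp [F, hA.a_zero]

theorem F_pos (hA : IsAdmissible h a) {s : ℝ} (hs : 0 < s) : 0 < F h a s :=
  mul_pos (hA.h_pos s hs) (hA.a_pos s hs)

theorem F_nonneg (hA : IsAdmissible h a) {s : ℝ} (hs : 0 ≤ s) : 0 ≤ F h a s := by
  rcases hs.eq_or_lt with rfl | hs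
  · exact hA.F_zero.ge
  · exact (hA.F_pos hs).le

theorem continuousOn_F (hA : IsAdmissible h a) : ContinuousOn (F h a) (Ici 0) :=
  hA.F_locallyLipschitzOn.continuousOn

theorem continuous_F_max (hA : IsAdmissible h a) : Continuous fun s => F h a (max s 0) :=
  hA.continuousOn_F.comp_continuous (by fun_prop) fun _ => mem_Ici.2 (le_max_right _ _)

theorem continuous_trunc_pow (hA : IsAdmissible h a) {p₁ K : ℝ} (hp₁ : 0 < p₁) (hK : 0 < K) :
    Continuous fun s => (Hpos h s / (1 + Hpos h s / K)) ^ p₁ := by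
  refine Continuous.rpow_const (hA.continuous_Hpos.div₀ (by
    have := hA.continuous_Hpos; fun_prop) fun s => ?_) fun s => Or.inr hp₁.le
  have := hA.Hpos_nonneg s
  positivity

theorem continuous_truncWeight (hA : IsAdmissible h a) {p₁ K : ℝ} (hp₁ : 0 < p₁) (hK : 0 < K) :
    Continuous (truncWeight h a p₁ K) :=
  (hA.continuous_trunc_pow hp₁ hK).mul hA.continuous_F_max

theorem truncWeight_of_nonpos (hA : IsAdmissible h a) {p₁ K s : ℝ} (hs : s ≤ 0) :
    truncWeight h a p₁ K s = 0 := by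
  rw [truncWeight, max_eq_right hs, hA.F_zero, mul_zero]

theorem truncWeight_pos (hA : IsAdmissible h a) {p₁ K s : ℝ} (hK : 0 < K) (hs : 0 < s) :
    0 < truncWeight h a p₁ K s := by
  have h1 := hA.Hpos_pos hs
  have h2 := hA.F_pos hs
  rw [truncWeight, max_eq_left hs.le]
  positivity

theorem trunc_pow_le (hA : IsAdmissible h a) {p₁ K : ℝ} (hp₁ : 0 < p₁) (hK : 0 < K) (s : ℝ) :
    (Hpos h s / (1 + Hpos h s / K)) ^ p₁ ≤ K ^ p₁ := by
  have h1 := hA.Hpos_nonneg s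
  refine Real.rpow_le_rpow (by positivity) ?_ hp₁.le
  rw [div_le_iff₀ (by positivity)]
  have : K * (Hpos h s / K) = Hpos h s := by field_simp
  nlinarith

theorem truncWeight_le (hA : IsAdmissible h a) {p₁ K s : ℝ} (hp₁ : 0 < p₁) (hK : 0 < K)
    (hs : 0 ≤ s) : truncWeight h a p₁ K s ≤ H h s ^ p₁ * F h a s := by
  have h1 := hA.Hpos_nonneg s
  rw [truncWeight, max_eq_left hs, ← Hpos_of_nonneg hs]
  refine mul_le_mul_of_nonneg_right (Real.rpow_le_rpow (by positivity) ?_ hp₁.le) (hA.F_nonneg hs)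
  refine div_le_self h1 ?_
  have : 0 ≤ Hpos h s / K := by positivity
  linarith

theorem continuous_truncDensity (hA : IsAdmissible h a) {p₁ q₁ c₃ K : ℝ} (hq₁ : 0 < q₁)
    (hK : 0 < K) : Continuous (truncDensity h p₁ q₁ c₃ K) := by
  have hc := hA.continuous_Hpos
  refine (continuous_const.mul (hc.rpow_const fun s => Or.inr hq₁.le)).mul
    (Continuous.rpow_const (by fun_prop) fun s => Or.inl ?_)
  have := hA.Hpos_nonneg s
  positivity

theorem truncDensity_nonneg (hA : IsAdmissible h a) {p₁ q₁ c₃ K : ℝ} (hc₃ : 0 < c₃)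
    (hK : 0 < K) (s : ℝ) : 0 ≤ truncDensity h p₁ q₁ c₃ K s := by
  have := hA.Hpos_nonneg s
  unfold truncDensity
  positivity

theorem truncDensity_of_nonpos {p₁ q₁ c₃ K s : ℝ} (hq₁ : 0 < q₁) (hs : s ≤ 0) :
    truncDensity h p₁ q₁ c₃ K s = 0 := by
  rw [truncDensity, Hpos_of_nonpos hs, Real.zero_rpow hq₁.ne', mul_zero, zero_mul]

/-- On (0, ∞) one has F = (H^{p₁}F) / H^{p₁}, so differentiability is inherited from the lower
growth condition; the sign comes from monotonicity. -/
theorem exists_hasDerivAt_F (hA : IsAdmissible h a) {p₁ q₁ c₃ : ℝ}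
    (hlow : LowerGrowth h a p₁ q₁ c₃) {s : ℝ} (hs : 0 < s) :
    ∃ F', HasDerivAt (F h a) F' s ∧ 0 ≤ F' := by
  have hnhds : Ici (0 : ℝ) ∈ 𝓝 s := Ici_mem_nhds hs
  have hG : DifferentiableAt ℝ (fun s => H h s ^ p₁ * F h a s) s :=
    (hlow.1 s hs.le).differentiableAt hnhds
  have hHs : 0 < H h s := by rw [← Hpos_of_nonneg hs.le]; exact hA.Hpos_pos hs
  have hP : DifferentiableAt ℝ (fun s => H h s ^ p₁) s :=
    ((hA.hasDerivAt_H hs).rpow_const (Or.inl hHs.ne')).differentiableAt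
  have hF : DifferentiableAt ℝ (F h a) s := by
    refine (hG.div hP (Real.rpow_pos_of_pos hHs _).ne').congr_of_eventuallyEq ?_
    filter_upwards [Ioi_mem_nhds hs] with r hr
    have : 0 < H h r := by
      rw [← Hpos_of_nonneg (le_of_lt hr)]; exact hA.Hpos_pos hr
    have h2 := (Real.rpow_pos_of_pos this p₁).ne'
    simp only [Pi.div_apply]
    field_simp
  refine ⟨_, hF.hasDerivAt, ?_⟩
  rw [← derivWithin_of_mem_nhds hnhds]
  exact hA.F_monotoneOn.derivWithin_nonneg

/-- With w = H, the derivative of w/(1+w/K) is h/(1+w/K)². Compared with [H^{p₁}F]', the term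
containing h acquires exactly the factor (1+w/K)^{-(p₁+1)}, and the term containing F' the larger
factor (1+w/K)^{-p₁}. Since F' ≥ 0, the lower growth condition survives with the smaller factor. -/
theorem truncWeight_deriv (hA : IsAdmissible h a) {p₁ q₁ c₃ K : ℝ}
    (hK : 0 < K) (hlow : LowerGrowth h a p₁ q₁ c₃) {s : ℝ} (hs : 0 < s) :
    HasDerivAt (truncWeight h a p₁ K) (deriv (truncWeight h a p₁ K) s) s ∧
      truncDensity h p₁ q₁ c₃ K s ≤ deriv (truncWeight h a p₁ K) s := by
  obtain ⟨F', hF, hF'⟩ := hA.exists_hasDerivAt_F hlow hs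
  have hFm : HasDerivAt (fun s => F h a (max s 0)) F' s := by
    refine hF.congr_of_eventuallyEq ?_
    filter_upwards [Ioi_mem_nhds hs] with r hr
    rw [max_eq_left (le_of_lt hr)]
  have hH := hA.hasDerivAt_Hpos hs
  set w := Hpos h s with hw
  have hw0 : 0 < w := hA.Hpos_pos hs
  have hq : 0 < 1 + w / K := by positivity
  have hFs := hA.F_pos hs
  have hhs := hA.h_pos s hs
  have hd1 : HasDerivAt (fun s => Hpos h s / (1 + Hpos h s / K)) (h s / (1 + w / K) ^ 2) s := by
    have := hH.div ((hH.div_const K).const_add 1) hq.ne'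
    refine this.congr_deriv ?_
    rw [← hw]
    congr 1
    field_simp
    ring
  have hd2 := (hd1.rpow_const (p := p₁) (Or.inl (by positivity))).mul hFm
  have hd3 : HasDerivAt (truncWeight h a p₁ K) _ s := hd2
  refine ⟨hd3.differentiableAt.hasDerivAt, ?_⟩
  rw [hd3.deriv, max_eq_left hs.le]
  have hG : HasDerivAt (fun s => H h s ^ p₁ * F h a s) (h s * p₁ * w ^ (p₁ - 1) * F h a s
      + w ^ p₁ * F') s := by
    rw [hw, Hpos_of_nonneg hs.le]
    refine ((hA.hasDerivAt_H hs).rpow_const (Or.inl ?_)).mul hF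
    rw [← Hpos_of_nonneg hs.le]; exact hw0.ne'
  have hG2 := hlow.2 s hs.le
  rw [derivWithin_of_mem_nhds (Ici_mem_nhds hs), hG.deriv, ← Hpos_of_nonneg hs.le, ← hw] at hG2
  have hqle : (1 : ℝ) ≤ 1 + w / K := by
    have : 0 ≤ w / K := by positivity
    linarith
  have e1 : (w / (1 + w / K)) ^ (p₁ - 1) * (1 / (1 + w / K) ^ 2)
      = w ^ (p₁ - 1) * (1 + w / K) ^ (-(p₁ + 1)) := by
    rw [Real.div_rpow hw0.le hq.le, div_mul_div_comm, mul_one, ← Real.rpow_natCast,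
      ← Real.rpow_add hq, Real.rpow_neg hq.le, div_eq_mul_inv]
    congr 3
    push_cast; ring
  have e2 : w ^ p₁ * (1 + w / K) ^ (-(p₁ + 1)) ≤ (w / (1 + w / K)) ^ p₁ := by
    rw [Real.div_rpow hw0.le hq.le, div_eq_mul_inv (w ^ p₁), ← Real.rpow_neg hq.le]
    exact mul_le_mul_of_nonneg_left (Real.rpow_le_rpow_of_exponent_le hqle (by linarith))
      (by positivity)
  have hq2 : 0 ≤ (1 + w / K) ^ (-(p₁ + 1)) := by positivity
  calc truncDensity h p₁ q₁ c₃ K s = c₃ * w ^ q₁ * (1 + w / K) ^ (-(p₁ + 1)) := rfl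
    _ ≤ (h s * p₁ * w ^ (p₁ - 1) * F h a s + w ^ p₁ * F') * (1 + w / K) ^ (-(p₁ + 1)) :=
        mul_le_mul_of_nonneg_right hG2 hq2
    _ = h s * p₁ * F h a s * (w ^ (p₁ - 1) * (1 + w / K) ^ (-(p₁ + 1)))
        + w ^ p₁ * (1 + w / K) ^ (-(p₁ + 1)) * F' := by ring
    _ ≤ h s * p₁ * F h a s * ((w / (1 + w / K)) ^ (p₁ - 1) * (1 / (1 + w / K) ^ 2))
        + (w / (1 + w / K)) ^ p₁ * F' := by
        rw [e1]; gcongr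
    _ = _ := by ring

theorem powDeriv_nonneg (hA : IsAdmissible h a) {κ : ℝ} (hκ : 0 < κ) (s : ℝ) :
    0 ≤ powDeriv h κ s := by
  unfold powDeriv
  split_ifs with hs
  · have h1 := hA.Hpos_nonneg s
    have h2 := hA.h_pos s hs
    positivity
  · exact le_rfl

theorem powDeriv_of_nonpos {κ s : ℝ} (hs : s ≤ 0) : powDeriv h κ s = 0 := if_neg hs.not_gt

/-- For s > 0 the derivative of H^{γ₁+1+θ} is (γ₁+1+θ)/(γ₁+1) · H^θ times that of H^{γ₁+1}, to which
the upper growth condition applies. -/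
theorem powDeriv_le (hA : IsAdmissible h a) {γ₁ β₁ β₂ c₅ θ : ℝ} (hγ₁ : 0 < γ₁) (hc₅ : 0 < c₅)
    (hθ : 0 ≤ θ) (hup : UpperGrowth h γ₁ β₁ β₂ c₅) (s : ℝ) :
    powDeriv h (γ₁ + 1 + θ) s ≤ (γ₁ + 1 + θ) / (γ₁ + 1) * c₅ *
      (Hpos h s ^ θ * (Hpos h s ^ β₁ + Hpos h s ^ β₂)) := by
  have hw := hA.Hpos_nonneg s
  unfold powDeriv
  split_ifs with hs
  · have hw0 := hA.Hpos_pos hs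
    have h2 := hup.2 s hs.le
    have hd := (hA.hasDerivAt_H hs).rpow_const (p := γ₁ + 1)
      (Or.inl (by rw [← Hpos_of_nonneg hs.le]; exact hw0.ne'))
    rw [derivWithin_of_mem_nhds (Ici_mem_nhds hs), hd.deriv, ← Hpos_of_nonneg hs.le] at h2
    have e : Hpos h s ^ (γ₁ + 1 + θ - 1) = Hpos h s ^ θ * Hpos h s ^ (γ₁ + 1 - 1) := by
      rw [← Real.rpow_add hw0]; congr 1; ring
    rw [e]
    calc (γ₁ + 1 + θ) * (Hpos h s ^ θ * Hpos h s ^ (γ₁ + 1 - 1)) * h s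
        = (γ₁ + 1 + θ) / (γ₁ + 1) * Hpos h s ^ θ *
          (h s * (γ₁ + 1) * Hpos h s ^ (γ₁ + 1 - 1)) := by field_simp
      _ ≤ (γ₁ + 1 + θ) / (γ₁ + 1) * Hpos h s ^ θ * (c₅ * (Hpos h s ^ β₁ + Hpos h s ^ β₂)) := by
          gcongr
      _ = _ := by ring
  · positivity

/-- Only the point 0 is delicate, since h may be singular there. The growth bound squeezes the
derivative to 0, as β₁ and β₂ are positive. -/
theorem continuous_powDeriv (hA : IsAdmissible h a) {γ₁ β₁ β₂ c₅ θ : ℝ} (hγ₁ : 0 < γ₁)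
    (hc₅ : 0 < c₅) (hθ : 0 ≤ θ) (hβ₁ : 0 < β₁) (hβ₂ : 0 < β₂)
    (hup : UpperGrowth h γ₁ β₁ β₂ c₅) : Continuous (powDeriv h (γ₁ + 1 + θ)) := by
  have hc := hA.continuous_Hpos
  rw [continuous_iff_continuousAt]
  intro s
  rcases lt_trichotomy s 0 with hs | rfl | hs
  · refine (continuousAt_const (y := (0 : ℝ))).congr ?_
    filter_upwards [Iio_mem_nhds hs] with r hr
    exact (powDeriv_of_nonpos (le_of_lt hr)).symm
  · rw [ContinuousAt, powDeriv_of_nonpos le_rfl]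
    have hcont : Continuous fun s => (γ₁ + 1 + θ) / (γ₁ + 1) * c₅ *
        (Hpos h s ^ θ * (Hpos h s ^ β₁ + Hpos h s ^ β₂)) :=
      continuous_const.mul ((hc.rpow_const fun s => Or.inr hθ).mul
        ((hc.rpow_const fun s => Or.inr hβ₁.le).add (hc.rpow_const fun s => Or.inr hβ₂.le)))
    have ht := hcont.tendsto 0
    simp only [Hpos_of_nonpos le_rfl, Real.zero_rpow hβ₁.ne', Real.zero_rpow hβ₂.ne', add_zero,
      mul_zero] at ht
    exact squeeze_zero (hA.powDeriv_nonneg (by linarith))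
      (hA.powDeriv_le hγ₁ hc₅ hθ hup) ht
  · have h1 : ContinuousAt (fun s => (γ₁ + 1 + θ) * Hpos h s ^ (γ₁ + 1 + θ - 1) * h s) s :=
      (continuousAt_const.mul (hc.rpow_const fun s => Or.inr (by linarith)).continuousAt).mul
        (hA.h_continuousOn.continuousAt (Ioi_mem_nhds hs))
    refine h1.congr ?_
    filter_upwards [Ioi_mem_nhds hs] with r hr
    exact (if_pos hr).symm

theorem integral_powDeriv (hA : IsAdmissible h a) {κ : ℝ} (hκ : 0 < κ)
    (hc : Continuous (powDeriv h κ)) {s : ℝ} (hs : 0 ≤ s) :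
    ∫ r in (0 : ℝ)..s, powDeriv h κ r = Hpos h s ^ κ := by
  rw [intervalIntegral.integral_eq_sub_of_hasDerivAt_of_le hs
    (f := fun s => Hpos h s ^ κ) ?_ ?_ (hc.intervalIntegrable _ _), Hpos_of_nonpos le_rfl,
    Real.zero_rpow hκ.ne', sub_zero]
  · exact (hA.continuous_Hpos.rpow_const fun s => Or.inr hκ.le).continuousOn
  · intro r hr
    rw [powDeriv, if_pos hr.1]
    refine ((hA.hasDerivAt_Hpos hr.1).rpow_const (Or.inl (hA.Hpos_pos hr.1).ne')).congr_deriv ?_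
    ring

end IsAdmissible


/-! ### Extension by zero and dissipation at a fixed time -/

theorem tendsto_integral_norm_of_eLpNorm {α F : Type*} [MeasurableSpace α] [NormedAddCommGroup F]
    {μ : Measure α} [IsFiniteMeasure μ] {q : ℝ≥0∞} (hq : 1 ≤ q) {u : ℕ → α → F}
    (hu : ∀ n, AEStronglyMeasurable (u n) μ)
    (h : Tendsto (fun n => eLpNorm (u n) q μ) atTop (𝓝 0)) :
    Tendsto (fun n => ∫ x, ‖u n x‖ ∂μ) atTop (𝓝 0) := by
  have he : 0 ≤ 1 / (1 : ℝ≥0∞).toReal - 1 / q.toReal := by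
    rcases eq_or_ne q ⊤ with rfl | hq'
    · simp
    · have : 1 ≤ q.toReal := by
        rw [← ENNReal.toReal_one]; exact ENNReal.toReal_mono hq' hq
      rw [ENNReal.toReal_one, sub_nonneg]
      exact one_div_le_one_div_of_le one_pos this
  have h1 : Tendsto (fun n => eLpNorm (u n) 1 μ) atTop (𝓝 0) := by
    have h2 := ENNReal.Tendsto.mul_const h
      (b := μ univ ^ (1 / (1 : ℝ≥0∞).toReal - 1 / q.toReal))
      (Or.inr (ENNReal.rpow_ne_top_of_nonneg he (measure_ne_top _ _)))
    rw [zero_mul] at h2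
    exact tendsto_of_tendsto_of_tendsto_of_le_of_le tendsto_const_nhds h2 (fun _ => zero_le)
      fun n => eLpNorm_le_eLpNorm_mul_rpow_measure_univ hq (hu n)
  have h3 := (ENNReal.tendsto_toReal ENNReal.zero_ne_top).comp h1
  rw [ENNReal.toReal_zero] at h3
  refine h3.congr fun n => ?_
  rw [Function.comp_apply, integral_norm_eq_lintegral_enorm (hu n), eLpNorm_one_eq_lintegral_enorm]

theorem IsTestFunction.eq_zero {Ω : Set (E N)} {ψ : E N → ℝ} (hψ : IsTestFunction Ω ψ) {x : E N}
    (hx : x ∉ Ω) : ψ x = 0 :=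
  image_eq_zero_of_notMem_tsupport fun h => hx (hψ.2.2 h)

theorem IsTestFunction.gradient_eq_zero {Ω : Set (E N)} {ψ : E N → ℝ} (hψ : IsTestFunction Ω ψ)
    {x : E N} (hx : x ∉ Ω) : ∇ ψ x = 0 := by
  by_contra h
  exact hx (hψ.2.2 (support_gradient_subset ψ h))

/-- Test functions and their gradients vanish off Ω, so the same approximating sequence works on the
whole space; boundedness of Ω turns L^q convergence into L¹ convergence. Allowing any representative
f' makes it possible to choose one that is nonnegative everywhere. -/
theorem MemW0.exists_sobolevPair {Ω : Set (E N)} (hΩ : IsOpen Ω) (hΩb : Bornology.IsBounded Ω)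
    {q : ℝ≥0∞} (hq : 1 ≤ q) {f f' : E N → ℝ} (hf : MemW0 q Ω f)
    (hf' : f' =ᵐ[volume] Ω.indicator f) :
    ∃ g φ, SobolevPair f' g φ ∧ (∀ k, IsTestFunction Ω (φ k)) ∧ MemLp g q ∧
      Tendsto (fun k => eLpNorm (fun x => ∇ (φ k) x - g x) q volume) atTop (𝓝 0) := by
  obtain ⟨hfL, g, hg, φ, hφ, hφf, hφg⟩ := hf
  have : IsFiniteMeasure (volume.restrict Ω) := ⟨by
    rw [Measure.restrict_apply_univ]; exact hΩb.measure_lt_top⟩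
  have hm := hΩ.measurableSet
  have e1 : ∀ k x, φ k x - Ω.indicator f x = Ω.indicator (fun x => φ k x - f x) x := by
    intro k x
    by_cases hx : x ∈ Ω
    · simp [hx]
    · simp [hx, (hφ k).eq_zero hx]
  have e2 : ∀ k x, ∇ (φ k) x - Ω.indicator g x = Ω.indicator (fun x => ∇ (φ k) x - g x) x := by
    intro k x
    by_cases hx : x ∈ Ω
    · simp [hx]
    · simp [hx, (hφ k).gradient_eq_zero hx]
  have cφ : ∀ k, Continuous (∇ (φ k)) := fun k => continuous_gradient ((hφ k).1.of_le (by simp))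
  refine ⟨Ω.indicator g, φ, ⟨?_, ?_, fun k => (hφ k).1, fun k => (hφ k).2.1, ?_, ?_⟩, hφ, ?_, ?_⟩
  · exact ((integrable_indicator_iff hm).2 (hfL.integrable hq)).congr hf'.symm
  · exact (integrable_indicator_iff hm).2 (hg.integrable hq)
  · refine (tendsto_integral_norm_of_eLpNorm hq (fun k =>
      (hφ k).1.continuous.aestronglyMeasurable.sub hfL.1) hφf).congr fun k => ?_
    rw [← integral_indicator hm]
    refine integral_congr_ae ?_
    filter_upwards [hf'] with x hx
    rw [hx, e1, norm_indicator_eq_indicator_norm]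
    rfl
  · refine (tendsto_integral_norm_of_eLpNorm hq (fun k =>
      (cφ k).aestronglyMeasurable.sub hg.1) hφg).congr fun k => ?_
    rw [← integral_indicator hm]
    refine integral_congr_ae (Eventually.of_forall fun x => ?_)
    simp only
    rw [e2, norm_indicator_eq_indicator_norm]
    rfl
  · exact (memLp_indicator_iff_restrict hm).2 hg
  · refine hφg.congr fun k => ?_
    rw [← eLpNorm_indicator_eq_eLpNorm_restrict hm]
    congr 1
    exact (funext (e2 k)).symm

theorem HasWeakLaplacian.weakDivergence {Ω : Set (E N)} (hΩ : IsOpen Ω) {f f' L : E N → ℝ}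
    (h : HasWeakLaplacian Ω f L) (hf' : f' =ᵐ[volume] Ω.indicator f) {g : E N → E N}
    {φ : ℕ → E N → ℝ} (hp : SobolevPair f' g φ) : WeakDivergence Ω g L := by
  refine ⟨h.2.1, fun ψ hψ => ?_⟩
  rw [← h.2.2 ψ hψ, ← neg_eq_iff_eq_neg, ← hp.integral_mul_laplacian hψ.1 hψ.2.1,
    ← integral_indicator hΩ.measurableSet]
  refine integral_congr_ae ?_
  filter_upwards [hf'] with x hx
  rw [hx, indicator_mul_left]

/-- The dissipation at a fixed time, bounded from below by the moments. -/
theorem exists_dissipation_bound (hN : 2 ≤ N) {Ω : Set (E N)} (hΩ : IsOpen Ω)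
    (hΩb : Bornology.IsBounded Ω) {p₁ q₁ γ₁ β₁ β₂ δ₁ δ₂ p₂ p₃ c₃ c₅ : ℝ}
    (hp₁ : 0 < p₁) (hq₁ : 0 < q₁) (hγ₁ : 0 < γ₁) (hβ : β₂ < β₁) (hβ₂ : q₁ / 2 < β₂)
    (hc₃ : 0 < c₃) (hc₅ : 0 < c₅)
    (hδ₁ : δ₁ = delta1 p₁ γ₁) (hδ₁_ge : 1 ≤ δ₁) (hδ₁_lt : δ₁ < 2)
    (hδ₂ : δ₂ = delta2 N δ₁) (hp₂ : p₂ = zExponent β₁ q₁ δ₂) (hp₃ : p₃ = zExponent β₂ q₁ δ₂) :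
    ∃ κ : ℝ, 0 < κ ∧ ∀ h a : ℝ → ℝ, IsAdmissible h a → LowerGrowth h a p₁ q₁ c₃ →
      UpperGrowth h γ₁ β₁ β₂ c₅ → ∀ f L : E N → ℝ, (∀ᵐ x ∂volume.restrict Ω, 0 ≤ f x) →
      MemW0 1 Ω f → HasWeakLaplacian Ω f L →
      MemLp (fun x => F h a (f x) * L x) 2 (volume.restrict Ω) →
      MemW0 2 Ω (fun x => H h (f x) ^ p₁ * F h a (f x)) →
      (∀ k : ℕ, 0 ≤ -∫ x in Ω, truncWeight h a p₁ (k + 1) (f x) * L x) ∧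
      (∫⁻ x in Ω, ENNReal.ofReal (H h (f x) ^ (p₁ + 1)) ≠ ⊤ →
      ENNReal.ofReal κ * ((∫⁻ x in Ω, ENNReal.ofReal (H h (f x) ^ (p₁ + 1))) ^ (2 / δ₁) *
        ((∫⁻ x in Ω, ENNReal.ofReal (H h (f x) ^ p₂)) +
          (∫⁻ x in Ω, ENNReal.ofReal (H h (f x) ^ p₃)) + 1) ^ (-((2 - δ₂) / δ₂))) ≤
      liminf (fun k : ℕ =>
        ENNReal.ofReal (-∫ x in Ω, truncWeight h a p₁ (k + 1) (f x) * L x)) atTop) := by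
  obtain ⟨hδ₂1, -⟩ := delta2_bounds hN hδ₁_ge hδ₁_lt hδ₂
  have hθ : 0 ≤ (p₁ + 1) * dualExponent δ₂ := by
    have : 1 / δ₂ ≤ 1 := by rw [div_le_one (by linarith)]; exact hδ₂1
    unfold dualExponent
    exact mul_nonneg (by linarith) (by linarith)
  set θ := (p₁ + 1) * dualExponent δ₂ with hθdef
  obtain ⟨K, hK, hmain⟩ := exists_moment_bound hN hΩ hΩb hp₁ hq₁ hγ₁ hβ hβ₂
    (c := (γ₁ + 1 + θ) / (γ₁ + 1) * c₅) (by positivity) hδ₁ hδ₁_ge hδ₁_lt hδ₂ hp₂ hp₃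
  -- The lower growth condition contributes c₃, and the passage from dissipation to moments costs K.
  refine ⟨c₃ / K, by positivity, fun h a hA hlow hup f L hf0 hW hΔ hFL hG => ?_⟩
  have hm := hΩ.measurableSet
  have : IsFiniteMeasure (volume.restrict Ω) := ⟨by
    rw [Measure.restrict_apply_univ]; exact hΩb.measure_lt_top⟩
  set f' : E N → ℝ := Ω.indicator fun x => max (f x) 0 with hf'
  have hf'0 : ∀ x, 0 ≤ f' x := fun x => indicator_nonneg (fun _ _ => le_max_right _ _) x
  have hf'Ω : ∀ x, x ∉ Ω → f' x = 0 := fun x hx => indicator_of_notMem hx _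
  have hres : ∀ᵐ x ∂volume.restrict Ω, f' x = f x := by
    filter_upwards [hf0, ae_restrict_mem hm] with x hx hxΩ
    rw [hf', indicator_of_mem hxΩ, max_eq_left hx]
  have hae : f' =ᵐ[volume] Ω.indicator f := by
    filter_upwards [(ae_restrict_iff' hm).1 hres] with x hx
    by_cases hxΩ : x ∈ Ω
    · rw [hx hxΩ, indicator_of_mem hxΩ]
    · rw [hf'Ω x hxΩ, indicator_of_notMem hxΩ]
  set G : ℝ → ℝ := fun s => H h s ^ p₁ * F h a s with hGdef
  have hG0 : G 0 = 0 := by simp only [hGdef, hA.F_zero, mul_zero]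
  have haeG : (fun x => G (f' x)) =ᵐ[volume] Ω.indicator fun x => G (f x) := by
    filter_upwards [hae] with x hx
    by_cases hxΩ : x ∈ Ω
    · rw [hx, indicator_of_mem hxΩ, indicator_of_mem hxΩ]
    · rw [hf'Ω x hxΩ, indicator_of_notMem hxΩ, hG0]
  obtain ⟨g, φ, hp, -, -, -⟩ := hW.exists_sobolevPair hΩ hΩb le_rfl hae
  obtain ⟨γ, ψ, hpG, hψ, hγ, hψγ⟩ := hG.exists_sobolevPair hΩ hΩb one_le_two haeG
  have hData : SpatialData Ω G (derivWithin G (Ici 0)) (fun s => c₃ * H h s ^ q₁) f' g L φ γ ψ :=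
    { open' := hΩ
      pair_f := hp
      nonneg := hf'0
      div := hΔ.weakDivergence hΩ hae hp
      pair_G := hpG
      test_G := hψ
      memLp := hγ
      tendsto_G := hψγ
      hasDeriv := fun s hs => (hlow.1 s hs).hasDerivWithinAt
      G_zero := hG0
      le_deriv := fun s hs => hlow.2 s hs
      c_pos := fun s hs => by
        have := hA.Hpos_pos hs
        rw [IsAdmissible.Hpos_of_nonneg hs.le] at this
        positivity
      c_mono := fun s hs t ht hst => by
        have h1 := hA.Hpos_nonneg s
        rw [IsAdmissible.Hpos_of_nonneg hs] at h1
        have h2 := hA.H_strictMonoOn.monotoneOn hs ht hst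
        simp only
        gcongr }
  have hfm : AEMeasurable f (volume.restrict Ω) := hW.1.1.aemeasurable
  have henergy : ∀ k : ℕ, 0 ≤ -∫ x in Ω, truncWeight h a p₁ (k + 1) (f x) * L x ∧
      ∫⁻ x, ENNReal.ofReal (truncDensity h p₁ q₁ c₃ (k + 1) (f' x) * ‖g x‖ ^ 2) ≤
        ENNReal.ofReal (-∫ x in Ω, truncWeight h a p₁ (k + 1) (f x) * L x) := by
    intro k
    have hk : (0 : ℝ) < k + 1 := by positivity
    have e1 : ∀ᵐ x ∂volume.restrict Ω, truncWeight h a p₁ (k + 1) (f' x) * L x =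
        F h a (f x) * L x * (Hpos h (f x) / (1 + Hpos h (f x) / (k + 1))) ^ p₁ := by
      filter_upwards [hres, hf0] with x hx hx0
      rw [hx, truncWeight, max_eq_left hx0]
      ring
    -- This is what the truncation is for: a factor bounded by (k+1)^{p₁} multiplies F(f) L, which
    -- is in L² of a finite measure space.
    have hAL : IntegrableOn (fun x => truncWeight h a p₁ (k + 1) (f' x) * L x) Ω := by
      refine Integrable.congr ?_ (EventuallyEq.symm e1)
      refine (hFL.integrable one_le_two).mul_bdd (c := ((k : ℝ) + 1) ^ p₁)
        ((hA.continuous_trunc_pow hp₁ hk).measurable.comp_aemeasurable hfm).aestronglyMeasurable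
        (Eventually.of_forall fun x => ?_)
      have h1 := hA.Hpos_nonneg (f x)
      rw [Real.norm_of_nonneg (by positivity)]
      exact hA.trunc_pow_le hp₁ hk _
    have h2 := hData.energy_le (hA.continuous_truncWeight hp₁ hk)
      (fun s hs => hA.truncWeight_of_nonpos hs) (fun s hs => hA.truncWeight_pos hk hs)
      (fun s hs => (hA.truncWeight_deriv hk hlow hs).1)
      (fun s hs => hA.truncWeight_le hp₁ hk hs)
      (hA.continuous_truncDensity hq₁ hk) (hA.truncDensity_nonneg hc₃ hk)
      (fun s hs => IsAdmissible.truncDensity_of_nonpos hq₁ hs)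
      (fun s hs => (hA.truncWeight_deriv hk hlow hs).2) hAL
    have e2 : ∫ x in Ω, truncWeight h a p₁ (k + 1) (f' x) * L x =
        ∫ x in Ω, truncWeight h a p₁ (k + 1) (f x) * L x := by
      refine integral_congr_ae ?_
      filter_upwards [hres] with x hx
      rw [hx]
    rwa [e2] at h2
  refine ⟨fun k => (henergy k).1, fun hY => ?_⟩
  have hmoment := hmain f' g φ hp hf'0 hf'Ω (Hpos h) (powDeriv h (sobolevExponent p₁ γ₁ δ₂))
    hA.continuous_Hpos hA.Hpos_nonneg
    (hA.continuous_powDeriv hγ₁ hc₅ hθ (by linarith) (by linarith) hup)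
    (hA.powDeriv_nonneg (by unfold sobolevExponent; positivity))
    (fun s hs => IsAdmissible.powDeriv_of_nonpos hs)
    (fun s hs => hA.integral_powDeriv (by positivity)
      (hA.continuous_powDeriv hγ₁ hc₅ hθ (by linarith) (by linarith) hup) hs)
    (fun s hs => hA.powDeriv_le hγ₁ hc₅ hθ hup s)
  have e3 : ∀ p : ℝ, ∫⁻ x in Ω, ENNReal.ofReal (Hpos h (f' x) ^ p) =
      ∫⁻ x in Ω, ENNReal.ofReal (H h (f x) ^ p) := by
    intro p
    refine lintegral_congr_ae ?_
    filter_upwards [hres, hf0] with x hx hx0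
    rw [hx, IsAdmissible.Hpos_of_nonneg hx0]
  simp only [e3] at hmoment
  -- As k → ∞ the damping factor (1 + H/(k+1))^{-(p₁+1)} tends to 1, so Fatou recovers the
  -- untruncated dissipation.
  have hfatou : ENNReal.ofReal c₃ *
      (∫⁻ x in Ω, ENNReal.ofReal (Hpos h (f' x) ^ q₁ * ‖g x‖ ^ 2)) ≤
      liminf (fun k : ℕ =>
        ENNReal.ofReal (-∫ x in Ω, truncWeight h a p₁ (k + 1) (f x) * L x)) atTop := by
    have hf'm : AEMeasurable f' := hp.int_f.1.aemeasurable
    calc ENNReal.ofReal c₃ * (∫⁻ x in Ω, ENNReal.ofReal (Hpos h (f' x) ^ q₁ * ‖g x‖ ^ 2))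
        ≤ ENNReal.ofReal c₃ * ∫⁻ x, ENNReal.ofReal (Hpos h (f' x) ^ q₁ * ‖g x‖ ^ 2) := by
          gcongr; exact Measure.restrict_le_self
      _ = ∫⁻ x, liminf (fun k : ℕ =>
          ENNReal.ofReal (truncDensity h p₁ q₁ c₃ (k + 1) (f' x) * ‖g x‖ ^ 2)) atTop := by
          rw [← lintegral_const_mul' _ _ ENNReal.ofReal_ne_top]
          refine lintegral_congr fun x => ?_
          have hw := hA.Hpos_nonneg (f' x)
          have t1 : Tendsto (fun k : ℕ => Hpos h (f' x) / ((k : ℝ) + 1)) atTop (𝓝 0) :=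
            (tendsto_const_nhds (x := Hpos h (f' x))).div_atTop
              (tendsto_atTop_add_const_right _ _ tendsto_natCast_atTop_atTop)
          have t2 : Tendsto (fun k : ℕ => truncDensity h p₁ q₁ c₃ (k + 1) (f' x) * ‖g x‖ ^ 2)
              atTop (𝓝 (c₃ * Hpos h (f' x) ^ q₁ * (1 + 0) ^ (-(p₁ + 1)) * ‖g x‖ ^ 2)) :=
            (((t1.const_add 1).rpow_const (Or.inl (by norm_num))).const_mul _).mul_const _
          rw [(ENNReal.tendsto_ofReal t2).liminf_eq, ← ENNReal.ofReal_mul hc₃.le, add_zero,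
            Real.one_rpow, mul_one, mul_assoc]
      _ ≤ liminf (fun k : ℕ => ∫⁻ x,
          ENNReal.ofReal (truncDensity h p₁ q₁ c₃ (k + 1) (f' x) * ‖g x‖ ^ 2)) atTop :=
          lintegral_liminf_le' fun k => (((hA.continuous_truncDensity hq₁
            (by positivity)).measurable.comp_aemeasurable hf'm).mul
            (hp.int_g.1.norm.aemeasurable.pow_const 2)).ennreal_ofReal
      _ ≤ _ := liminf_le_liminf (Eventually.of_forall fun k => (henergy k).2)
  refine le_trans ?_ hfatou
  calc ENNReal.ofReal (c₃ / K) * _ ≤ ENNReal.ofReal (c₃ / K) * (ENNReal.ofReal K *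
        ∫⁻ x in Ω, ENNReal.ofReal (Hpos h (f' x) ^ q₁ * ‖g x‖ ^ 2)) := by
        exact mul_le_mul' le_rfl (hmoment hY)
    _ = _ := by
        rw [← mul_assoc, ← ENNReal.ofReal_mul (by positivity), div_mul_cancel₀ _ hK.ne']

/-! ### Chain rule in time -/

theorem lipschitz_comp_absolutelyContinuous {Φ : ℝ → ℝ} {C : ℝ}
    (hΦ : ∀ y z, dist (Φ y) (Φ z) ≤ C * dist y z) {y : ℝ → ℝ} {s t : ℝ}
    (hy : AbsolutelyContinuousOnInterval y s t) :
    AbsolutelyContinuousOnInterval (fun τ => Φ (y τ)) s t := by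
  have h0 := Tendsto.const_mul C hy
  rw [mul_zero] at h0
  refine squeeze_zero (fun t => Finset.sum_nonneg fun i hi => dist_nonneg) (fun t => ?_) h0
  rw [Finset.mul_sum]
  exact Finset.sum_le_sum fun i _ => hΦ _ _

theorem dist_primitive_le {φ : ℝ → ℝ} (hφ : Continuous φ) {C : ℝ} (hC : ∀ r, ‖φ r‖ ≤ C)
    (y z : ℝ) : dist (∫ r in (0 : ℝ)..y, φ r) (∫ r in (0 : ℝ)..z, φ r) ≤ C * dist y z := by
  rw [dist_eq_norm, intervalIntegral.integral_interval_sub_left (hφ.intervalIntegrable _ _)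
    (hφ.intervalIntegrable _ _), Real.dist_eq]
  exact intervalIntegral.norm_integral_le_of_norm_le_const fun r _ => hC r

/-- The path τ ↦ c + ∫ v is absolutely continuous and the primitive of the bounded function φ is
Lipschitz, so their composition is absolutely continuous and equals the integral of its derivative,
computed at the Lebesgue points of v. -/
theorem integral_chain_rule {φ : ℝ → ℝ} (hφ : Continuous φ) {C : ℝ} (hC : ∀ r, ‖φ r‖ ≤ C)
    {v : ℝ → ℝ} {t₀ s t : ℝ} (hs : t₀ ≤ s) (hst : s ≤ t) (hv : IntegrableOn v (Ioc t₀ t)) (c : ℝ) :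
    (∫ r in (0 : ℝ)..(c + ∫ r in Ioc t₀ t, v r), φ r) -
      (∫ r in (0 : ℝ)..(c + ∫ r in Ioc t₀ s, v r), φ r) =
      ∫ τ in Ioc s t, φ (c + ∫ r in Ioc t₀ τ, v r) * v τ := by
  have hi : IntervalIntegrable v volume t₀ t :=
    (intervalIntegrable_iff_integrableOn_Ioc_of_le (hs.trans hst)).2 hv
  set y : ℝ → ℝ := fun τ => c + ∫ r in t₀..τ, v r with hy
  have hac : AbsolutelyContinuousOnInterval y t₀ t := by
    have h1 : AbsolutelyContinuousOnInterval (fun _ : ℝ => c) t₀ t :=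
      (LipschitzWith.const c).lipschitzOnWith.absolutelyContinuousOnInterval
    exact h1.add (hi.absolutelyContinuousOnInterval_intervalIntegral left_mem_uIcc)
  have hsub : uIcc s t ⊆ uIcc t₀ t := by
    rw [uIcc_of_le hst, uIcc_of_le (hs.trans hst)]; exact Icc_subset_Icc_left hs
  have h2 := (lipschitz_comp_absolutelyContinuous (dist_primitive_le hφ hC)
    (hac.mono hsub)).integral_deriv_eq_sub
  have hyt : ∀ τ, t₀ ≤ τ → y τ = c + ∫ r in Ioc t₀ τ, v r := fun τ hτ => by
    rw [hy]; simp only; rw [intervalIntegral.integral_of_le hτ]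
  rw [← hyt t (hs.trans hst), ← hyt s hs, ← h2, ← intervalIntegral.integral_of_le hst]
  refine intervalIntegral.integral_congr_ae ?_
  filter_upwards [hi.ae_hasDerivAt_integral] with τ hτ hτm
  rw [uIoc_of_le hst] at hτm
  have hτt : τ ∈ uIcc t₀ t := by
    rw [uIcc_of_le (hs.trans hst)]; exact ⟨hs.trans hτm.1.le, hτm.2⟩
  have h3 := (hτ hτt t₀ left_mem_uIcc).const_add c
  have h4 := ((hφ.integral_hasStrictDerivAt 0 (y τ)).hasDerivAt).comp τ h3
  rw [← hyt τ (hs.trans hτm.1.le)]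
  exact h4.deriv

section Parametric

variable {α : Type*} [MeasurableSpace α] {μ : Measure α} [IsFiniteMeasure μ]

/-- The moving interval of integration is encoded as the indicator of a measurable set in one more
variable, which reduces the claim to measurability of parametric integrals. -/
theorem stronglyMeasurable_primitive {v : α → ℝ → ℝ}
    (hv : StronglyMeasurable (fun z : α × ℝ => v z.1 z.2)) (t₀ : ℝ) :
    StronglyMeasurable (fun z : α × ℝ => ∫ s in Ioc t₀ z.2, v z.1 s) := by
  set S : Set ((α × ℝ) × ℝ) := {p | t₀ < p.2 ∧ p.2 ≤ p.1.2} with hS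
  have hSm : MeasurableSet S :=
    (measurableSet_lt measurable_const measurable_snd).inter
      (measurableSet_le measurable_snd (measurable_snd.comp measurable_fst))
  have h1 : StronglyMeasurable (S.indicator fun p : (α × ℝ) × ℝ => v p.1.1 p.2) :=
    (hv.comp_measurable (f := fun z : α × ℝ => v z.1 z.2) (g := fun p : (α × ℝ) × ℝ => (p.1.1, p.2))
      (by fun_prop)).indicator hSm
  have h2 := h1.integral_prod_right' (ν := (volume : Measure ℝ))
  convert h2 using 2 with z
  rw [← integral_indicator measurableSet_Ioc]
  rfl

theorem integral_comp_primitive_sub {φ : ℝ → ℝ} (hφ : Continuous φ) {C : ℝ}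
    (hC : ∀ r, ‖φ r‖ ≤ C) {v : α → ℝ → ℝ}
    (hvm : StronglyMeasurable (fun z : α × ℝ => v z.1 z.2)) {w₀ : α → ℝ}
    (hw₀m : StronglyMeasurable w₀) (hw₀ : Integrable w₀ μ) {t₀ s t : ℝ} (hs : t₀ ≤ s) (hst : s ≤ t)
    (hv : Integrable (fun z : α × ℝ => v z.1 z.2) (μ.prod (volume.restrict (Ioc t₀ t)))) :
    (∫ x, (∫ r in (0 : ℝ)..(w₀ x + ∫ r in Ioc t₀ t, v x r), φ r) ∂μ) -
      (∫ x, (∫ r in (0 : ℝ)..(w₀ x + ∫ r in Ioc t₀ s, v x r), φ r) ∂μ) =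
      ∫ z, φ (w₀ z.1 + ∫ r in Ioc t₀ z.2, v z.1 r) * v z.1 z.2
        ∂(μ.prod (volume.restrict (Ioc s t))) := by
  have hprim : Continuous fun y => ∫ r in (0 : ℝ)..y, φ r :=
    continuous_iff_continuousAt.2 fun y =>
      (hφ.integral_hasStrictDerivAt 0 y).hasDerivAt.continuousAt
  have hint : ∀ τ, t₀ ≤ τ → τ ≤ t →
      Integrable (fun x => ∫ r in (0 : ℝ)..(w₀ x + ∫ r in Ioc t₀ τ, v x r), φ r) μ := by
    intro τ hτ hτt
    have h1 : Integrable (fun x => w₀ x + ∫ r in Ioc t₀ τ, v x r) μ :=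
      hw₀.add (hv.mono_measure (Measure.prod_mono le_rfl
        (Measure.restrict_mono (Ioc_subset_Ioc_right hτt) le_rfl))).integral_prod_left
    refine (h1.norm.const_mul C).mono' (hprim.comp_aestronglyMeasurable h1.1)
      (Eventually.of_forall fun x => ?_)
    have h2 := dist_primitive_le hφ hC (w₀ x + ∫ r in Ioc t₀ τ, v x r) 0
    rwa [intervalIntegral.integral_same, dist_zero_right, dist_zero_right] at h2
  have hv' : Integrable (fun z : α × ℝ => v z.1 z.2) (μ.prod (volume.restrict (Ioc s t))) :=
    hv.mono_measure (Measure.prod_mono le_rfl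
      (Measure.restrict_mono (Ioc_subset_Ioc_left hs) le_rfl))
  have hwm : StronglyMeasurable fun z : α × ℝ => w₀ z.1 + ∫ r in Ioc t₀ z.2, v z.1 r :=
    (hw₀m.comp_measurable measurable_fst).add (stronglyMeasurable_primitive hvm t₀)
  have hφv : Integrable (fun z : α × ℝ => φ (w₀ z.1 + ∫ r in Ioc t₀ z.2, v z.1 r) * v z.1 z.2)
      (μ.prod (volume.restrict (Ioc s t))) :=
    hv'.bdd_mul (c := C) (hφ.comp_stronglyMeasurable hwm).aestronglyMeasurable
      (Eventually.of_forall fun z => hC _)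
  rw [← integral_sub (hint t (hs.trans hst) le_rfl) (hint s hs hst), integral_prod _ hφv]
  refine integral_congr_ae ?_
  filter_upwards [hv.prod_right_ae] with x hx
  exact integral_chain_rule hφ hC hs hst hx (w₀ x)

end Parametric

/-! ### Truncated powers and their primitives -/

/-- The truncated power `(r⁺ / (1 + r⁺ / K))^p`. -/
def truncPow (p K r : ℝ) : ℝ := (max r 0 / (1 + max r 0 / K)) ^ p

/-- The primitive of `(p + 1) truncPow`. -/
def truncPrim (p K y : ℝ) : ℝ := ∫ r in (0 : ℝ)..y, (p + 1) * truncPow p K r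

section TruncPow

variable {p K : ℝ}

theorem continuous_truncPow (hp : 0 < p) (hK : 0 < K) : Continuous (truncPow p K) := by
  refine Continuous.rpow_const (Continuous.div₀ (by fun_prop) (by fun_prop) fun r => ?_)
    fun s => Or.inr hp.le
  have := le_max_right r 0
  positivity

theorem truncPow_nonneg (hK : 0 < K) (r : ℝ) : 0 ≤ truncPow p K r := by
  have := le_max_right r 0
  unfold truncPow
  positivity

theorem truncPow_le (hp : 0 < p) (hK : 0 < K) (r : ℝ) : truncPow p K r ≤ K ^ p := by
  have h1 := le_max_right r 0
  refine Real.rpow_le_rpow (by positivity) ?_ hp.le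
  rw [div_le_iff₀ (by positivity)]
  have : K * (max r 0 / K) = max r 0 := by field_simp
  nlinarith

theorem truncPow_le_rpow (hp : 0 < p) (hK : 0 < K) {r : ℝ} (hr : 0 ≤ r) :
    truncPow p K r ≤ r ^ p := by
  rw [truncPow, max_eq_left hr]
  refine Real.rpow_le_rpow (by positivity) (div_le_self hr ?_) hp.le
  have : 0 ≤ r / K := by positivity
  linarith

/-- Freezing the denominator at its largest value on [0, y] gives a lower bound with an explicit
primitive; it supplies the lower half of the squeeze in `tendsto_truncPrim`. -/
theorem le_truncPow (hp : 0 < p) (hK : 0 < K) {r y : ℝ} (hr : 0 ≤ r) (hy : r ≤ y) :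
    (1 + y / K) ^ (-p) * r ^ p ≤ truncPow p K r := by
  have hy0 : 0 ≤ y := hr.trans hy
  rw [truncPow, max_eq_left hr, Real.div_rpow hr (by positivity), Real.rpow_neg (by positivity),
    div_eq_mul_inv (r ^ p), mul_comm]
  gcongr

theorem integral_rpow_primitive (hp : 0 < p) (y c : ℝ) :
    ∫ r in (0 : ℝ)..y, (p + 1) * (c * r ^ p) = c * y ^ (p + 1) := by
  rw [intervalIntegral.integral_const_mul, intervalIntegral.integral_const_mul,
    integral_rpow (Or.inl (by linarith)), Real.zero_rpow (by linarith), sub_zero]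
  field_simp

theorem truncPrim_nonneg (hp : 0 < p) (hK : 0 < K) {y : ℝ} (hy : 0 ≤ y) : 0 ≤ truncPrim p K y :=
  intervalIntegral.integral_nonneg hy fun r _ => mul_nonneg (by linarith) (truncPow_nonneg hK r)

theorem truncPrim_le (hp : 0 < p) (hK : 0 < K) {y : ℝ} (hy : 0 ≤ y) :
    truncPrim p K y ≤ y ^ (p + 1) := by
  have h1 := integral_rpow_primitive hp y 1
  rw [one_mul] at h1
  rw [← h1]
  refine intervalIntegral.integral_mono_on hy
    ((continuous_const.mul (continuous_truncPow hp hK)).intervalIntegrable _ _)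
    (Continuous.intervalIntegrable (by
      have := Real.continuous_rpow_const hp.le; fun_prop) _ _) fun r hr => ?_
  rw [one_mul]
  exact mul_le_mul_of_nonneg_left (truncPow_le_rpow hp hK hr.1) (by linarith)

theorem le_truncPrim (hp : 0 < p) (hK : 0 < K) {y : ℝ} (hy : 0 ≤ y) :
    (1 + y / K) ^ (-p) * y ^ (p + 1) ≤ truncPrim p K y := by
  rw [← integral_rpow_primitive hp y]
  refine intervalIntegral.integral_mono_on hy
    (Continuous.intervalIntegrable (by
      have := Real.continuous_rpow_const hp.le; fun_prop) _ _)
    ((continuous_const.mul (continuous_truncPow hp hK)).intervalIntegrable _ _) fun r hr => ?_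
  exact mul_le_mul_of_nonneg_left (le_truncPow hp hK hr.1 hr.2) (by linarith)

theorem tendsto_truncPrim (hp : 0 < p) {y : ℝ} (hy : 0 ≤ y) :
    Tendsto (fun k : ℕ => truncPrim p (k + 1) y) atTop (𝓝 (y ^ (p + 1))) := by
  have t1 : Tendsto (fun k : ℕ => y / ((k : ℝ) + 1)) atTop (𝓝 0) :=
    (tendsto_const_nhds (x := y)).div_atTop
      (tendsto_atTop_add_const_right _ _ tendsto_natCast_atTop_atTop)
  have t2 : Tendsto (fun k : ℕ => (1 + y / ((k : ℝ) + 1)) ^ (-p) * y ^ (p + 1)) atTop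
      (𝓝 ((1 + 0) ^ (-p) * y ^ (p + 1))) :=
    ((t1.const_add 1).rpow_const (Or.inl (by norm_num))).mul_const _
  rw [add_zero, Real.one_rpow, one_mul] at t2
  exact tendsto_of_tendsto_of_tendsto_of_le_of_le t2 tendsto_const_nhds
    (fun k => le_truncPrim hp (by positivity) hy) fun k => truncPrim_le hp (by positivity) hy

end TruncPow


/-! ### Energy inequality for the evolution -/

theorem add_liminf_le {a b : ℕ → ℝ≥0∞} {A c : ℝ≥0∞} (ha : Tendsto a atTop (𝓝 A))
    (h : ∀ k, a k + b k ≤ c) : A + liminf b atTop ≤ c := by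
  rw [liminf_eq_iSup_iInf_of_nat, ENNReal.add_iSup]
  refine iSup_le fun n => le_of_tendsto (ha.add tendsto_const_nhds) ?_
  filter_upwards [eventually_ge_atTop n] with k hk
  exact (add_le_add le_rfl (iInf₂_le k hk)).trans (h k)

theorem norm_truncPow_le {p K : ℝ} (hp : 0 < p) (hK : 0 < K) (r : ℝ) :
    ‖(p + 1) * truncPow p K r‖ ≤ (p + 1) * K ^ p := by
  have h1 := truncPow_nonneg (p := p) hK r
  rw [Real.norm_of_nonneg (by positivity)]
  exact mul_le_mul_of_nonneg_left (truncPow_le hp hK r) (by linarith)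

/-- The conditions in `IsStrongSolution` that concern the evolution, with explicit time derivative
`v = [H(u)]_t` and Laplacian `L = Δu`. -/
structure EvolutionData (h a : ℝ → ℝ) (Ω : Set (E N)) (t₀ : ℝ) (u₀ : E N → ℝ)
    (u v L : E N → ℝ → ℝ) : Prop where
  meas : AEStronglyMeasurable (fun z : E N × ℝ => u z.1 z.2) (cylinder Ω t₀)
  nonneg : ∀ t, t₀ ≤ t → ∀ᵐ x ∂volume.restrict Ω, 0 ≤ u x t
  initial : ∀ᵐ x ∂volume.restrict Ω, u x t₀ = u₀ x
  memLp_v : MemLp (fun z : E N × ℝ => v z.1 z.2) 2 (cylinder Ω t₀)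
  primitive : ∀ t, t₀ ≤ t → ∀ᵐ x ∂volume.restrict Ω,
    H h (u x t) = H h (u x t₀) + ∫ s in t₀..t, v x s
  memLp_L : MemLp (fun z : E N × ℝ => F h a (u z.1 z.2) * L z.1 z.2) 2 (cylinder Ω t₀)
  le : ∀ᵐ z ∂cylinder Ω t₀, v z.1 z.2 - F h a (u z.1 z.2) * L z.1 z.2 ≤ 0

namespace EvolutionData

variable {h a : ℝ → ℝ} {Ω : Set (E N)} {t₀ : ℝ} {u₀ : E N → ℝ} {u v L : E N → ℝ → ℝ}

theorem slab_le {s t : ℝ} (hs : t₀ ≤ s) :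
    (volume.restrict Ω).prod (volume.restrict (Ioc s t)) ≤ cylinder Ω t₀ :=
  Measure.prod_mono le_rfl (Measure.restrict_mono (fun _ hx => hs.trans_lt hx.1) le_rfl)

/-- A jointly measurable representative of `H(u)`. -/
theorem exists_representative (D : EvolutionData h a Ω t₀ u₀ u v L) (hA : IsAdmissible h a)
    [IsFiniteMeasure (volume.restrict Ω)]
    (hH₀ : Integrable (fun x => H h (u₀ x)) (volume.restrict Ω)) :
    ∃ (w₀ : E N → ℝ) (v' : E N → ℝ → ℝ), StronglyMeasurable w₀ ∧
      StronglyMeasurable (fun z : E N × ℝ => v' z.1 z.2) ∧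
      Integrable w₀ (volume.restrict Ω) ∧
      (∀ t, Integrable (fun z : E N × ℝ => v' z.1 z.2)
        ((volume.restrict Ω).prod (volume.restrict (Ioc t₀ t)))) ∧
      (∀ᵐ z ∂cylinder Ω t₀, v z.1 z.2 = v' z.1 z.2) ∧
      (∀ t, t₀ ≤ t → ∀ᵐ x ∂volume.restrict Ω,
        H h (u x t) = w₀ x + ∫ r in Ioc t₀ t, v' x r) ∧
      (∀ᵐ z ∂cylinder Ω t₀, 0 ≤ u z.1 z.2 ∧
        H h (u z.1 z.2) = w₀ z.1 + ∫ r in Ioc t₀ z.2, v' z.1 r) := by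
  set w₀ := hH₀.1.mk _ with hw₀
  set V := D.memLp_v.1.mk _ with hV
  have hw₀m : StronglyMeasurable w₀ := hH₀.1.stronglyMeasurable_mk
  have hVm : StronglyMeasurable V := D.memLp_v.1.stronglyMeasurable_mk
  have hVe : ∀ᵐ z ∂cylinder Ω t₀, v z.1 z.2 = V z := D.memLp_v.1.ae_eq_mk
  have hsec : ∀ t, t₀ ≤ t → ∀ᵐ x ∂volume.restrict Ω,
      H h (u x t) = w₀ x + ∫ r in Ioc t₀ t, V (x, r) := by
    intro t ht
    filter_upwards [D.primitive t ht, D.initial, hH₀.1.ae_eq_mk,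
      Measure.ae_ae_of_ae_prod hVe] with x h1 h2 h3 h4
    rw [h1, h2, h3, intervalIntegral.integral_of_le ht]
    congr 1
    exact integral_congr_ae (ae_restrict_of_ae_restrict_of_subset (fun _ hr => hr.1) h4)
  refine ⟨w₀, fun x r => V (x, r), hw₀m, hVm, hH₀.congr hH₀.1.ae_eq_mk, fun t => ?_, hVe, hsec, ?_⟩
  · exact ((D.memLp_v.ae_eq hVe).mono_measure (slab_le le_rfl)).integrable one_le_two
  · set U := D.meas.mk _ with hU
    have hUm : StronglyMeasurable U := D.meas.stronglyMeasurable_mk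
    have hUe : ∀ᵐ z ∂cylinder Ω t₀, u z.1 z.2 = U z := D.meas.ae_eq_mk
    have hwm : StronglyMeasurable fun z : E N × ℝ => w₀ z.1 + ∫ r in Ioc t₀ z.2, V (z.1, r) :=
      (hw₀m.comp_measurable measurable_fst).add
        (stronglyMeasurable_primitive (v := fun x r => V (x, r)) hVm t₀)
    -- The identities are known for each t at almost every x. Exchanging the quantifiers by Fubini
    -- requires a jointly measurable set, whence the representatives `U`, `V` and the globally
    -- continuous `Hpos` in place of `H`.
    have hS : MeasurableSet {z : E N × ℝ | 0 ≤ U z ∧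
        Hpos h (U z) = w₀ z.1 + ∫ r in Ioc t₀ z.2, V (z.1, r)} :=
      (measurableSet_le measurable_const hUm.measurable).inter
        (measurableSet_eq_fun (hA.continuous_Hpos.measurable.comp hUm.measurable) hwm.measurable)
    have hswap : ∀ᵐ t ∂volume.restrict (Ioi t₀), ∀ᵐ x ∂volume.restrict Ω, u x t = U (x, t) := by
      have h1 := (Measure.measurePreserving_swap (μ := volume.restrict (Ioi t₀))
        (ν := volume.restrict Ω)).quasiMeasurePreserving.ae hUe
      exact Measure.ae_ae_of_ae_prod h1
    have hae : ∀ᵐ t ∂volume.restrict (Ioi t₀), ∀ᵐ x ∂volume.restrict Ω,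
        0 ≤ U (x, t) ∧ Hpos h (U (x, t)) = w₀ x + ∫ r in Ioc t₀ t, V (x, r) := by
      filter_upwards [hswap, ae_restrict_mem measurableSet_Ioi] with t h1 ht
      filter_upwards [h1, D.nonneg t (le_of_lt ht), hsec t (le_of_lt ht)] with x h2 h3 h4
      rw [← h2, IsAdmissible.Hpos_of_nonneg h3]
      exact ⟨h3, h4⟩
    have hae' : ∀ᵐ z ∂cylinder Ω t₀, 0 ≤ U z ∧
        Hpos h (U z) = w₀ z.1 + ∫ r in Ioc t₀ z.2, V (z.1, r) :=
      (Measure.ae_prod_iff_ae_ae hS).2 ((Measure.ae_ae_comm (p := fun x t => 0 ≤ U (x, t) ∧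
        Hpos h (U (x, t)) = w₀ x + ∫ r in Ioc t₀ t, V (x, r)) hS).2 hae)
    filter_upwards [hae', hUe] with z h1 h2
    rw [h2]
    refine ⟨h1.1, ?_⟩
    rw [← h1.2, IsAdmissible.Hpos_of_nonneg h1.1]

theorem integrable_truncWeight_mul (D : EvolutionData h a Ω t₀ u₀ u v L) (hA : IsAdmissible h a)
    [IsFiniteMeasure (volume.restrict Ω)] (hn : ∀ᵐ z ∂cylinder Ω t₀, 0 ≤ u z.1 z.2)
    {p₁ K : ℝ} (hp₁ : 0 < p₁) (hK : 0 < K) {s t : ℝ} (hs : t₀ ≤ s) :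
    Integrable (fun z : E N × ℝ => truncWeight h a p₁ K (u z.1 z.2) * L z.1 z.2)
      ((volume.restrict Ω).prod (volume.restrict (Ioc s t))) := by
  have h1 := (D.memLp_L.mono_measure (slab_le (t := t) hs)).integrable one_le_two
  have hum := (D.meas.mono_measure (slab_le (t := t) hs)).aemeasurable
  refine (h1.mul_bdd (c := K ^ p₁) ((hA.continuous_trunc_pow hp₁
    hK).measurable.comp_aemeasurable hum).aestronglyMeasurable
    (Eventually.of_forall fun z => ?_)).congr ?_
  · have := hA.Hpos_nonneg (u z.1 z.2)
    rw [Function.comp_apply, Real.norm_of_nonneg (by positivity)]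
    exact hA.trunc_pow_le hp₁ hK _
  · filter_upwards [ae_mono (slab_le hs) hn] with z hz
    rw [Function.comp_apply, truncWeight, max_eq_left hz]
    ring

theorem integrable_truncPrim {p₁ K : ℝ} (hp₁ : 0 < p₁) (hK : 0 < K) {w : E N → ℝ}
    (hw : Integrable w (volume.restrict Ω)) :
    Integrable (fun x => truncPrim p₁ K (w x)) (volume.restrict Ω) := by
  have hc : Continuous fun r => (p₁ + 1) * truncPow p₁ K r :=
    continuous_const.mul (continuous_truncPow hp₁ hK)
  have hprim : Continuous (truncPrim p₁ K) := continuous_iff_continuousAt.2 fun y =>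
    (hc.integral_hasStrictDerivAt 0 y).hasDerivAt.continuousAt
  refine (hw.norm.const_mul ((p₁ + 1) * K ^ p₁)).mono' (hprim.comp_aestronglyMeasurable hw.1)
    (Eventually.of_forall fun x => ?_)
  have h2 := dist_primitive_le hc (norm_truncPow_le hp₁ hK) (w x) 0
  rwa [intervalIntegral.integral_same, dist_zero_right, dist_zero_right] at h2

/-- The truncated energy inequality. -/
theorem truncated_energy_le (D : EvolutionData h a Ω t₀ u₀ u v L) (hA : IsAdmissible h a)
    [IsFiniteMeasure (volume.restrict Ω)]
    (hH₀ : Integrable (fun x => H h (u₀ x)) (volume.restrict Ω))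
    {p₁ K : ℝ} (hp₁ : 0 < p₁) (hK : 0 < K) {s t : ℝ} (hs : t₀ ≤ s) (hst : s ≤ t) :
    (∫ x in Ω, truncPrim p₁ K (H h (u x t))) +
      ∫ τ in Ioc s t, (p₁ + 1) * -∫ x in Ω, truncWeight h a p₁ K (u x τ) * L x τ ≤
      ∫ x in Ω, truncPrim p₁ K (H h (u x s)) := by
  obtain ⟨w₀, v', hw₀m, hvm, hw₀, hv, hve, hsec, hjoint⟩ := D.exists_representative hA hH₀
  have hc : Continuous fun r => (p₁ + 1) * truncPow p₁ K r :=
    continuous_const.mul (continuous_truncPow hp₁ hK)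
  have hb := norm_truncPow_le (p := p₁) hp₁ hK
  have key := integral_comp_primitive_sub (μ := volume.restrict Ω) hc hb hvm hw₀m hw₀ hs hst (hv t)
  have e : ∀ τ, t₀ ≤ τ → ∫ x in Ω, truncPrim p₁ K (H h (u x τ)) =
      ∫ x in Ω, ∫ r in (0 : ℝ)..(w₀ x + ∫ r in Ioc t₀ τ, v' x r), (p₁ + 1) * truncPow p₁ K r := by
    intro τ hτ
    refine integral_congr_ae ?_
    filter_upwards [hsec τ hτ] with x hx
    rw [hx, truncPrim]
  rw [← e t (hs.trans hst), ← e s hs] at key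
  have hI := D.integrable_truncWeight_mul hA (hjoint.mono fun z hz => hz.1) hp₁ hK (t := t) hs
  -- The inequality v ≤ F(u) L is multiplied by the nonnegative factor (p₁+1) truncPow(H(u)); the
  -- truncated power of H(u) times F(u) is precisely `truncWeight`.
  have hle : ∫ z, (p₁ + 1) * truncPow p₁ K (w₀ z.1 + ∫ r in Ioc t₀ z.2, v' z.1 r) * v' z.1 z.2
        ∂((volume.restrict Ω).prod (volume.restrict (Ioc s t))) ≤
      ∫ z, (p₁ + 1) * (truncWeight h a p₁ K (u z.1 z.2) * L z.1 z.2)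
        ∂((volume.restrict Ω).prod (volume.restrict (Ioc s t))) := by
    refine integral_mono_ae ?_ (hI.const_mul _) ?_
    · refine ((hv t).mono_measure (Measure.prod_mono le_rfl
        (Measure.restrict_mono (Ioc_subset_Ioc_left hs) le_rfl))).bdd_mul
        (c := (p₁ + 1) * K ^ p₁) (hc.comp_stronglyMeasurable
        ((hw₀m.comp_measurable measurable_fst).add
          (stronglyMeasurable_primitive hvm t₀))).aestronglyMeasurable
        (Eventually.of_forall fun z => hb _)
    · filter_upwards [ae_mono (slab_le hs) hjoint, ae_mono (slab_le hs) hve,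
        ae_mono (slab_le hs) D.le] with z h1 h2 h3
      have hp := hA.Hpos_nonneg (u z.1 z.2)
      have h4 := truncPow_nonneg (p := p₁) hK (Hpos h (u z.1 z.2))
      have h5 : truncWeight h a p₁ K (u z.1 z.2) =
          truncPow p₁ K (Hpos h (u z.1 z.2)) * F h a (u z.1 z.2) := by
        rw [truncWeight, max_eq_left h1.1, truncPow, max_eq_left hp]
      rw [← h1.2, ← h2, ← IsAdmissible.Hpos_of_nonneg h1.1, h5, mul_assoc, mul_assoc]
      gcongr
      linarith
  rw [integral_prod_symm _ (hI.const_mul _)] at hle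
  have e2 : ∫ τ in Ioc s t, (p₁ + 1) * -∫ x in Ω, truncWeight h a p₁ K (u x τ) * L x τ =
      -∫ τ in Ioc s t, ∫ x in Ω, (p₁ + 1) * (truncWeight h a p₁ K (u x τ) * L x τ) := by
    rw [← integral_neg]
    refine integral_congr_ae (Eventually.of_forall fun τ => ?_)
    simp only
    rw [integral_const_mul, mul_neg]
  rw [e2]
  linarith

theorem H_nonneg (D : EvolutionData h a Ω t₀ u₀ u v L) (hA : IsAdmissible h a) {t : ℝ}
    (ht : t₀ ≤ t) : ∀ᵐ x ∂volume.restrict Ω, 0 ≤ H h (u x t) := by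
  filter_upwards [D.nonneg t ht] with x hx
  rw [← IsAdmissible.Hpos_of_nonneg hx]
  exact hA.Hpos_nonneg _

theorem integrable_H (D : EvolutionData h a Ω t₀ u₀ u v L) (hA : IsAdmissible h a)
    [IsFiniteMeasure (volume.restrict Ω)]
    (hH₀ : Integrable (fun x => H h (u₀ x)) (volume.restrict Ω)) {t : ℝ} (ht : t₀ ≤ t) :
    Integrable (fun x => H h (u x t)) (volume.restrict Ω) := by
  obtain ⟨w₀, v', -, -, hw₀, hv, -, hsec, -⟩ := D.exists_representative hA hH₀
  exact (hw₀.add (hv t).integral_prod_left).congr ((hsec t ht).mono fun x hx => hx.symm)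

theorem aemeasurable_dissipation (D : EvolutionData h a Ω t₀ u₀ u v L) (hA : IsAdmissible h a)
    [IsFiniteMeasure (volume.restrict Ω)]
    (hH₀ : Integrable (fun x => H h (u₀ x)) (volume.restrict Ω)) {p₁ : ℝ} (hp₁ : 0 < p₁) (t : ℝ) :
    AEMeasurable (fun τ => liminf (fun k : ℕ =>
        ENNReal.ofReal (-∫ x in Ω, truncWeight h a p₁ (k + 1) (u x τ) * L x τ)) atTop)
      (volume.restrict (Ioc t₀ t)) := by
  obtain ⟨w₀, v', -, -, -, -, -, -, hjoint⟩ := D.exists_representative hA hH₀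
  simp only [liminf_eq_iSup_iInf_of_nat]
  refine AEMeasurable.iSup fun n => AEMeasurable.iInf fun k => AEMeasurable.iInf fun _ => ?_
  exact (D.integrable_truncWeight_mul hA (hjoint.mono fun z hz => hz.1) hp₁ (by positivity)
    le_rfl).integral_prod_right.neg.1.aemeasurable.ennreal_ofReal

theorem ae_memLp_section (D : EvolutionData h a Ω t₀ u₀ u v L) :
    ∀ᵐ t ∂volume.restrict (Ioi t₀),
      MemLp (fun x => F h a (u x t) * L x t) 2 (volume.restrict Ω) := by
  have h1 : ∀ᵐ t ∂volume.restrict (Ioi t₀),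
      AEStronglyMeasurable (fun x => F h a (u x t) * L x t) (volume.restrict Ω) :=
    D.memLp_L.1.prod_swap.prodMk_left
  filter_upwards [h1, D.memLp_L.integrable_sq.prod_left_ae] with t h2 h3
  exact (memLp_two_iff_integrable_sq h2).2 h3

/-- The energy inequality. -/
theorem energy_le (D : EvolutionData h a Ω t₀ u₀ u v L) (hA : IsAdmissible h a)
    [IsFiniteMeasure (volume.restrict Ω)]
    (hH₀ : Integrable (fun x => H h (u₀ x)) (volume.restrict Ω)) {p₁ : ℝ} (hp₁ : 0 < p₁)
    (hE : ∀ᵐ τ ∂volume.restrict (Ioi t₀), ∀ k : ℕ,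
      0 ≤ -∫ x in Ω, truncWeight h a p₁ (k + 1) (u x τ) * L x τ)
    {s t : ℝ} (hs : t₀ ≤ s) (hst : s ≤ t) :
    (∫⁻ x in Ω, ENNReal.ofReal (H h (u x t) ^ (p₁ + 1))) +
      ∫⁻ τ in Ioc s t, liminf (fun k : ℕ =>
        ENNReal.ofReal (-∫ x in Ω, truncWeight h a p₁ (k + 1) (u x τ) * L x τ)) atTop ≤
      ∫⁻ x in Ω, ENNReal.ofReal (H h (u x s) ^ (p₁ + 1)) := by
  obtain ⟨w₀, v', hw₀m, hvm, hw₀, hv, hve, hsec, hjoint⟩ := D.exists_representative hA hH₀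
  have hn : ∀ᵐ z ∂cylinder Ω t₀, 0 ≤ u z.1 z.2 := hjoint.mono fun z hz => hz.1
  have hHn := fun τ hτ => D.H_nonneg hA (t := τ) hτ
  have hHi := fun τ hτ => D.integrable_H hA hH₀ (t := τ) hτ
  have hPi : ∀ (k : ℕ) τ, t₀ ≤ τ →
      Integrable (fun x => truncPrim p₁ (k + 1) (H h (u x τ))) (volume.restrict Ω) :=
    fun k τ hτ => integrable_truncPrim hp₁ (by positivity) (hHi τ hτ)
  have hPn : ∀ (k : ℕ) τ, t₀ ≤ τ →
      ∀ᵐ x ∂volume.restrict Ω, 0 ≤ truncPrim p₁ (k + 1) (H h (u x τ)) := fun k τ hτ =>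
    (hHn τ hτ).mono fun x hx => truncPrim_nonneg hp₁ (by positivity) hx
  have hPe : ∀ (k : ℕ) τ, t₀ ≤ τ →
      ENNReal.ofReal (∫ x in Ω, truncPrim p₁ (k + 1) (H h (u x τ))) =
        ∫⁻ x in Ω, ENNReal.ofReal (truncPrim p₁ (k + 1) (H h (u x τ))) := fun k τ hτ =>
    ofReal_integral_eq_lintegral_ofReal (hPi k τ hτ) (hPn k τ hτ)
  have hPle : ∀ (k : ℕ) τ, t₀ ≤ τ →
      ENNReal.ofReal (∫ x in Ω, truncPrim p₁ (k + 1) (H h (u x τ))) ≤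
        ∫⁻ x in Ω, ENNReal.ofReal (H h (u x τ) ^ (p₁ + 1)) := by
    intro k τ hτ
    rw [hPe k τ hτ]
    refine lintegral_mono_ae ((hHn τ hτ).mono fun x hx => ENNReal.ofReal_le_ofReal ?_)
    exact truncPrim_le hp₁ (by positivity) hx
  have ht := hs.trans hst
  -- Fatou gives the lower bound and truncPrim(y) ≤ y^{p₁+1} the upper one. The limit is taken in
  -- [0, ∞], since finiteness at time t is not yet known.
  have hlim : Tendsto (fun k : ℕ =>
      ENNReal.ofReal (∫ x in Ω, truncPrim p₁ (k + 1) (H h (u x t)))) atTop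
      (𝓝 (∫⁻ x in Ω, ENNReal.ofReal (H h (u x t) ^ (p₁ + 1)))) := by
    refine tendsto_of_le_liminf_of_limsup_le ?_ ?_
    · calc ∫⁻ x in Ω, ENNReal.ofReal (H h (u x t) ^ (p₁ + 1))
          = ∫⁻ x in Ω, liminf (fun k : ℕ =>
            ENNReal.ofReal (truncPrim p₁ (k + 1) (H h (u x t)))) atTop := by
            refine lintegral_congr_ae ((hHn t ht).mono fun x hx => ?_)
            exact (ENNReal.tendsto_ofReal (tendsto_truncPrim hp₁ hx)).liminf_eq.symm
        _ ≤ liminf (fun k : ℕ => ∫⁻ x in Ω,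
            ENNReal.ofReal (truncPrim p₁ (k + 1) (H h (u x t)))) atTop :=
            lintegral_liminf_le' fun k => (hPi k t ht).1.aemeasurable.ennreal_ofReal
        _ = _ := by simp only [hPe _ t ht]
    · refine (limsup_le_limsup (Eventually.of_forall fun k => hPle k t ht)).trans ?_
      rw [limsup_const]
  have hEi : ∀ k : ℕ, Integrable (fun τ => -∫ x in Ω, truncWeight h a p₁ (k + 1) (u x τ) * L x τ)
      (volume.restrict (Ioc s t)) := fun k =>
    (D.integrable_truncWeight_mul hA hn hp₁ (by positivity) hs).integral_prod_right.neg
  have hE' : ∀ k : ℕ, ∀ᵐ τ ∂volume.restrict (Ioc s t),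
      0 ≤ -∫ x in Ω, truncWeight h a p₁ (k + 1) (u x τ) * L x τ := fun k =>
    (ae_restrict_of_ae_restrict_of_subset (fun _ hr => hs.trans_lt hr.1) hE).mono fun τ hτ => hτ k
  have hfatou : ∫⁻ τ in Ioc s t, liminf (fun k : ℕ =>
        ENNReal.ofReal (-∫ x in Ω, truncWeight h a p₁ (k + 1) (u x τ) * L x τ)) atTop ≤
      liminf (fun k : ℕ => ENNReal.ofReal
        (∫ τ in Ioc s t, -∫ x in Ω, truncWeight h a p₁ (k + 1) (u x τ) * L x τ)) atTop := by
    refine (lintegral_liminf_le' fun k => (hEi k).1.aemeasurable.ennreal_ofReal).trans_eq ?_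
    congr 1
    funext k
    exact (ofReal_integral_eq_lintegral_ofReal (hEi k) (hE' k)).symm
  refine (add_le_add le_rfl hfatou).trans (add_liminf_le hlim fun k => ?_)
  refine le_trans ?_ (hPle k s hs)
  rw [← ENNReal.ofReal_add (integral_nonneg_of_ae (hPn k t ht)) (integral_nonneg_of_ae (hE' k))]
  refine ENNReal.ofReal_le_ofReal (le_trans ?_ (D.truncated_energy_le hA hH₀ hp₁
    (K := k + 1) (by positivity) hs hst))
  refine add_le_add le_rfl ?_
  -- The factor p₁ + 1 ≥ 1 in front of the nonnegative dissipation is simply dropped.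
  refine integral_mono_ae (hEi k) ((hEi k).const_mul _) ((hE' k).mono fun τ hτ => ?_)
  exact le_mul_of_one_le_left hτ (by linarith)

end EvolutionData


/-! ### Differentiation in time and conclusion -/

/-- Differentiation of an integral energy inequality. -/
theorem ae_deriv_add_le {y : ℝ → ℝ} {e : ℝ → ℝ≥0∞} {t₀ : ℝ}
    (he : ∀ T, AEMeasurable e (volume.restrict (Ioc t₀ T))) (hy : ∀ t, t₀ ≤ t → 0 ≤ y t)
    (h : ∀ s t, t₀ ≤ s → s ≤ t →
      ENNReal.ofReal (y t) + ∫⁻ τ in Ioc s t, e τ ≤ ENNReal.ofReal (y s)) :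
    AntitoneOn y (Ici t₀) ∧ ∀ᵐ t ∂volume.restrict (Ioi t₀),
      DifferentiableAt ℝ y t ∧ e t ≠ ⊤ ∧ deriv y t + (e t).toReal ≤ 0 := by
  have hanti : AntitoneOn y (Ici t₀) := fun s hs t _ hst =>
    (ENNReal.ofReal_le_ofReal_iff (hy s hs)).1 (le_self_add.trans (h s t hs hst))
  refine ⟨hanti, ?_⟩
  -- Freezing y to the left of t₀ yields a function monotone on all of ℝ, to which Lebesgue's
  -- differentiation theorem applies.
  have hmono : Monotone fun t => -y (max t t₀) := fun s t hst =>
    neg_le_neg (hanti (mem_Ici.2 (le_max_right _ _)) (mem_Ici.2 (le_max_right _ _))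
      (max_le_max_right t₀ hst))
  have hdiff : ∀ᵐ t, t ∈ Ioi t₀ → DifferentiableAt ℝ y t := by
    filter_upwards [hmono.ae_differentiableAt] with t ht htm
    have h1 : DifferentiableAt ℝ (fun t => - -y (max t t₀)) t := ht.neg
    refine h1.congr_of_eventuallyEq ?_
    filter_upwards [Ioi_mem_nhds htm] with r hr
    rw [neg_neg, max_eq_left (le_of_lt hr)]
  have hloc : ∀ n : ℕ, ∀ᵐ t, t ∈ Ioo t₀ (t₀ + n) →
      e t ≠ ⊤ ∧ (DifferentiableAt ℝ y t → deriv y t + (e t).toReal ≤ 0) := by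
    intro n
    set T := t₀ + (n : ℝ) with hT
    have hT0 : t₀ ≤ T := by simp [hT]
    have hfin : ∀ s t, t₀ ≤ s → s ≤ t → ∫⁻ τ in Ioc s t, e τ ≠ ⊤ := fun s t hs hst =>
      ((le_add_self.trans (h s t hs hst)).trans_lt ENNReal.ofReal_lt_top).ne
    have htop : ∀ᵐ t ∂volume.restrict (Ioc t₀ T), e t < ⊤ :=
      ae_lt_top' (he T) (hfin t₀ T le_rfl hT0)
    have hi : IntegrableOn (fun τ => (e τ).toReal) (Ioc t₀ T) :=
      integrable_toReal_of_lintegral_ne_top (he T) (hfin t₀ T le_rfl hT0)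
    have hi' : IntervalIntegrable (fun τ => (e τ).toReal) volume t₀ T :=
      (intervalIntegrable_iff_integrableOn_Ioc_of_le hT0).2 hi
    -- The energy inequality says exactly that y plus the accumulated dissipation is nonincreasing;
    -- its derivative is therefore nonpositive wherever both summands are differentiable.
    have hg : AntitoneOn (fun t => y t + ∫ τ in t₀..t, (e τ).toReal) (Icc t₀ T) := by
      intro s hs t ht hst
      have hsub : Ioc s t ⊆ Ioc t₀ T := Ioc_subset_Ioc hs.1 ht.2
      have h1 : ∫ τ in s..t, (e τ).toReal = (∫⁻ τ in Ioc s t, e τ).toReal := by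
        rw [intervalIntegral.integral_of_le hst, integral_toReal ((he T).mono_set hsub)
          (ae_restrict_of_ae_restrict_of_subset hsub htop)]
      have h2 : ∫ τ in t₀..t, (e τ).toReal =
          (∫ τ in t₀..s, (e τ).toReal) + ∫ τ in s..t, (e τ).toReal :=
        (intervalIntegral.integral_add_adjacent_intervals
          (hi'.mono_set (by
            rw [uIcc_of_le hs.1, uIcc_of_le hT0]; exact Icc_subset_Icc_right hs.2))
          (hi'.mono_set (by
            rw [uIcc_of_le hst, uIcc_of_le hT0]; exact Icc_subset_Icc hs.1 ht.2))).symm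
      have h3 := ENNReal.toReal_mono ENNReal.ofReal_ne_top (h s t hs.1 hst)
      rw [ENNReal.toReal_add ENNReal.ofReal_ne_top (hfin s t hs.1 hst),
        ENNReal.toReal_ofReal (hy t ht.1), ENNReal.toReal_ofReal (hy s hs.1), ← h1] at h3
      simp only
      linarith
    filter_upwards [(ae_restrict_iff' measurableSet_Ioc).1 htop,
      hi'.ae_hasDerivAt_integral] with t h1 h2 ht
    refine ⟨(h1 (Ioo_subset_Ioc_self ht)).ne, fun hd => ?_⟩
    have h3 := h2 (by rw [uIcc_of_le hT0]; exact Ioo_subset_Icc_self ht) t₀ left_mem_uIcc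
    have h4 := hg.derivWithin_nonpos (x := t)
    rw [derivWithin_of_mem_nhds (Icc_mem_nhds ht.1 ht.2)] at h4
    have h5 : HasDerivAt (fun t => y t + ∫ τ in t₀..t, (e τ).toReal) _ t := hd.hasDerivAt.add h3
    rwa [h5.deriv] at h4
  rw [ae_restrict_iff' measurableSet_Ioi]
  filter_upwards [hdiff, ae_all_iff.2 hloc] with t h1 h2 ht
  obtain ⟨n, hn⟩ := exists_nat_gt (t - t₀)
  have h3 := h2 n ⟨ht, by linarith⟩
  exact ⟨h1 ht, h3.1, h3.2 (h1 ht)⟩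

end DegenerateEinstein

end

theorem mainTheorem6 (N : ℕ) (hN : 2 ≤ N)
    (Ω : Set (DegenerateEinstein.E N)) (hΩ : IsOpen Ω) (hΩb : Bornology.IsBounded Ω)
    (p₁ q₁ γ₁ β₁ β₂ c₃ c₅ δ₁ δ₂ p₂ p₃ : ℝ)
    (hp₁ : 0 < p₁) (hq₁ : 0 < q₁) (hγ₁ : 0 < γ₁) (hc₃ : 0 < c₃) (hc₅ : 0 < c₅)
    (hβ : β₂ < β₁) (hβ₂ : q₁ / 2 < β₂)
    (hδ₁ : δ₁ = DegenerateEinstein.delta1 p₁ γ₁) (hδ₁_ge : 1 ≤ δ₁) (hδ₁_lt : δ₁ < 2)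
    (hδ₂ : δ₂ = DegenerateEinstein.delta2 N δ₁)
    (hp₂ : p₂ = DegenerateEinstein.zExponent β₁ q₁ δ₂)
    (hp₃ : p₃ = DegenerateEinstein.zExponent β₂ q₁ δ₂) :
    ∃ K : ℝ, 0 < K ∧
      ∀ h a : ℝ → ℝ, DegenerateEinstein.IsAdmissible h a →
        DegenerateEinstein.LowerGrowth h a p₁ q₁ c₃ →
        DegenerateEinstein.UpperGrowth h γ₁ β₁ β₂ c₅ →
      ∀ (t₀ : ℝ) (u₀ : DegenerateEinstein.E N → ℝ) (u : DegenerateEinstein.E N → ℝ → ℝ),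
        DegenerateEinstein.IsStrongSolution h a Ω t₀ u₀ u →
        MemLp (fun x => DegenerateEinstein.H h (u₀ x)) (ENNReal.ofReal (p₁ + 1))
          (volume.restrict Ω) →
        (∀ᵐ t ∂volume.restrict (Ioi t₀), DegenerateEinstein.MemW0 2 Ω
          (fun x => DegenerateEinstein.H h (u x t) ^ p₁ * DegenerateEinstein.F h a (u x t))) →
        (∀ t, t₀ ≤ t →
          IntegrableOn (fun x => DegenerateEinstein.H h (u x t) ^ (p₁ + 1)) Ω) ∧
        AntitoneOn (DegenerateEinstein.Y h Ω p₁ u) (Ici t₀) ∧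
        ∀ᵐ t ∂volume.restrict (Ioi t₀),
          DifferentiableAt ℝ (DegenerateEinstein.Y h Ω p₁ u) t ∧
          deriv (DegenerateEinstein.Y h Ω p₁ u) t +
            K * ((DegenerateEinstein.Z h Ω p₂ u t + DegenerateEinstein.Z h Ω p₃ u t + 1) ^
                (-((2 - δ₂) / δ₂))).toReal *
              DegenerateEinstein.Y h Ω p₁ u t ^ (2 / δ₁) ≤ 0 := by
  obtain ⟨κ, hκ, hbound⟩ := DegenerateEinstein.exists_dissipation_bound hN hΩ hΩb hp₁ hq₁ hγ₁ hβ hβ₂ hc₃ hc₅ hδ₁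
    hδ₁_ge hδ₁_lt hδ₂ hp₂ hp₃
  refine ⟨κ, hκ, fun h a hA hlow hup t₀ u₀ u hu hu₀ hW => ?_⟩
  obtain ⟨hum, hun, hui, huW, v, L, hv, hvp, hΔ, hL, hle⟩ := hu
  have D : DegenerateEinstein.EvolutionData h a Ω t₀ u₀ u v L :=
    ⟨hum, hun, hui, hv, hvp, hL, hle⟩
  have hfinite : IsFiniteMeasure (volume.restrict Ω) := ⟨by
    rw [Measure.restrict_apply_univ]; exact hΩb.measure_lt_top⟩
  have hq : 1 ≤ ENNReal.ofReal (p₁ + 1) := by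
    rw [← ENNReal.ofReal_one]; exact ENNReal.ofReal_le_ofReal (by linarith)
  have hH₀ := hu₀.integrable hq
  have hfix := ((((ae_restrict_mem (μ := volume) (measurableSet_Ioi (a := t₀))).and huW).and
    hΔ).and (D.ae_memLp_section.and hW)).mono fun t ht =>
    hbound h a hA hlow hup (fun x => u x t) (fun x => L x t) (hun t (le_of_lt ht.1.1.1)) ht.1.1.2
      ht.1.2 ht.2.1 ht.2.2
  have henergy := fun s t hs hst => D.energy_le hA hH₀ hp₁ (s := s) (t := t)
    (hfix.mono fun t ht => ht.1) hs hst
  have hY₀ : ∫⁻ x in Ω, ENNReal.ofReal (DegenerateEinstein.H h (u x t₀) ^ (p₁ + 1)) < ⊤ := by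
    have h1 := lintegral_rpow_enorm_lt_top_of_eLpNorm_lt_top
      (zero_lt_one.trans_le hq).ne' ENNReal.ofReal_ne_top hu₀.2
    rw [ENNReal.toReal_ofReal (by linarith)] at h1
    refine (lintegral_congr_ae ?_).trans_lt h1
    filter_upwards [hui, D.H_nonneg hA le_rfl] with x hx hx0
    rw [← hx, ← ofReal_norm, Real.norm_of_nonneg hx0,
      ENNReal.ofReal_rpow_of_nonneg hx0 (by linarith)]
  -- Finiteness propagates from t₀ because the energy inequality holds in [0, ∞] without assuming
  -- it.
  have hYtop : ∀ t, t₀ ≤ t →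
      ∫⁻ x in Ω, ENNReal.ofReal (DegenerateEinstein.H h (u x t) ^ (p₁ + 1)) ≠ ⊤ := fun t ht =>
    ((le_self_add.trans (henergy t₀ t le_rfl ht)).trans_lt hY₀).ne
  have hpow : ∀ t, t₀ ≤ t → ∀ᵐ x ∂volume.restrict Ω,
      0 ≤ DegenerateEinstein.H h (u x t) ^ (p₁ + 1) := fun t ht =>
    (D.H_nonneg hA ht).mono fun x hx => Real.rpow_nonneg hx _
  have hYint : ∀ t, t₀ ≤ t →
      IntegrableOn (fun x => DegenerateEinstein.H h (u x t) ^ (p₁ + 1)) Ω := by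
    intro t ht
    refine ⟨((D.integrable_H hA hH₀ ht).1.aemeasurable.pow_const _).aestronglyMeasurable, ?_⟩
    rw [hasFiniteIntegral_iff_ofReal (hpow t ht)]
    exact (hYtop t ht).lt_top
  have hYeq : ∀ t, t₀ ≤ t → ENNReal.ofReal (DegenerateEinstein.Y h Ω p₁ u t) =
      ∫⁻ x in Ω, ENNReal.ofReal (DegenerateEinstein.H h (u x t) ^ (p₁ + 1)) := fun t ht =>
    ofReal_integral_eq_lintegral_ofReal (hYint t ht) (hpow t ht)
  have hY0 : ∀ t, t₀ ≤ t → 0 ≤ DegenerateEinstein.Y h Ω p₁ u t := fun t ht =>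
    integral_nonneg_of_ae (hpow t ht)
  obtain ⟨hanti, hderiv⟩ := DegenerateEinstein.ae_deriv_add_le
    (D.aemeasurable_dissipation hA hH₀ hp₁) hY0 fun s t hs hst => by
      rw [hYeq t (hs.trans hst), hYeq s hs]
      exact henergy s t hs hst
  refine ⟨hYint, hanti, ?_⟩
  filter_upwards [hderiv, hfix, ae_restrict_mem measurableSet_Ioi] with t h1 h2 ht
  have ht' : t₀ ≤ t := le_of_lt ht
  refine ⟨h1.1, le_trans ?_ h1.2.2⟩
  -- The dissipation is finite at almost every time, so the lower bound by the moments passes to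
  -- real numbers; there Z₁ + Z₂ = ∞ contributes 0.
  have h3 := ENNReal.toReal_mono h1.2.1 (h2.2 (hYtop t ht'))
  rw [ENNReal.toReal_mul, ENNReal.toReal_mul, ENNReal.toReal_ofReal hκ.le, ← hYeq t ht',
    ← ENNReal.toReal_rpow, ENNReal.toReal_ofReal (hY0 t ht')] at h3
  refine add_le_add le_rfl (le_trans (le_of_eq ?_) h3)
  rw [DegenerateEinstein.Z, DegenerateEinstein.Z]
  ring
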